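/- Let $0<q<1$, $g>0$, $t=q^g$, let $\xi\in\mathbb C\setminus\{0\}$, and let $\lambda=(\lambda_1,\lambda_2)\in\mathbb Z^2$ with $\lambda_1\le\lambda_2$; put $|\lambda|=\lambda_1+\lambda_2$, $\lambda_{21}=\lambda_2-\lambda_1$. Notation. $(a;q)_n=\prod_{i=0}^{n-1}(1-aq^i)$, $(a;q)_\infty=\prod_{i\ge0}(1-aq^i)$, with $(a_1,\dots,a_m;q)=\prod_j(a_j;q)$. Put $\mathcal L(\nu;x,y)=(\nu xy,\nu xy^{-1},\nu x^{-1}y,\nu x^{-1}y^{-1};q)_\infty$, $\Gamma_q(x)=(1-q)^{1-x}(q;q)_\infty/(q^x;q)_\infty$, $B_q(x,y)=\Gamma_q(x)\Gamma_q(y)/\Gamma_q(x+y)$. The continuous $q$-ultraspherical polynomials are $$C_n(\cos\theta;\beta|q)=\sum_{k=0}^n\frac{(\beta;q)_k(\beta;q)_{n-k}}{(q;q)_k(q;q)_{n-k}}e^{i(n-2k)\theta}.$$ The $A_1$ Macdonald polynomials are $$P_\lambda(x_1,x_2)=x_+^{|\lambda|}\frac{(q;q)_{\lambda_{21}}}{(t;q)_{\lambda_{21}}}C_{\lambda_{21}}\Big(\tfrac{x_-+x_-^{-1}}2;t\,\Big|\,q\Big),\qquad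 x_1=x_+x_-,\ x_2=x_+/x_-,$$ and the separated polynomials are $$f_\lambda(y)=y^{\lambda_1}\,{}_2\phi_1\left[\begin{matrix}t,\ q^{-\lambda_{21}}\\ t^{-1}q^{1-\lambda_{21}}\end{matrix};q,t^{-2}qy\right].$$ The operator. For non-zero $y_1,y_2\in\mathbb C$ choose $y_\pm$ with $y_+y_-=y_1$, $y_+/y_-=y_2$, let $$\mathcal M(y_+,y_-|z)=\frac{(1-q)(q;q)_\infty^2(z^2,z^{-2};q)_\infty\,\mathcal L(t;y_-,t^{-1}y_+)}{2B_q(g,g)\,\mathcal L(t^{1/2};y_-,z)\,\mathcal L(t^{1/2};z,t^{-1}y_+)},$$ and set $$(M_\xi f)(y_1,y_2)=\frac1{2\pi i}\int_\Gamma\frac{dz}z\,\mathcal M(y_+,y_-|z)\,f(t^{-1/2}\xi y_+z,\,t^{-1/2}\xi y_+z^{-1}).$$ Here, with the parameter set $S=\{t^{1/2}y_-,\ t^{1/2}y_-^{-1},\ t^{-1/2}y_+,\ t^{3/2}y_+^{-1}\}$, the contour is $\Gamma=C_{0,1}+\sum_p(C_{p,\varepsilon}-C_{p^{-1},\varepsilon})$,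 where $C_{c,r}$ is the positively oriented circle with centre $c$ and radius $r$, $p$ runs over the distinct points $sq^k$ ($s\in S$, $k\ge0$) with $|sq^k|>1$, and $\varepsilon>0$ is so small that each closed disc of radius $\varepsilon$ about such a $p$ or $p^{-1}$ contains none of the points $sq^k$, $s^{-1}q^{-k}$ ($s\in S$, $k\ge 0$) other than its centre. The pair $(y_+,y_-)$ is called generic if no $sq^k$ lies on the unit circle and no $sq^k$ equals an $s'^{-1}q^{-k'}$ ($s,s'\in S$, $k,k'\ge0$). Theorem. (i) For all non-zero $y_1,y_2\in\mathbb C$ and every choice of $y_\pm$ as above such that $(y_+,y_-)$ is generic, all sufficiently small $\varepsilon>0$ are admissible in the definition of $\Gamma$, and for every admissible $\varepsilon$ $$(M_\xi P_\lambda)(y_1,y_2)=c_{\lambda,\xi}\,f_\lambda(y_1)f_\lambda(y_2),\qquad c_{\lambda,\xi}=t^{-2\lambda_1+\lambda_2}\,\xi^{|\lambda|}\,\frac{(t;q)_{\lambda_{21}}}{(t^2;q)_{\lambda_{21}}}.$$ (ii) For all real $\theta,\varphi$ the pair $y_+=te^{-i(\theta+\varphi)}$, $y_-=e^{i(\varphi-\theta)}$,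 for which $y_1=te^{-2i\theta}$ and $y_2=te^{-2i\varphi}$, is generic (and $\Gamma=C_{0,1}$), and the identity in (i) at this point is equivalent to the product formula, with $n=\lambda_{21}$, $\beta=t$, $u=\cos\theta$, $v=\cos\varphi$, $$C_n(u;\beta|q)\,C_n(v;\beta|q)=\frac{(\beta^2;q)_n}{(q;q)_n}\beta^{-n/2}\int_{-1}^1K(u,v,w)\,C_n(w;\beta|q)\,dw,$$ where, for $w=\cos\psi$, $$K(u,v,w)=\frac{(q,\beta,\beta;q)_\infty\,|(\beta e^{2i\theta},\beta e^{2i\varphi};q)_\infty|^2}{2\pi(\beta^2;q)_\infty\sqrt{1-w^2}}\cdot\frac{(e^{2i\psi},e^{-2i\psi};q)_\infty}{\prod_{a\in A}(ae^{i\psi},ae^{-i\psi};q)_\infty},$$ and $A$ is the list $\beta^{1/2}e^{i(\theta+\varphi)},\ \beta^{1/2}e^{-i(\theta+\varphi)},\ \beta^{1/2}e^{i(\theta-\varphi)},\ \beta^{1/2}e^{i(\varphi-\theta)}$ (with multiplicity). In particular, the product formula holds. -/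

import Mathlib

open scoped Real

noncomputable section

namespace SepVar

/-- The finite `q`-shifted factorial `(a; q)_n`. -/
def qPoch (a q : ℂ) (n : ℕ) : ℂ := ∏ i ∈ Finset.range n, (1 - a * q ^ i)

/-- The infinite `q`-shifted factorial `(a; q)_∞`. -/
def qPochInf (a q : ℂ) : ℂ := ∏' i : ℕ, (1 - a * q ^ i)

/-- The basic hypergeometric series `₂φ₁[a, b; c; q, z]`. -/
def phi21 (a b c q z : ℂ) : ℂ :=
  ∑' k : ℕ, qPoch a q k * qPoch b q k / (qPoch q q k * qPoch c q k) * z ^ k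

/-- The `q`-gamma function `Γ_q(x) = (1 - q)^{1-x} (q; q)_∞ / (q^x; q)_∞`. -/
def qGamma (q x : ℝ) : ℂ :=
  (((1 - q) ^ (1 - x) : ℝ) : ℂ) * qPochInf q q / qPochInf ((q ^ x : ℝ) : ℂ) q

/-- The `q`-beta function `B_q(x, y) = Γ_q(x) Γ_q(y) / Γ_q(x + y)`. -/
def qBeta (q x y : ℝ) : ℂ := qGamma q x * qGamma q y / qGamma q (x + y)

/-- `∑_{k=0}^n (β;q)_k (β;q)_{n-k} / ((q;q)_k (q;q)_{n-k}) u^{n-2k}`; with `u = e^{iθ}` this is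
the continuous `q`-ultraspherical polynomial of degree `n` at `cos θ`. -/
def qUltraExp (q β : ℂ) (n : ℕ) (u : ℂ) : ℂ :=
  ∑ k ∈ Finset.range (n + 1),
    qPoch β q k * qPoch β q (n - k) / (qPoch q q k * qPoch q q (n - k)) *
      u ^ ((n : ℤ) - 2 * (k : ℤ))

/-- The continuous `q`-ultraspherical polynomial `C_n(x; β | q)`, `x = cos θ`, where
`e^{iθ} = x + (x² - 1)^{1/2}`. The value does not depend on the choice of the root,
see `qUltra_joukowski`. -/
def qUltra (q β : ℂ) (n : ℕ) (x : ℂ) : ℂ :=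
  qUltraExp q β n (x + (x ^ 2 - 1) ^ (1 / 2 : ℂ))

theorem qUltraExp_inv (q β : ℂ) (n : ℕ) (u : ℂ) :
    qUltraExp q β n u⁻¹ = qUltraExp q β n u := by
  unfold qUltraExp
  rw [← Finset.sum_range_reflect]
  refine Finset.sum_congr rfl fun k hk => ?_
  have hk' : k ≤ n := by
    have := Finset.mem_range.1 hk
    omega
  have h1 : n + 1 - 1 - k = n - k := by omega
  have h2 : n - (n - k) = k := by omega
  rw [h1, h2, inv_zpow', Nat.cast_sub hk']
  have h3 : -((n : ℤ) - 2 * ((n : ℤ) - (k : ℤ))) = (n : ℤ) - 2 * (k : ℤ) := by ring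
  rw [h3]
  ring

/-- `C_n((u + u⁻¹)/2; β | q)` is the expected Laurent polynomial in `u`. -/
theorem qUltra_joukowski (q β : ℂ) (n : ℕ) (u : ℂ) (hu : u ≠ 0) :
    qUltra q β n ((u + u⁻¹) / 2) = qUltraExp q β n u := by
  unfold qUltra
  set x : ℂ := (u + u⁻¹) / 2 with hx
  set s : ℂ := (x ^ 2 - 1) ^ (1 / 2 : ℂ) with hs
  have hs2 : s ^ 2 = x ^ 2 - 1 := by
    rw [hs]
    simp
  have hfac : (x + s - u) * (x + s - u⁻¹) = 0 := by
    have hxx : u + u⁻¹ = 2 * x := by rw [hx]; ring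
    have huu : u * u⁻¹ = 1 := mul_inv_cancel₀ hu
    linear_combination hs2 - (x + s) * hxx + huu
  rcases mul_eq_zero.1 hfac with h | h
  · rw [sub_eq_zero.1 h]
  · rw [sub_eq_zero.1 h, qUltraExp_inv]

/-- The `A₁` Macdonald polynomial
`P_λ(x₁, x₂) = x₊^{|λ|} (q;q)_{λ₂₁} / (t;q)_{λ₂₁} C_{λ₂₁}((x₋ + x₋⁻¹)/2; t | q)`,
`x_± = (x₁ x₂^{±1})^{1/2}` with `x₊ x₋ = x₁`, `λ = (l₁ ≤ l₂)`, `λ₂₁ = l₂ - l₁`.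
The value does not depend on the choice of the root, see `macdonaldP_eq`. -/
def macdonaldP (q t : ℝ) (l₁ l₂ : ℤ) (x₁ x₂ : ℂ) : ℂ :=
  let n : ℕ := (l₂ - l₁).toNat
  let xp : ℂ := (x₁ * x₂) ^ (1 / 2 : ℂ)
  let xm : ℂ := x₁ / xp
  xp ^ (l₁ + l₂) * (qPoch q q n / qPoch t q n) * qUltra q t n ((xm + xm⁻¹) / 2)

theorem qUltraExp_neg (q β : ℂ) (n : ℕ) (u : ℂ) :
    qUltraExp q β n (-u) = (-1) ^ (n : ℤ) * qUltraExp q β n u := by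
  unfold qUltraExp
  rw [Finset.mul_sum]
  refine Finset.sum_congr rfl fun k _ => ?_
  have h : (-u) ^ ((n : ℤ) - 2 * (k : ℤ)) = (-1) ^ (n : ℤ) * u ^ ((n : ℤ) - 2 * (k : ℤ)) := by
    rw [← neg_one_mul u, mul_zpow, zpow_sub₀ (by norm_num), zpow_mul]
    norm_num
  rw [h]
  ring

theorem macdonaldP_eq (q t : ℝ) (l₁ l₂ : ℤ) (hl : l₁ ≤ l₂) (xp xm : ℂ) (hp : xp ≠ 0)
    (hm : xm ≠ 0) :
    macdonaldP q t l₁ l₂ (xp * xm) (xp / xm) =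
      xp ^ (l₁ + l₂) * (qPoch q q (l₂ - l₁).toNat / qPoch t q (l₂ - l₁).toNat) *
        qUltra q t (l₂ - l₁).toNat ((xm + xm⁻¹) / 2) := by
  have hprod : xp * xm * (xp / xm) = xp ^ 2 := by field_simp
  simp only [macdonaldP, hprod]
  set s : ℂ := (xp ^ 2) ^ (1 / 2 : ℂ) with hs
  have hs2 : s ^ 2 = xp ^ 2 := by
    rw [hs]
    simp
  rcases sq_eq_sq_iff_eq_or_eq_neg.1 hs2 with h | h
  · rw [h, mul_div_cancel_left₀ _ hp]
  · have h1 : xp * xm / s = -xm := by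
      rw [h]; field_simp
    rw [h1, qUltra_joukowski _ _ _ _ (neg_ne_zero.2 hm), qUltra_joukowski _ _ _ _ hm,
      qUltraExp_neg, Int.toNat_of_nonneg (by omega), h]
    have h2 : (-xp) ^ (l₁ + l₂) = (-1) ^ (l₁ + l₂) * xp ^ (l₁ + l₂) := by
      rw [← neg_one_mul xp, mul_zpow]
    have h3 : ((-1 : ℂ) ^ (l₁ + l₂)) * (-1) ^ (l₂ - l₁) = 1 := by
      rw [← zpow_add₀ (by norm_num)]
      have : l₁ + l₂ + (l₂ - l₁) = 2 * l₂ := by ring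
      rw [this, zpow_mul]
      norm_num
    rw [h2]
    linear_combination (xp ^ (l₁ + l₂) * (qPoch q q (l₂ - l₁).toNat / qPoch t q (l₂ - l₁).toNat) *
      qUltraExp q t (l₂ - l₁).toNat xm) * h3

/-- The separated polynomial
`f_λ(y) = y^{λ₁} ₂φ₁[t, q^{-λ₂₁}; t^{-1} q^{1-λ₂₁}; q, t^{-2} q y]`. -/
def sepPoly (q t : ℝ) (l₁ l₂ : ℤ) (y : ℂ) : ℂ :=
  y ^ l₁ * phi21 (t : ℂ) ((q : ℂ) ^ (-(l₂ - l₁))) ((t : ℂ)⁻¹ * (q : ℂ) ^ (1 - (l₂ - l₁))) q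
    (((t : ℂ) ^ 2)⁻¹ * q * y)

/-- `c_{λ,ξ} = t^{-2λ₁+λ₂} ξ^{|λ|} (t;q)_{λ₂₁} / (t²;q)_{λ₂₁}`. -/
def sepCoeff (q t : ℝ) (ξ : ℂ) (l₁ l₂ : ℤ) : ℂ :=
  (t : ℂ) ^ (-2 * l₁ + l₂) * ξ ^ (l₁ + l₂) *
    (qPoch t q (l₂ - l₁).toNat / qPoch ((t : ℂ) ^ 2) q (l₂ - l₁).toNat)

/-- `L(ν; x, y) = (ν x y, ν x y⁻¹, ν x⁻¹ y, ν x⁻¹ y⁻¹; q)_∞`. -/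
def Lq (q ν x y : ℂ) : ℂ :=
  qPochInf (ν * x * y) q * qPochInf (ν * x * y⁻¹) q * qPochInf (ν * x⁻¹ * y) q *
    qPochInf (ν * x⁻¹ * y⁻¹) q

/-- The kernel of the separating operator, with `t = q^g`:
`(1-q) (q;q)²_∞ (z², z⁻²; q)_∞ L(t; y₋, t⁻¹y₊) /
  (2 B_q(g,g) L(t^{1/2}; y₋, z) L(t^{1/2}; z, t⁻¹y₊))`. -/
def sepKernel (q g : ℝ) (yp ym z : ℂ) : ℂ :=
  let t : ℝ := q ^ g
  (1 - (q : ℂ)) * qPochInf q q ^ 2 * (qPochInf (z ^ 2) q * qPochInf ((z ^ 2)⁻¹) q) *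
      Lq q t ym ((t : ℂ)⁻¹ * yp) /
    (2 * qBeta q g g * Lq q ((√t : ℝ) : ℂ) ym z * Lq q ((√t : ℝ) : ℂ) z ((t : ℂ)⁻¹ * yp))

/-- For a set `S` of parameters: the points `z q^k`, `z ∈ S`, `k ≥ 0`. -/
def innerPoles (q : ℂ) (S : Set ℂ) : Set ℂ := {p | ∃ z ∈ S, ∃ k : ℕ, p = z * q ^ k}

/-- For a set `S` of parameters: the points `z⁻¹ q^{-k}`, `z ∈ S`, `k ≥ 0`. -/
def outerPoles (q : ℂ) (S : Set ℂ) : Set ℂ := {p | ∃ z ∈ S, ∃ k : ℕ, p = (z * q ^ k)⁻¹}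

/-- The points `z q^k` outside the closed unit disc. -/
def largePoles (q : ℂ) (S : Set ℂ) : Set ℂ := {p | p ∈ innerPoles q S ∧ 1 < ‖p‖}

/-- The unit circle carries no zero of the denominator, and no point `z q^k` is at the same time a
point `w⁻¹ q^{-j}`. -/
def Generic (q : ℂ) (S : Set ℂ) : Prop :=
  (∀ p ∈ innerPoles q S, ‖p‖ ≠ 1) ∧ Disjoint (innerPoles q S) (outerPoles q S)

/-- `ε > 0` is so small that every circle of radius `ε` that is used in the contour encircles only
one of the zeros of the denominator, its centre. -/
def SmallRadius (q : ℂ) (S : Set ℂ) (ε : ℝ) : Prop :=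
  0 < ε ∧ ∀ p ∈ largePoles q S, ∀ s ∈ innerPoles q S ∪ outerPoles q S,
    (s ∈ Metric.closedBall p ε → s = p) ∧ (s ∈ Metric.closedBall p⁻¹ ε → s = p⁻¹)

/-- `(2πi)⁻¹ ∫_Γ F(x) dx` over the contour
`Γ = C_{0,1} + ∑_{p} (C_{p,ε} - C_{p⁻¹,ε})`, where `p` runs over the distinct points `z q^k` with
`z ∈ S`, `k ≥ 0`, `|z q^k| > 1`. -/
def contourIntegral (q : ℂ) (S : Set ℂ) (ε : ℝ) (F : ℂ → ℂ) : ℂ :=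
  (2 * (π : ℂ) * Complex.I)⁻¹ *
    ((∮ x in C(0, 1), F x) +
      ∑ᶠ p ∈ largePoles q S, ((∮ x in C(p, ε), F x) - ∮ x in C(p⁻¹, ε), F x))

/-- The parameters `y q^{α/2}, y⁻¹ q^{α/2}, r q^{β/2}, r⁻¹ q^{β/2}` of the contour for
`α = β = g`, `y = y₋`, `r = t⁻¹ y₊`, `t = q^g`. -/
def sepParams (t : ℝ) (yp ym : ℂ) : Set ℂ :=
  {ym * ((√t : ℝ) : ℂ), ym⁻¹ * ((√t : ℝ) : ℂ),
    (t : ℂ)⁻¹ * yp * ((√t : ℝ) : ℂ), ((t : ℂ)⁻¹ * yp)⁻¹ * ((√t : ℝ) : ℂ)}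

/-- The value `(M_ξ f)(y₁, y₂)` at `y₁ = y₊ y₋`, `y₂ = y₊ / y₋`, with the contour of radius `ε`. -/
def sepOp (q g : ℝ) (ξ : ℂ) (ε : ℝ) (f : ℂ → ℂ → ℂ) (yp ym : ℂ) : ℂ :=
  let t : ℝ := q ^ g
  let s : ℂ := ((√t : ℝ) : ℂ)
  contourIntegral q (sepParams t yp ym) ε fun z =>
    z⁻¹ * (sepKernel q g yp ym z * f (s⁻¹ * ξ * yp * z) (s⁻¹ * ξ * yp * z⁻¹))

/-- The Askey–Wilson weight `w(x; a, b, c, d)`. -/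
def awWeight (q x a b c d : ℂ) : ℂ :=
  qPochInf (x ^ 2) q * qPochInf ((x ^ 2)⁻¹) q /
    (qPochInf (a * x) q * qPochInf (a * x⁻¹) q * qPochInf (b * x) q * qPochInf (b * x⁻¹) q *
      qPochInf (c * x) q * qPochInf (c * x⁻¹) q * qPochInf (d * x) q * qPochInf (d * x⁻¹) q)

/-- `e^{iθ}`. -/
def expI (θ : ℝ) : ℂ := Complex.exp (θ * Complex.I)

/-- The kernel `K(u, v, w; β | q)` of the product formula for the continuous `q`-ultraspherical
polynomials, `u = cos θ`, `v = cos φ`, `w = cos ψ`. -/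
def productKernel (q β u v w : ℝ) : ℂ :=
  let θ := Real.arccos u
  let φ := Real.arccos v
  let ψ := Real.arccos w
  let s : ℂ := ((√β : ℝ) : ℂ)
  qPochInf q q * qPochInf β q ^ 2 *
      ((‖qPochInf (β * expI (2 * θ)) q * qPochInf (β * expI (2 * φ)) q‖ ^ 2 : ℝ) : ℂ) /
    (2 * (π : ℂ) * qPochInf ((β : ℂ) ^ 2) q * ((√(1 - w ^ 2) : ℝ) : ℂ)) *
    awWeight q (expI ψ) (s * expI (θ + φ)) (s * expI (-θ - φ)) (s * expI (θ - φ))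
      (s * expI (φ - θ))

/-- The product formula at `u, v ∈ [-1, 1]`:
`C_n(u) C_n(v) = (β²;q)_n / (q;q)_n β^{-n/2} ∫_{-1}^1 K(u, v, w) C_n(w) dw`. -/
def ProductFormulaAt (q β : ℝ) (n : ℕ) (u v : ℝ) : Prop :=
  qUltra q β n u * qUltra q β n v =
    qPoch ((β : ℂ) ^ 2) q n / qPoch q q n * ((β ^ (-((n : ℝ) / 2)) : ℝ) : ℂ) *
      ∫ w in (-1 : ℝ)..1, productKernel q β u v w * qUltra q β n w

end SepVar

end

/-!
Both parts come from one identity, the product formula as a contour integral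
(`sepNorm_mul_awIntegral`). Put `s = √t` and write `y₁ = t u²`, `y₂ = t v²` with `u / v = y₋` and
`t u v = y₊`. The integrand of `M_ξ P_λ` is then a constant times `C_n(z)` times the Askey–Wilson
weight with parameters `s u / v`, `s v / u`, `s u v`, `s / (u v)`, and `f_λ(y₁)`, `f_λ(y₂)` are
elementary multiples of `C_n(u)`, `C_n(v)` (`sepPoly_mul_sq`), where `C_n(z)` stands for the Laurent
polynomial `qUltraExp q t n z`. What has to be shown is that the normalized Askey–Wilson functional
with these parameters maps `C_n` to `sⁿ (q; q)_n / (t²; q)_n C_n(u) C_n(v)`.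

*Moments of the weight.* On the basis `∏_{i<k} (1 - a qⁱ z) (1 - a qⁱ / z)` the functional is found
by shifting parameters: a factor of the basis is absorbed by the weight, and
`I(a q, b, c, d) / I(a, b, c, d)` follows from the first moment of the weight, which is the integral
of a `q`-difference (`awIntegral_first_moment`). This needs that the contour integral of `G(z) dz / z`
is invariant under `z ↦ q z` if no pole is crossed (`contourIntegral_comp_mul`), which is read off
from a partial fraction expansion: the contour separates the points `s q^k` from their inverses.
Shifting all four parameters to `0` shows that the integral is a universal constant times its
expected value, and the parameters `q, -q, √q, -√q`, for which the weight is a Laurent polynomial,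
give the constant (`awIntegral_one`).

*The product formula.* The moments imply that the functional intertwines the `q`-difference operator
with eigenfunctions `C_n(z)` (the `A₁` Macdonald operator) with the same operator acting on the
variable `u` (`exists_sepFunctional_intertwine`). Hence the image of `C_n` is a Laurent polynomial
eigenfunction in `u`; as the eigenvalues are distinct, it is a multiple of `C_n(u)`
(`IsLaurent.eq_mul_qUltraExp`). The factor is determined at `u = 1 / s`, where one of the parameter
products is `1`, the functional is the evaluation at `v` (`sepFunctional_inv`), and `C_n(1 / s)` has
a closed form (`qUltraExp_principal`).

For `|u| = |v| = 1` the contour is the unit circle, and the substitution `w = cos ψ` turns the same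
identity into the product formula on `[-1, 1]` (`productFormulaAt`).
-/

namespace SepVar

/-! ### The infinite `q`-shifted factorial -/

section qPochInf

variable {q : ℂ}

theorem summable_neg_mul_pow (hq : ‖q‖ < 1) (a : ℂ) : Summable fun i : ℕ => ‖-(a * q ^ i)‖ := by
  simpa [norm_mul, norm_pow] using (summable_geometric_of_lt_one (norm_nonneg q) hq).mul_left ‖a‖

theorem multipliable_one_sub_mul_pow (hq : ‖q‖ < 1) (a : ℂ) :
    Multipliable fun i : ℕ => 1 - a * q ^ i := by
  simpa [sub_eq_add_neg] using multipliable_one_add_of_summable (summable_neg_mul_pow hq a)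

theorem qPochInf_eq_mul (hq : ‖q‖ < 1) (a : ℂ) :
    qPochInf a q = (1 - a) * qPochInf (a * q) q := by
  have h : Multipliable fun i : ℕ => 1 - a * q ^ (i + 1) := by
    simpa [pow_succ', mul_assoc] using multipliable_one_sub_mul_pow hq (a * q)
  have h2 : qPochInf a q = (1 - a * q ^ 0) * ∏' i : ℕ, (1 - a * q ^ (i + 1)) :=
    tprod_eq_zero_mul' (f := fun i : ℕ => 1 - a * q ^ i) h
  have h3 : qPochInf (a * q) q = ∏' i : ℕ, (1 - a * q ^ (i + 1)) :=
    tprod_congr fun i => by ring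
  rw [h2, h3, pow_zero, mul_one]

theorem qPochInf_ne_zero (hq : ‖q‖ < 1) {a : ℂ} (ha : ∀ k : ℕ, a * q ^ k ≠ 1) :
    qPochInf a q ≠ 0 := by
  have := tprod_one_add_ne_zero_of_summable (f := fun i : ℕ => -(a * q ^ i))
    (fun i => by
      have := sub_ne_zero.2 (ha i).symm
      simpa [sub_eq_add_neg] using this) (summable_neg_mul_pow hq a)
  simpa [qPochInf, sub_eq_add_neg] using this

theorem qPochInf_ne_zero_of_norm_lt_one (hq : ‖q‖ < 1) {a : ℂ} (ha : ‖a‖ < 1) :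
    qPochInf a q ≠ 0 := by
  refine qPochInf_ne_zero hq fun k hk => ?_
  have h1 : ‖a * q ^ k‖ = 1 := by rw [hk, norm_one]
  rw [norm_mul, norm_pow] at h1
  have h2 : ‖q‖ ^ k ≤ 1 := pow_le_one₀ (norm_nonneg _) hq.le
  nlinarith [norm_nonneg a]

theorem qPochInf_zero_left : qPochInf 0 q = 1 := by simp [qPochInf]

theorem differentiable_qPochInf (hq : ‖q‖ < 1) : Differentiable ℂ fun a => qPochInf a q := by
  have key : HasProdLocallyUniformlyOn (fun (i : ℕ) (a : ℂ) => 1 + -(a * q ^ i))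
      (fun a => ∏' i : ℕ, (1 + -(a * q ^ i))) Set.univ := by
    refine hasProdLocallyUniformlyOn_of_forall_compact isOpen_univ fun K _ hK => ?_
    obtain ⟨M, hM⟩ := hK.isBounded.exists_norm_le
    refine Summable.hasProdUniformlyOn_nat_one_add (u := fun i => |M| * ‖q‖ ^ i) hK
      ((summable_geometric_of_lt_one (norm_nonneg q) hq).mul_left _) ?_ ?_
    · refine Filter.Eventually.of_forall fun i a ha => ?_
      rw [norm_neg, norm_mul, norm_pow]
      gcongr
      exact (hM a ha).trans (le_abs_self M)
    · intro i
      fun_prop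
  have h2 := key.differentiableOn (.of_forall fun s => by
    simpa [Finset.prod_fn] using
      DifferentiableOn.finsetProd (fun _ _ => by fun_prop)) isOpen_univ
  rw [differentiableOn_univ] at h2
  simpa [qPochInf, sub_eq_add_neg] using h2

theorem continuous_qPochInf (hq : ‖q‖ < 1) : Continuous fun a => qPochInf a q :=
  (differentiable_qPochInf hq).continuous

theorem conj_qPochInf (a q : ℂ) :
    (starRingEnd ℂ) (qPochInf a q) = qPochInf ((starRingEnd ℂ) a) ((starRingEnd ℂ) q) := by
  unfold qPochInf
  have h := Function.LeftInverse.map_tprod (f := fun i : ℕ => 1 - a * q ^ i)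
    (L := .unconditional ℕ) (g := (starRingEnd ℂ)) (g' := (starRingEnd ℂ))
    (hg := RCLike.continuous_conj) (hg' := RCLike.continuous_conj) (fun x => Complex.conj_conj x)
  simpa using h

/-- `(a; q)_∞ (-a; q)_∞ = (a²; q²)_∞`. -/
theorem qPochInf_mul_qPochInf_neg (hq : ‖q‖ < 1) (a : ℂ) :
    qPochInf a q * qPochInf (-a) q = qPochInf (a ^ 2) (q ^ 2) := by
  unfold qPochInf
  rw [← (multipliable_one_sub_mul_pow hq a).tprod_mul (multipliable_one_sub_mul_pow hq (-a))]
  refine tprod_congr fun i => ?_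
  ring

/-- `(a; q²)_∞ (a q; q²)_∞ = (a; q)_∞`. -/
theorem qPochInf_sq_mul (hq : ‖q‖ < 1) (a : ℂ) :
    qPochInf a (q ^ 2) * qPochInf (a * q) (q ^ 2) = qPochInf a q := by
  have hq2 : ‖q ^ 2‖ < 1 := by
    rw [norm_pow]
    exact pow_lt_one₀ (norm_nonneg _) hq two_ne_zero
  have he : Multipliable fun k : ℕ => 1 - a * q ^ (2 * k) := by
    simpa [pow_mul] using multipliable_one_sub_mul_pow hq2 a
  have ho : Multipliable fun k : ℕ => 1 - a * q ^ (2 * k + 1) := by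
    refine (multipliable_one_sub_mul_pow hq2 (a * q)).congr fun i => ?_
    rw [← pow_mul]
    ring
  have h1 : qPochInf a (q ^ 2) = ∏' k : ℕ, (1 - a * q ^ (2 * k)) :=
    tprod_congr fun i => by rw [pow_mul]
  have h2 : qPochInf (a * q) (q ^ 2) = ∏' k : ℕ, (1 - a * q ^ (2 * k + 1)) :=
    tprod_congr fun i => by rw [← pow_mul]; ring
  rw [h1, h2]
  exact tprod_even_mul_odd (f := fun i : ℕ => 1 - a * q ^ i) he ho

end qPochInf

/-! ### The finite `q`-shifted factorial -/

section qPoch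

theorem qPoch_zero (a q : ℂ) : qPoch a q 0 = 1 := by simp [qPoch]

theorem qPoch_succ (a q : ℂ) (n : ℕ) : qPoch a q (n + 1) = qPoch a q n * (1 - a * q ^ n) := by
  simp [qPoch, Finset.prod_range_succ]

theorem qPoch_succ' (a q : ℂ) (n : ℕ) : qPoch a q (n + 1) = (1 - a) * qPoch (a * q) q n := by
  simp only [qPoch, Finset.prod_range_succ', pow_zero, mul_one, pow_succ']
  rw [mul_comm]
  simp only [mul_assoc]

theorem qPoch_ne_zero_iff {a q : ℂ} {n : ℕ} : qPoch a q n ≠ 0 ↔ ∀ i < n, a * q ^ i ≠ 1 := by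
  simp only [qPoch, Finset.prod_ne_zero_iff, sub_ne_zero, Finset.mem_range]
  exact forall₂_congr fun i _ => ne_comm

theorem qPoch_ne_zero_of_norm_lt_one {a q : ℂ} (hq : ‖q‖ < 1) (ha : ‖a‖ < 1) (n : ℕ) :
    qPoch a q n ≠ 0 := by
  rw [qPoch_ne_zero_iff]
  intro k _ hk
  have h1 : ‖a * q ^ k‖ = 1 := by rw [hk, norm_one]
  rw [norm_mul, norm_pow] at h1
  have h2 : ‖q‖ ^ k ≤ 1 := pow_le_one₀ (norm_nonneg _) hq.le
  nlinarith [norm_nonneg a]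

end qPoch

end SepVar

namespace SepVar

/-! ### Partial fractions with finitely many poles -/

section PartialFractions

/-- At a pole of order at most `n`, the term of order one is a simple fraction and those of higher
order are the derivative of `Q`. -/
theorem exists_principal_part_aux {U : Set ℂ} (hU : IsOpen U) {p : ℂ} (hp : p ∈ U) (n : ℕ) :
    ∀ {H : ℂ → ℂ}, DifferentiableOn ℂ H (U \ {p}) →
      AnalyticAt ℂ (fun z => (z - p) ^ n • H z) p →
      ∃ (c : ℂ) (Q h : ℂ → ℂ), (∀ z, z ≠ p → DifferentiableAt ℂ Q z) ∧ DifferentiableOn ℂ h U ∧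
        ∀ z ∈ U \ {p}, H z = c / (z - p) + deriv Q z + h z := by
  have hUp : IsOpen (U \ {p}) := hU.sdiff isClosed_singleton
  induction n with
  | zero =>
    intro H hd ha
    refine ⟨0, fun _ => 0, H, fun z _ => differentiableAt_const _, fun z hz => ?_, by simp⟩
    rcases eq_or_ne z p with rfl | hzp
    · have : AnalyticAt ℂ H z := by simpa using ha
      exact this.differentiableAt.differentiableWithinAt
    · exact (hd.differentiableAt (hUp.mem_nhds ⟨hz, hzp⟩)).differentiableWithinAt
  | succ n ih =>
    intro H hd ha
    set g : ℂ → ℂ := fun z => (z - p) ^ (n + 1) • H z with hg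
    have hgp : g p = 0 := by simp [hg]
    have hgd : DifferentiableOn ℂ g U := by
      intro z hz
      rcases eq_or_ne z p with rfl | hzp
      · exact ha.differentiableAt.differentiableWithinAt
      · have := hd.differentiableAt (hUp.mem_nhds ⟨hz, hzp⟩)
        exact DifferentiableAt.differentiableWithinAt (by fun_prop)
    have hsd : DifferentiableOn ℂ (dslope g p) U :=
      (Complex.differentiableOn_dslope (hU.mem_nhds hp)).2 hgd
    have hsan : AnalyticAt ℂ (dslope g p) p := hsd.analyticAt (hU.mem_nhds hp)
    have hsl : ∀ z, z ≠ p → dslope g p z = (z - p) ^ n * H z := by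
      intro z hz
      have hz' : z - p ≠ 0 := sub_ne_zero.2 hz
      rw [dslope_of_ne _ hz, slope_def_field, hgp, hg]
      simp only [smul_eq_mul]
      field_simp
      ring
    rcases Nat.eq_zero_or_pos n with rfl | hn
    · refine ⟨0, fun _ => 0, dslope g p, fun z _ => differentiableAt_const _, hsd, ?_⟩
      intro z hz
      rw [hsl z hz.2]
      simp
    set c' : ℂ := dslope g p p with hc'
    -- remove the term of order `n`
    have hd1 : DifferentiableOn ℂ (fun z => H z - c' * ((z - p) ^ n)⁻¹) (U \ {p}) := by
      refine hd.sub fun z hz => ?_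
      have : (z - p) ^ n ≠ 0 := pow_ne_zero _ (sub_ne_zero.2 hz.2)
      exact DifferentiableAt.differentiableWithinAt (by fun_prop (disch := assumption))
    have ha1 : AnalyticAt ℂ (fun z => (z - p) ^ n • (H z - c' * ((z - p) ^ n)⁻¹)) p := by
      have : (fun z => (z - p) ^ n • (H z - c' * ((z - p) ^ n)⁻¹)) =
          fun z => dslope g p z - c' := by
        funext z
        rcases eq_or_ne z p with rfl | hz
        · simp [hn.ne', hc']
        · have hz' : (z - p) ^ n ≠ 0 := pow_ne_zero _ (sub_ne_zero.2 hz)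
          rw [hsl z hz, smul_eq_mul]
          field_simp
      rw [this]
      exact hsan.sub analyticAt_const
    obtain ⟨c, Q, h, hQ, hh, hrep⟩ := ih hd1 ha1
    rcases Nat.lt_or_ge n 2 with hn2 | hn2
    · obtain rfl : n = 1 := by omega
      refine ⟨c + c', Q, h, hQ, hh, fun z hz => ?_⟩
      have := hrep z hz
      rw [pow_one] at this
      rw [add_div, div_eq_mul_inv c']
      linear_combination this
    · obtain ⟨m, rfl⟩ : ∃ m, n = m + 2 := ⟨n - 2, by omega⟩
      set R : ℂ → ℂ := fun z => -c' / (m + 1) * ((z - p) ^ (m + 1))⁻¹ with hR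
      have hRd : ∀ z, z ≠ p → HasDerivAt R (c' * ((z - p) ^ (m + 2))⁻¹) z := by
        intro z hz
        have hz' : z - p ≠ 0 := sub_ne_zero.2 hz
        have h1 : HasDerivAt (fun z => (z - p) ^ (m + 1)) ((↑(m + 1) : ℂ) * (z - p) ^ m * 1) z := by
          simpa using ((hasDerivAt_id z).sub_const p).fun_pow (m + 1)
        have h2 := (h1.inv (pow_ne_zero _ hz')).const_mul (-c' / (m + 1))
        refine h2.congr_deriv ?_
        have hm : ((m : ℂ) + 1) ≠ 0 := by exact_mod_cast Nat.succ_ne_zero m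
        push_cast
        field_simp
        ring
      refine ⟨c, fun z => Q z + R z, h, fun z hz => (hQ z hz).add (hRd z hz).differentiableAt,
        hh, fun z hz => ?_⟩
      have h1 := hrep z hz
      have h2 : deriv (fun z => Q z + R z) z = deriv Q z + c' * ((z - p) ^ (m + 2))⁻¹ :=
        ((hQ z hz.2).hasDerivAt.add (hRd z hz.2)).deriv
      rw [h2]
      linear_combination h1

/-- A function that is meromorphic on `U` with finitely many poles is a sum of simple fractions,
a derivative, and a holomorphic function. The coefficients `c p` are the residues. -/
theorem exists_partial_fraction {U : Set ℂ} (hU : IsOpen U) (T : Finset ℂ) :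
    ∀ {H : ℂ → ℂ}, ↑T ⊆ U → DifferentiableOn ℂ H (U \ T) → (∀ p ∈ T, MeromorphicAt H p) →
      ∃ (c Q h : ℂ → ℂ), (∀ z, z ∉ T → DifferentiableAt ℂ Q z) ∧ DifferentiableOn ℂ h U ∧
        ∀ z ∈ U \ T, H z = ∑ p ∈ T, c p / (z - p) + deriv Q z + h z := by
  classical
  induction T using Finset.induction_on with
  | empty =>
    intro H _ hd _
    exact ⟨0, 0, H, fun z _ => differentiableAt_const 0, by simpa using hd, by simp⟩
  | insert p T hpT ih =>
    intro H hTU hd hm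
    have hTU' : ↑T ⊆ U := fun z hz => hTU (by simp [Finset.mem_coe.1 hz])
    have hUT : IsOpen (U \ T) := hU.sdiff T.finite_toSet.isClosed
    have hset : (U \ ↑T) \ {p} = U \ ↑(insert p T) := by
      ext z
      simp only [Set.mem_sdiff, Set.mem_singleton_iff, Finset.coe_insert, Set.mem_insert_iff]
      tauto
    obtain ⟨n, hn⟩ := hm p (by simp)
    obtain ⟨c₀, Q₀, h₀, hQ₀, hh₀, hrep₀⟩ := exists_principal_part_aux hUT
      (⟨hTU (by simp), by simpa using hpT⟩ : p ∈ U \ ↑T) n (hset ▸ hd) hn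
    have hm₀ : ∀ p' ∈ T, MeromorphicAt h₀ p' := by
      intro p' hp'
      have hne : p' ≠ p := fun h => hpT (h ▸ hp')
      have h1 : MeromorphicAt (fun z => H z - (c₀ / (z - p) + deriv Q₀ z)) p' := by
        have hQan : AnalyticAt ℂ Q₀ p' := by
          have : DifferentiableOn ℂ Q₀ {p}ᶜ :=
            fun z hz => (hQ₀ z hz).differentiableWithinAt
          exact this.analyticAt (isOpen_compl_singleton.mem_nhds hne)
        refine (hm p' (by simp [hp'])).sub (MeromorphicAt.add ?_ hQan.deriv.meromorphicAt)
        fun_prop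
      refine h1.congr ?_
      have hU1 : U \ ↑T ∪ {p'} ∈ nhds p' := by
        have : U \ ↑(T.erase p') ∈ nhds p' :=
          (hU.sdiff (T.erase p').finite_toSet.isClosed).mem_nhds ⟨hTU' hp', by simp⟩
        filter_upwards [this] with z hz
        by_cases hzp : z = p'
        · exact Or.inr hzp
        · exact Or.inl ⟨hz.1, fun h => hz.2 (by simpa [hzp] using h)⟩
      have hU2 : {p}ᶜ ∈ nhds p' := isOpen_compl_singleton.mem_nhds hne
      filter_upwards [nhdsWithin_le_nhds hU1, nhdsWithin_le_nhds hU2, self_mem_nhdsWithin]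
        with z hz1 hz2 hz3
      have hz : z ∈ (U \ ↑T) \ {p} := ⟨hz1.resolve_right hz3, hz2⟩
      rw [hrep₀ z hz]
      ring
    obtain ⟨c, Q, h, hQ, hh, hrep⟩ := ih hTU' hh₀ hm₀
    refine ⟨Function.update c p c₀, fun z => Q₀ z + Q z, h, fun z hz => ?_, hh, fun z hz => ?_⟩
    · simp only [Finset.mem_insert, not_or] at hz
      exact (hQ₀ z hz.1).add (hQ z hz.2)
    · rw [← hset] at hz
      have h1 := hrep₀ z hz
      rw [hrep z hz.1] at h1
      have h2 : deriv (fun z => Q₀ z + Q z) z = deriv Q₀ z + deriv Q z :=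
        deriv_fun_add (hQ₀ z hz.2) (hQ z (by simpa using hz.1.2))
      have h3 : ∑ x ∈ T, Function.update c p c₀ x / (z - x) = ∑ x ∈ T, c x / (z - x) :=
        Finset.sum_congr rfl fun x hx => by
          rw [Function.update_of_ne (ne_of_mem_of_not_mem hx hpT)]
      rw [h2, Finset.sum_insert hpT, h3, Function.update_self, h1]
      ring

theorem circleIntegral_inv_sub (w p : ℂ) {ρ : ℝ} (hρ : 0 < ρ) (hp : p ∉ Metric.sphere w ρ) :
    (∮ z in C(w, ρ), (z - p)⁻¹) =
      (2 * (π : ℂ) * Complex.I) * (Set.indicator (Metric.ball w ρ) (fun _ => 1) p : ℂ) := by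
  classical
  by_cases h : p ∈ Metric.ball w ρ
  · rw [circleIntegral.integral_sub_inv_of_mem_ball h]
    simp [h]
  · have hp' : p ∉ Metric.closedBall w ρ := by
      rw [← Metric.ball_union_sphere]
      exact fun h' => h'.elim h hp
    rw [Set.indicator_of_notMem h, mul_zero]
    refine Complex.circleIntegral_eq_zero_of_differentiable_on_off_countable hρ.le
      Set.countable_empty ?_ ?_
    · intro z hz
      have : z - p ≠ 0 := sub_ne_zero.2 fun h => hp' (h ▸ hz)
      exact ContinuousAt.continuousWithinAt (by fun_prop (disch := assumption))
    · intro z hz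
      have : z - p ≠ 0 := sub_ne_zero.2 fun h => hp' (h ▸ Metric.ball_subset_closedBall hz.1)
      fun_prop (disch := assumption)

/-- The integral of a partial fraction over a circle. -/
theorem circleIntegral_partial_fraction {U : Set ℂ} (hU : IsOpen U) {T : Finset ℂ}
    {c Q h H : ℂ → ℂ} (hQ : DifferentiableOn ℂ Q (U \ T)) (hh : DifferentiableOn ℂ h U)
    (hrep : ∀ z ∈ U \ T, H z = ∑ p ∈ T, c p / (z - p) + deriv Q z + h z) {w : ℂ} {ρ : ℝ}
    (hρ : 0 < ρ) (hs : Metric.sphere w ρ ⊆ U \ T) :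
    (∮ z in C(w, ρ), H z) =
      (2 * (π : ℂ) * Complex.I) *
        ∑ p ∈ T, c p * (Set.indicator (Metric.ball w ρ) (fun _ => 1) p : ℂ) +
      ∮ z in C(w, ρ), h z := by
  have hUT : IsOpen (U \ T) := hU.sdiff T.finite_toSet.isClosed
  have hne : ∀ p ∈ T, p ∉ Metric.sphere w ρ := fun p hp hps => (hs hps).2 hp
  have hi1 : ∀ p ∈ T, CircleIntegrable (fun z => c p / (z - p)) w ρ := by
    intro p hp
    refine ContinuousOn.circleIntegrable hρ.le fun z hz => ?_
    have : z - p ≠ 0 := sub_ne_zero.2 fun h => hne p hp (h ▸ hz)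
    exact ContinuousAt.continuousWithinAt (by fun_prop (disch := assumption))
  have hi1' : CircleIntegrable (fun z => ∑ p ∈ T, c p / (z - p)) w ρ :=
    CircleIntegrable.fun_sum T hi1
  have hi2 : CircleIntegrable (deriv Q) w ρ :=
    ContinuousOn.circleIntegrable hρ.le (((hQ.deriv hUT).continuousOn).mono hs)
  have hi3 : CircleIntegrable h w ρ :=
    ContinuousOn.circleIntegrable hρ.le (hh.continuousOn.mono fun z hz => (hs hz).1)
  rw [circleIntegral.integral_congr hρ.le fun z hz => hrep z (hs hz),
    circleIntegral.integral_add (f := fun z => ∑ p ∈ T, c p / (z - p) + deriv Q z)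
      (hi1'.add hi2) hi3,
    circleIntegral.integral_add hi1' hi2, circleIntegral.integral_fun_sum hi1]
  have hz : (∮ z in C(w, ρ), deriv Q z) = 0 :=
    circleIntegral.integral_eq_zero_of_hasDerivWithinAt hρ.le fun z hz =>
      (hQ.differentiableAt (hUT.mem_nhds (hs hz))).hasDerivAt.hasDerivWithinAt
  rw [hz, add_zero, Finset.mul_sum]
  congr 1
  refine Finset.sum_congr rfl fun p hp => ?_
  simp only [div_eq_mul_inv]
  rw [circleIntegral.integral_const_mul, circleIntegral_inv_sub w p hρ (hne p hp)]
  ring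

end PartialFractions

end SepVar

namespace SepVar

/-! ### The deformed contour -/

section Contour

/-- The standing assumptions on the parameters `S` and the radius `ε` of the contour `Γ`. Besides
genericity and smallness of the radius, none of the small discs contains the accumulation point
`0` of the points `z q^k`. -/
structure Admissible (q : ℝ) (S : Set ℂ) (ε : ℝ) : Prop where
  finite : S.Finite
  zero_notMem : (0 : ℂ) ∉ S
  generic : Generic q S
  small : SmallRadius q S ε
  zero_notMem_ball : ∀ p ∈ largePoles q S,
    (0 : ℂ) ∉ Metric.closedBall p ε ∧ (0 : ℂ) ∉ Metric.closedBall p⁻¹ ε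

/-- The support of the contour `Γ`. -/
def contourCurve (q : ℂ) (S : Set ℂ) (ε : ℝ) : Set ℂ :=
  Metric.sphere 0 1 ∪ ⋃ p ∈ largePoles q S, (Metric.sphere p ε ∪ Metric.sphere p⁻¹ ε)

/-- The unit circle and the small discs bounded by the other circles of `Γ`. -/
def contourHull (q : ℂ) (S : Set ℂ) (ε : ℝ) : Set ℂ :=
  Metric.sphere 0 1 ∪ ⋃ p ∈ largePoles q S, (Metric.closedBall p ε ∪ Metric.closedBall p⁻¹ ε)

theorem contourCurve_subset_contourHull (q : ℂ) (S : Set ℂ) (ε : ℝ) :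
    contourCurve q S ε ⊆ contourHull q S ε := by
  unfold contourCurve contourHull
  gcongr <;> exact Metric.sphere_subset_closedBall

/-- The annulus `ρ⁻¹ < |z| < ρ`. -/
def annulus (ρ : ℝ) : Set ℂ := {z | ρ⁻¹ < ‖z‖ ∧ ‖z‖ < ρ}

theorem isOpen_annulus (ρ : ℝ) : IsOpen (annulus ρ) :=
  (isOpen_lt continuous_const continuous_norm).inter (isOpen_lt continuous_norm continuous_const)

theorem ne_zero_of_mem_annulus {ρ : ℝ} (hρ : 0 < ρ) {z : ℂ} (hz : z ∈ annulus ρ) : z ≠ 0 := by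
  rintro rfl
  have h1 := hz.1
  rw [norm_zero] at h1
  exact absurd (inv_pos.2 hρ) h1.not_gt

theorem innerPoles_finite_of_lt {q : ℝ} (hq0 : 0 < q) (hq1 : q < 1) {S : Set ℂ} (hS : S.Finite)
    {r : ℝ} (hr : 0 < r) : {p ∈ innerPoles q S | r < ‖p‖}.Finite := by
  have h1 : ∀ s ∈ S, {p : ℂ | (∃ k : ℕ, p = s * (q : ℂ) ^ k) ∧ r < ‖p‖}.Finite := by
    intro s _
    have h2 : Filter.Tendsto (fun k : ℕ => ‖s‖ * q ^ k) Filter.atTop (nhds 0) := by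
      simpa using (tendsto_pow_atTop_nhds_zero_of_lt_one hq0.le hq1).const_mul ‖s‖
    obtain ⟨N, hN⟩ := Filter.eventually_atTop.1 (h2.eventually (gt_mem_nhds hr))
    refine ((Finset.range N).finite_toSet.image fun k => s * (q : ℂ) ^ k).subset ?_
    rintro p ⟨⟨k, rfl⟩, hk⟩
    refine ⟨k, ?_, rfl⟩
    by_contra hkN
    have h3 := hN k (by simpa using hkN)
    rw [norm_mul, norm_pow, Complex.norm_real, Real.norm_of_nonneg hq0.le] at hk
    exact absurd h3 hk.not_gt
  refine (hS.biUnion h1).subset ?_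
  rintro p ⟨⟨s, hs, k, hk⟩, hp⟩
  exact Set.mem_biUnion hs ⟨⟨k, hk⟩, hp⟩

theorem outerPoles_eq (q : ℂ) (S : Set ℂ) : outerPoles q S = {p | p⁻¹ ∈ innerPoles q S} := by
  ext p
  constructor
  · rintro ⟨s, hs, k, rfl⟩
    exact ⟨s, hs, k, inv_inv _⟩
  · rintro ⟨s, hs, k, hk⟩
    exact ⟨s, hs, k, by rw [← hk, inv_inv]⟩

theorem outerPoles_finite_of_lt {q : ℝ} (hq0 : 0 < q) (hq1 : q < 1) {S : Set ℂ} (hS : S.Finite)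
    {r : ℝ} (hr : 0 < r) (h0 : (0 : ℂ) ∉ outerPoles q S) :
    {p ∈ outerPoles q S | ‖p‖ < r}.Finite := by
  refine ((innerPoles_finite_of_lt hq0 hq1 hS (inv_pos.2 hr)).image fun p => p⁻¹).subset ?_
  rintro p ⟨hp, hpr⟩
  rw [outerPoles_eq] at hp
  refine ⟨p⁻¹, ⟨hp, ?_⟩, inv_inv p⟩
  have : p ≠ 0 := by
    rintro rfl
    exact h0 (by rw [outerPoles_eq]; exact hp)
  rw [norm_inv]
  exact inv_strictAnti₀ (norm_pos_iff.2 this) hpr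

theorem zero_notMem_innerPoles {q : ℝ} (hq0 : 0 < q) {S : Set ℂ} (h0 : (0 : ℂ) ∉ S) :
    (0 : ℂ) ∉ innerPoles q S := by
  rintro ⟨s, hs, k, hk⟩
  have hq : (q : ℂ) ^ k ≠ 0 := pow_ne_zero _ (by exact_mod_cast hq0.ne')
  rcases mul_eq_zero.1 hk.symm with h | h
  · exact h0 (h ▸ hs)
  · exact hq h

theorem zero_notMem_outerPoles {q : ℝ} (hq0 : 0 < q) {S : Set ℂ} (h0 : (0 : ℂ) ∉ S) :
    (0 : ℂ) ∉ outerPoles q S := by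
  rw [outerPoles_eq]
  simpa using zero_notMem_innerPoles hq0 h0

theorem largePoles_finite {q : ℝ} (hq0 : 0 < q) (hq1 : q < 1) {S : Set ℂ} (hS : S.Finite) :
    (largePoles q S).Finite :=
  innerPoles_finite_of_lt hq0 hq1 hS one_pos

variable {q : ℝ} {S : Set ℂ} {ε : ℝ}

theorem Admissible.zero_notMem_innerPoles (hA : Admissible q S ε) (hq0 : 0 < q) :
    (0 : ℂ) ∉ innerPoles q S := SepVar.zero_notMem_innerPoles hq0 hA.zero_notMem

theorem Admissible.norm_ne_one (hA : Admissible q S ε) {p : ℂ}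
    (hp : p ∈ innerPoles q S ∪ outerPoles q S) : ‖p‖ ≠ 1 := by
  rcases hp with hp | hp
  · exact hA.generic.1 p hp
  · rw [outerPoles_eq] at hp
    have := hA.generic.1 _ hp
    rwa [norm_inv, ne_eq, inv_eq_one] at this

theorem Admissible.notMem_contourCurve (hA : Admissible q S ε) {p : ℂ}
    (hp : p ∈ innerPoles q S ∪ outerPoles q S) : p ∉ contourCurve q S ε := by
  rintro (h | h)
  · exact hA.norm_ne_one hp (by simpa using h)
  · simp only [Set.mem_iUnion] at h
    obtain ⟨P, hP, h | h⟩ := h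
    · have := (hA.small.2 P hP p hp).1 (Metric.sphere_subset_closedBall h)
      subst this
      simp only [Metric.mem_sphere, dist_self] at h
      exact hA.small.1.ne h
    · have := (hA.small.2 P hP p hp).2 (Metric.sphere_subset_closedBall h)
      subst this
      simp only [Metric.mem_sphere, dist_self] at h
      exact hA.small.1.ne h

theorem Admissible.zero_notMem_contourHull (hA : Admissible q S ε) :
    (0 : ℂ) ∉ contourHull q S ε := by
  rintro (h | h)
  · simp at h
  · simp only [Set.mem_iUnion] at h
    obtain ⟨P, hP, h | h⟩ := h
    · exact (hA.zero_notMem_ball P hP).1 h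
    · exact (hA.zero_notMem_ball P hP).2 h

theorem Admissible.ne_zero_of_mem_contourCurve (hA : Admissible q S ε) {z : ℂ}
    (hz : z ∈ contourCurve q S ε) : z ≠ 0 := by
  rintro rfl
  exact hA.zero_notMem_contourHull (contourCurve_subset_contourHull _ _ _ hz)

theorem Admissible.exists_annulus (hA : Admissible q S ε) (hq0 : 0 < q) (hq1 : q < 1) :
    ∃ ρ : ℝ, 1 < ρ ∧ contourHull q S ε ⊆ annulus ρ := by
  have hK : IsCompact (contourHull q S ε) := by
    refine (isCompact_sphere _ _).union ((largePoles_finite hq0 hq1 hA.finite).isCompact_biUnion ?_)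
    exact fun p _ => (isCompact_closedBall _ _).union (isCompact_closedBall _ _)
  obtain ⟨M, hM⟩ := hK.isBounded.exists_norm_le
  have hcont : ContinuousOn (fun z : ℂ => z⁻¹) (contourHull q S ε) :=
    continuousOn_inv₀.mono fun z hz h0 => hA.zero_notMem_contourHull (h0 ▸ hz)
  obtain ⟨M', hM'⟩ := (hK.image_of_continuousOn hcont).isBounded.exists_norm_le
  refine ⟨max (max (|M| + 1) (|M'| + 1)) 2, by simp, fun z hz => ?_⟩
  have hz0 : 0 < ‖z‖ := norm_pos_iff.2 fun h0 => hA.zero_notMem_contourHull (h0 ▸ hz)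
  have h1 := (hM z hz).trans (le_abs_self M)
  have h2 := (hM' _ ⟨z, hz, rfl⟩).trans (le_abs_self M')
  have h3 : |M| < max (max (|M| + 1) (|M'| + 1)) 2 := by simp
  have h4 : |M'| < max (max (|M| + 1) (|M'| + 1)) 2 := by simp
  rw [norm_inv] at h2
  refine ⟨?_, h1.trans_lt h3⟩
  rw [inv_lt_comm₀ (by positivity) hz0]
  exact h2.trans_lt h4

theorem contourIntegral_eq_sum (hq0 : 0 < q) (hq1 : q < 1) (hS : S.Finite) (F : ℂ → ℂ) :
    contourIntegral q S ε F = (2 * (π : ℂ) * Complex.I)⁻¹ * ((∮ x in C(0, 1), F x) +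
      ∑ p ∈ (largePoles_finite hq0 hq1 hS).toFinset,
        ((∮ x in C(p, ε), F x) - ∮ x in C(p⁻¹, ε), F x)) := by
  rw [contourIntegral, finsum_mem_eq_finite_toFinset_sum _ (largePoles_finite hq0 hq1 hS)]

theorem sphere_subset_contourCurve {p : ℂ} (hp : p ∈ largePoles q S) :
    Metric.sphere p ε ⊆ contourCurve q S ε ∧ Metric.sphere p⁻¹ ε ⊆ contourCurve q S ε :=
  ⟨fun _ hz => Or.inr (Set.mem_biUnion hp (Or.inl hz)),
    fun _ hz => Or.inr (Set.mem_biUnion hp (Or.inr hz))⟩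

theorem closedBall_subset_contourHull {p : ℂ} (hp : p ∈ largePoles q S) :
    Metric.closedBall p ε ⊆ contourHull q S ε ∧ Metric.closedBall p⁻¹ ε ⊆ contourHull q S ε :=
  ⟨fun _ hz => Or.inr (Set.mem_biUnion hp (Or.inl hz)),
    fun _ hz => Or.inr (Set.mem_biUnion hp (Or.inr hz))⟩

theorem contourIntegral_congr (hε : 0 < ε) {F G : ℂ → ℂ}
    (h : Set.EqOn F G (contourCurve q S ε)) :
    contourIntegral q S ε F = contourIntegral q S ε G := by
  unfold contourIntegral
  rw [circleIntegral.integral_congr zero_le_one (h.mono Set.subset_union_left)]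
  congr 2
  refine finsum_mem_congr rfl fun p hp => ?_
  rw [circleIntegral.integral_congr hε.le (h.mono (sphere_subset_contourCurve hp).1),
    circleIntegral.integral_congr hε.le (h.mono (sphere_subset_contourCurve hp).2)]

theorem contourIntegral_add (hq0 : 0 < q) (hq1 : q < 1) (hS : S.Finite) (hε : 0 < ε)
    {F G : ℂ → ℂ} (hF : ContinuousOn F (contourCurve q S ε))
    (hG : ContinuousOn G (contourCurve q S ε)) :
    contourIntegral q S ε (fun z => F z + G z) =
      contourIntegral q S ε F + contourIntegral q S ε G := by
  simp only [contourIntegral_eq_sum hq0 hq1 hS]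
  have h1 : (∮ x in C(0, 1), F x + G x) = (∮ x in C(0, 1), F x) + ∮ x in C(0, 1), G x :=
    circleIntegral.integral_add
      (ContinuousOn.circleIntegrable zero_le_one (hF.mono Set.subset_union_left))
      (ContinuousOn.circleIntegrable zero_le_one (hG.mono Set.subset_union_left))
  have h2 : ∀ p ∈ (largePoles_finite hq0 hq1 hS).toFinset,
      ((∮ x in C(p, ε), F x + G x) - ∮ x in C(p⁻¹, ε), F x + G x) =
        ((∮ x in C(p, ε), F x) - ∮ x in C(p⁻¹, ε), F x) +
          ((∮ x in C(p, ε), G x) - ∮ x in C(p⁻¹, ε), G x) := by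
    intro p hp
    have hp' : p ∈ largePoles q S := by simpa using hp
    obtain ⟨hs1, hs2⟩ := sphere_subset_contourCurve (ε := ε) hp'
    rw [circleIntegral.integral_add (ContinuousOn.circleIntegrable hε.le (hF.mono hs1))
      (ContinuousOn.circleIntegrable hε.le (hG.mono hs1)),
      circleIntegral.integral_add (ContinuousOn.circleIntegrable hε.le (hF.mono hs2))
      (ContinuousOn.circleIntegrable hε.le (hG.mono hs2))]
    ring
  rw [h1, Finset.sum_congr rfl h2, Finset.sum_add_distrib]
  ring

theorem contourIntegral_const_mul (hq0 : 0 < q) (hq1 : q < 1) (hS : S.Finite) (a : ℂ)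
    (F : ℂ → ℂ) :
    contourIntegral q S ε (fun z => a * F z) = a * contourIntegral q S ε F := by
  simp only [contourIntegral_eq_sum hq0 hq1 hS, circleIntegral.integral_const_mul, ← mul_sub,
    ← Finset.mul_sum]
  ring

open Classical in
/-- The contour `Γ` encircles the points `z q^k` once and the points `z⁻¹ q^{-k}` not at all. -/
theorem contourIntegral_partial_fraction (hA : Admissible q S ε) (hq0 : 0 < q) (hq1 : q < 1)
    {U : Set ℂ} (hU : IsOpen U) (hUc : contourHull q S ε ⊆ U) {T : Finset ℂ}
    (hT : ∀ p ∈ T, p ∈ innerPoles q S ∪ outerPoles q S) {c Q h H : ℂ → ℂ}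
    (hQ : DifferentiableOn ℂ Q (U \ T)) (hh : DifferentiableOn ℂ h U)
    (hrep : ∀ z ∈ U \ T, H z = ∑ p ∈ T, c p / (z - p) + deriv Q z + h z) :
    contourIntegral q S ε H = (2 * (π : ℂ) * Complex.I)⁻¹ * (∮ z in C(0, 1), h z) +
      ∑ p ∈ T, if p ∈ innerPoles q S then c p else 0 := by
  have hcurve : contourCurve q S ε ⊆ U \ T := fun z hz =>
    ⟨hUc (contourCurve_subset_contourHull _ _ _ hz),
      fun hzT => hA.notMem_contourCurve (hT z hzT) hz⟩
  have hpi : (2 * (π : ℂ) * Complex.I) ≠ 0 := Complex.two_pi_I_ne_zero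
  set L := (largePoles_finite hq0 hq1 hA.finite).toFinset with hL
  have hLmem : ∀ {p}, p ∈ L ↔ p ∈ largePoles q S := by simp [hL]
  have h0 := circleIntegral_partial_fraction hU hQ hh hrep one_pos
    (Set.subset_union_left.trans hcurve)
  have hsmall : ∀ w, Metric.sphere w ε ⊆ contourCurve q S ε →
      Metric.closedBall w ε ⊆ contourHull q S ε → (∮ z in C(w, ε), H z) =
      (2 * (π : ℂ) * Complex.I) *
        ∑ p ∈ T, c p * (Set.indicator (Metric.ball w ε) (fun _ => 1) p : ℂ) := by
    intro w hw hw'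
    rw [circleIntegral_partial_fraction hU hQ hh hrep hA.small.1 (hw.trans hcurve)]
    have : (∮ z in C(w, ε), h z) = 0 := by
      refine Complex.circleIntegral_eq_zero_of_differentiable_on_off_countable hA.small.1.le
        Set.countable_empty (hh.continuousOn.mono (hw'.trans hUc)) fun z hz => ?_
      exact hh.differentiableAt (hU.mem_nhds (hUc (hw' (Metric.ball_subset_closedBall hz.1))))
    rw [this, add_zero]
  rw [contourIntegral_eq_sum hq0 hq1 hA.finite, h0]
  have h1 : ∀ P ∈ L, ((∮ x in C(P, ε), H x) - ∮ x in C(P⁻¹, ε), H x) =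
      (2 * (π : ℂ) * Complex.I) * ∑ p ∈ T, c p * ((if P = p then 1 else 0) -
        (if P = p⁻¹ then 1 else 0)) := by
    intro P hP
    rw [hLmem] at hP
    obtain ⟨hs1, hs2⟩ := sphere_subset_contourCurve (ε := ε) hP
    obtain ⟨hb1, hb2⟩ := closedBall_subset_contourHull (ε := ε) hP
    rw [hsmall P hs1 hb1, hsmall P⁻¹ hs2 hb2, ← mul_sub, ← Finset.sum_sub_distrib]
    congr 1
    refine Finset.sum_congr rfl fun p hp => ?_
    have hsm := hA.small.2 P hP p (hT p hp)
    rw [← mul_sub]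
    congr 2
    · by_cases hPp : P = p
      · subst hPp; simp [hA.small.1]
      · rw [if_neg hPp, Set.indicator_of_notMem]
        exact fun hb => hPp (hsm.1 (Metric.ball_subset_closedBall hb)).symm
    · by_cases hPp : P = p⁻¹
      · subst hPp; simp [hA.small.1]
      · rw [if_neg hPp, Set.indicator_of_notMem]
        intro hb
        have := hsm.2 (Metric.ball_subset_closedBall hb)
        exact hPp (by rw [this, inv_inv])
  rw [Finset.sum_congr rfl h1, ← Finset.mul_sum, Finset.sum_comm]
  have h2 : ∀ p ∈ T, (if p ∈ innerPoles q S then c p else 0) =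
      c p * (Set.indicator (Metric.ball 0 1) (fun _ => 1) p : ℂ) +
      ∑ P ∈ L, c p * ((if P = p then 1 else 0) - (if P = p⁻¹ then 1 else 0)) := by
    intro p hp
    rw [← Finset.mul_sum, Finset.sum_sub_distrib, Finset.sum_ite_eq', Finset.sum_ite_eq', ← mul_add]
    have hn := hA.norm_ne_one (hT p hp)
    have hp0 : p ≠ 0 := by
      rintro rfl
      exact (hT 0 hp).elim (hA.zero_notMem_innerPoles hq0)
        (zero_notMem_outerPoles hq0 hA.zero_notMem)
    have hpos : 0 < ‖p‖ := norm_pos_iff.2 hp0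
    rcases hT p hp with hpi | hpo
    · have hpo : p⁻¹ ∉ innerPoles q S := fun h =>
        hA.generic.2.le_bot ⟨hpi, by rw [outerPoles_eq]; exact h⟩
      have hpL : p⁻¹ ∉ L := fun h => hpo (hLmem.1 h).1
      rcases lt_or_gt_of_ne hn with hlt | hgt
      · have : p ∉ L := fun h => hlt.not_gt (hLmem.1 h).2
        simp [hpi, hpL, this, hlt]
      · have : p ∈ L := hLmem.2 ⟨hpi, hgt⟩
        simp [hpi, hpL, this, hgt.not_gt]
    · have hpi : p ∉ innerPoles q S := fun h => hA.generic.2.le_bot ⟨h, hpo⟩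
      have hpo' : p⁻¹ ∈ innerPoles q S := by rw [outerPoles_eq] at hpo; exact hpo
      have hpL : p ∉ L := fun h => hpi (hLmem.1 h).1
      rcases lt_or_gt_of_ne hn with hlt | hgt
      · have : p⁻¹ ∈ L := hLmem.2 ⟨hpo', by rw [norm_inv]; exact (one_lt_inv₀ hpos).2 hlt⟩
        simp [hpi, hpL, this, hlt]
      · have : p⁻¹ ∉ L := fun h => by
          have h3 := (hLmem.1 h).2
          rw [norm_inv, one_lt_inv₀ hpos] at h3
          exact h3.not_gt hgt
        simp [hpi, hpL, this, hgt.le]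
  rw [Finset.sum_congr rfl h2, Finset.sum_add_distrib]
  field_simp
  ring

end Contour

end SepVar

namespace SepVar

/-! ### Invariance of the contour integral -/

section ContourInvariance

variable {q : ℝ} {S : Set ℂ} {ε : ℝ}

theorem poles_inter_annulus_finite (hq0 : 0 < q) (hq1 : q < 1) (hS : S.Finite)
    (h0 : (0 : ℂ) ∉ S) {ρ : ℝ} (hρ : 0 < ρ) :
    ((innerPoles q S ∪ outerPoles q S) ∩ annulus ρ).Finite := by
  refine ((innerPoles_finite_of_lt hq0 hq1 hS (inv_pos.2 hρ)).union
    (outerPoles_finite_of_lt hq0 hq1 hS hρ (zero_notMem_outerPoles hq0 h0))).subset ?_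
  rintro p ⟨hp | hp, h1, h2⟩
  · exact Or.inl ⟨hp, h1⟩
  · exact Or.inr ⟨hp, h2⟩

/-- Partial fractions on an annulus for a function on `ℂ ∖ {0}` whose poles lie in `P`. -/
theorem exists_partial_fraction_annulus {P : Set ℂ} {ρ : ℝ} (hρ : 0 < ρ)
    (hP : (P ∩ annulus ρ).Finite) {H : ℂ → ℂ}
    (hd : ∀ z, z ≠ 0 → z ∉ P → DifferentiableAt ℂ H z) (hm : ∀ z, z ≠ 0 → MeromorphicAt H z) :
    ∃ (T : Finset ℂ) (c Q h : ℂ → ℂ), (∀ p ∈ T, p ∈ P ∧ p ≠ 0) ∧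
      (∀ z, z ∉ T → DifferentiableAt ℂ Q z) ∧ DifferentiableOn ℂ h (annulus ρ) ∧
        ∀ z ∈ annulus ρ \ T, H z = ∑ p ∈ T, c p / (z - p) + deriv Q z + h z := by
  have hT : ∀ p, p ∈ hP.toFinset ↔ p ∈ P ∧ p ∈ annulus ρ := by simp
  obtain ⟨c, Q, h, h1, h2, h3⟩ := exists_partial_fraction (isOpen_annulus ρ) hP.toFinset (H := H)
    (fun p hp => ((hT p).1 hp).2)
    (fun z hz => (hd z (ne_zero_of_mem_annulus hρ hz.1)
      fun hzP => hz.2 ((hT z).2 ⟨hzP, hz.1⟩)).differentiableWithinAt)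
    (fun p hp => hm p (ne_zero_of_mem_annulus hρ ((hT p).1 hp).2))
  exact ⟨hP.toFinset, c, Q, h,
    fun p hp => ⟨((hT p).1 hp).1, ne_zero_of_mem_annulus hρ ((hT p).1 hp).2⟩, h1, h2, h3⟩

theorem circleIntegral_mul_comp_mul (h : ℂ → ℂ) {r : ℝ} :
    (∮ z in C(0, 1), (r : ℂ) * h (r * z)) = ∮ z in C(0, r), h z := by
  simp only [circleIntegral, deriv_circleMap, smul_eq_mul]
  refine intervalIntegral.integral_congr fun θ _ => ?_
  simp only [circleMap, Complex.ofReal_one, one_mul, zero_add]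
  ring

theorem circleIntegral_eq_of_annulus {ρ : ℝ} (h : ℂ → ℂ)
    (hh : DifferentiableOn ℂ h (annulus ρ)) {r : ℝ} (hr0 : 0 < r) (hr : r ≤ 1) (hρ : 1 < ρ)
    (hrρ : ρ⁻¹ < r) :
    (∮ z in C(0, 1), h z) = ∮ z in C(0, r), h z := by
  have hsub : Metric.closedBall (0 : ℂ) 1 \ Metric.ball 0 r ⊆ annulus ρ := by
    rintro z ⟨h1, h2⟩
    simp only [mem_closedBall_zero_iff, mem_ball_zero_iff, not_lt] at h1 h2
    exact ⟨hrρ.trans_le h2, h1.trans_lt hρ⟩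
  refine Complex.circleIntegral_eq_of_differentiable_on_annulus_off_countable hr0 hr
    Set.countable_empty (hh.continuousOn.mono hsub) fun z hz => ?_
  refine hh.differentiableAt ((isOpen_annulus ρ).mem_nhds (hsub ⟨?_, ?_⟩))
  · exact Metric.ball_subset_closedBall hz.1.1
  · exact fun h => hz.1.2 (Metric.ball_subset_closedBall h)

/-- Only the poles that actually occur matter: a smaller set of parameters gives the same contour
integral if it accounts for all the poles of the integrand. -/
theorem contourIntegral_eq_of_subset {S' : Set ℂ} (hA : Admissible q S ε)
    (hA' : Admissible q S' ε) (hq0 : 0 < q) (hq1 : q < 1)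
    (hin : innerPoles q S' ⊆ innerPoles q S) {H : ℂ → ℂ}
    (hd : ∀ z, z ≠ 0 → z ∉ innerPoles q S' ∪ outerPoles q S' → DifferentiableAt ℂ H z)
    (hm : ∀ z, z ≠ 0 → MeromorphicAt H z) :
    contourIntegral q S' ε H = contourIntegral q S ε H := by
  have hout : outerPoles q S' ⊆ outerPoles q S := by
    rw [outerPoles_eq, outerPoles_eq]
    exact fun p hp => hin hp
  have hhull : contourHull q S' ε ⊆ contourHull q S ε := by
    refine Set.union_subset_union_right _ (Set.biUnion_mono (fun p hp => ?_) fun _ _ => le_rfl)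
    exact ⟨hin hp.1, hp.2⟩
  obtain ⟨ρ, hρ, hU⟩ := hA.exists_annulus hq0 hq1
  have hρ0 : 0 < ρ := by linarith
  obtain ⟨T, c, Q, h, hT, hQ, hh, hrep⟩ := exists_partial_fraction_annulus hρ0
    (poles_inter_annulus_finite hq0 hq1 hA'.finite hA'.zero_notMem hρ0) hd hm
  have hQ' : DifferentiableOn ℂ Q (annulus ρ \ T) :=
    fun z hz => (hQ z hz.2).differentiableWithinAt
  rw [contourIntegral_partial_fraction hA hq0 hq1 (isOpen_annulus ρ) hU
      (fun p hp => (hT p hp).1.imp (fun h => hin h) fun h => hout h) hQ' hh hrep,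
    contourIntegral_partial_fraction hA' hq0 hq1 (isOpen_annulus ρ) (hhull.trans hU)
      (fun p hp => (hT p hp).1) hQ' hh hrep]
  congr 1
  refine Finset.sum_congr rfl fun p hp => ?_
  congr 1
  refine propext ⟨fun h => hin h, fun h => (hT p hp).1.resolve_right fun h' => ?_⟩
  exact hA.generic.2.le_bot ⟨h, hout h'⟩

/-- Invariance of the contour integral under `z ↦ q z`, with respect to `dz / z`, for an integrand
without poles at the points of `S`: no pole is crossed when the contour is multiplied by `q`. -/
theorem contourIntegral_comp_mul (hA : Admissible q S ε) (hq0 : 0 < q) (hq1 : q < 1)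
    {G : ℂ → ℂ}
    (hd : ∀ z : ℂ, z ≠ 0 → z / (q : ℂ) ∉ innerPoles q S → z ∉ outerPoles q S →
      DifferentiableAt ℂ G z)
    (hm : ∀ z, z ≠ 0 → MeromorphicAt G z) :
    contourIntegral q S ε (fun z => z⁻¹ * G (q * z)) =
      contourIntegral q S ε (fun z => z⁻¹ * G z) := by
  classical
  have hqc : (q : ℂ) ≠ 0 := by exact_mod_cast hq0.ne'
  have hinq : ∀ {p : ℂ}, p / q ∈ innerPoles q S → p ∈ innerPoles q S := by
    rintro p ⟨s, hs, k, hk⟩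
    refine ⟨s, hs, k + 1, ?_⟩
    rw [div_eq_iff hqc] at hk
    rw [hk]; ring
  have houtq : ∀ {p : ℂ}, p ∈ outerPoles q S → p / q ∈ outerPoles q S := by
    rintro p ⟨s, hs, k, rfl⟩
    refine ⟨s, hs, k + 1, ?_⟩
    rw [pow_succ, ← mul_assoc, mul_inv _ (q : ℂ), div_eq_mul_inv]
  obtain ⟨ρ', hρ', hU'⟩ := hA.exists_annulus hq0 hq1
  -- the larger annulus contains the image of the smaller one under multiplication by `q`
  set ρ : ℝ := ρ' / q with hρdef
  have hρ0' : 0 < ρ' := by linarith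
  have hρ0 : 0 < ρ := by positivity
  have hρρ : ρ' < ρ := by
    rw [hρdef, lt_div_iff₀ hq0]; nlinarith
  have hρ1 : 1 < ρ := hρ'.trans hρρ
  have hsub : ∀ {z}, z ∈ annulus ρ' → z ∈ annulus ρ := fun hz =>
    ⟨(inv_strictAnti₀ hρ0' hρρ).trans hz.1, hz.2.trans hρρ⟩
  have hsub2 : ∀ {z : ℂ}, z ∈ annulus ρ' → (q : ℂ) * z ∈ annulus ρ := by
    intro z hz
    refine ⟨?_, ?_⟩ <;> rw [norm_mul, Complex.norm_real, Real.norm_of_nonneg hq0.le]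
    · rw [hρdef, inv_div, div_eq_mul_inv]
      exact mul_lt_mul_of_pos_left hz.1 hq0
    · nlinarith [hz.2, norm_nonneg z]
  have hPfin : ({p : ℂ | p / (q : ℂ) ∈ innerPoles q S ∨ p ∈ outerPoles q S} ∩
      annulus ρ).Finite := by
    refine (poles_inter_annulus_finite hq0 hq1 hA.finite hA.zero_notMem hρ0).subset ?_
    rintro p ⟨h | h, h2⟩
    · exact ⟨Or.inl (hinq h), h2⟩
    · exact ⟨Or.inr h, h2⟩
  obtain ⟨T, c, Q, h, hT, hQ, hh, hrep⟩ := exists_partial_fraction_annulus hρ0 hPfin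
    (H := fun z => z⁻¹ * G z)
    (fun z hz hzP => (differentiableAt_inv hz).mul
      (hd z hz (fun h => hzP (Or.inl h)) fun h => hzP (Or.inr h)))
    (fun z hz => (by fun_prop : MeromorphicAt (fun z : ℂ => z⁻¹) z).mul (hm z hz))
  have hQ' : DifferentiableOn ℂ Q (annulus ρ \ T) :=
    fun z hz => (hQ z hz.2).differentiableWithinAt
  have hmemT : ∀ z, z ∈ T.image (fun z => z / (q : ℂ)) ↔ q * z ∈ T := by
    intro z
    rw [Finset.mem_image]
    refine ⟨fun ⟨p, hp, hpz⟩ => ?_, fun hz => ⟨_, hz, by field_simp⟩⟩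
    rw [← hpz, mul_div_cancel₀ _ hqc]; exact hp
  have hQ2 : DifferentiableOn ℂ (fun z => Q (q * z))
      (annulus ρ' \ ↑(T.image fun z => z / (q : ℂ))) := by
    intro z hz
    have h1 : q * z ∉ T := fun h => hz.2 ((hmemT z).2 h)
    exact ((hQ _ h1).comp z (by fun_prop)).differentiableWithinAt
  have hh2 : DifferentiableOn ℂ (fun z => (q : ℂ) * h (q * z)) (annulus ρ') := by
    intro z hz
    have h1 : DifferentiableAt ℂ h (q * z) :=
      hh.differentiableAt ((isOpen_annulus ρ).mem_nhds (hsub2 hz))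
    have h2 : DifferentiableAt ℂ (fun z => h (q * z)) z := h1.comp z (by fun_prop)
    exact DifferentiableAt.differentiableWithinAt (by fun_prop)
  have hrep2 : ∀ z ∈ annulus ρ' \ ↑(T.image fun z => z / (q : ℂ)), z⁻¹ * G (q * z) =
      ∑ p ∈ T.image (fun z => z / (q : ℂ)), c (q * p) / (z - p) + deriv (fun z => Q (q * z)) z +
        q * h (q * z) := by
    intro z hz
    have hz0 := ne_zero_of_mem_annulus hρ0' hz.1
    have hzT : q * z ∉ T := fun h => hz.2 ((hmemT z).2 h)
    have h1 := hrep (q * z) ⟨hsub2 hz.1, hzT⟩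
    have h2 : deriv (fun z => Q (q * z)) z = q * deriv Q (q * z) := by
      rw [deriv_comp_mul_left, smul_eq_mul]
    have h3 : ∑ p ∈ T.image (fun z => z / (q : ℂ)), c (q * p) / (z - p) =
        q * ∑ p ∈ T, c p / (q * z - p) := by
      rw [Finset.sum_image fun a _ b _ hab => (div_left_inj' hqc).1 hab, Finset.mul_sum]
      refine Finset.sum_congr rfl fun p _ => ?_
      have : q * z - p = q * (z - p / q) := by field_simp
      rw [mul_div_cancel₀ _ hqc, this, ← mul_div_assoc, mul_div_mul_left _ _ hqc]
    have h5 : z⁻¹ * G (q * z) = q * ((q * z)⁻¹ * G (q * z)) := by field_simp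
    rw [h5, h1, h2, h3]
    ring
  have hT2 : ∀ p ∈ T.image (fun z => z / (q : ℂ)), p ∈ innerPoles q S ∪ outerPoles q S := by
    intro p hp
    rw [hmemT] at hp
    rcases (hT _ hp).1 with h | h
    · exact Or.inl (by rwa [mul_div_cancel_left₀ _ hqc] at h)
    · have := houtq h
      exact Or.inr (by rwa [mul_div_cancel_left₀ _ hqc] at this)
  rw [contourIntegral_partial_fraction hA hq0 hq1 (isOpen_annulus ρ) (fun z hz => hsub (hU' hz))
      (fun p hp => (hT p hp).1.imp hinq id) hQ' hh hrep,
    contourIntegral_partial_fraction hA hq0 hq1 (isOpen_annulus ρ') hU' hT2 hQ2 hh2 hrep2,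
    circleIntegral_mul_comp_mul, circleIntegral_eq_of_annulus h hh hq0 hq1.le hρ1
      (by rw [hρdef, inv_div, div_lt_iff₀ hρ0']; nlinarith),
    Finset.sum_image fun a _ b _ hab => (div_left_inj' hqc).1 hab]
  congr 1
  refine Finset.sum_congr rfl fun p hp => ?_
  rw [mul_div_cancel₀ _ hqc]
  congr 1
  refine propext ⟨hinq, fun h => ?_⟩
  -- a pole of `G` among the points `s q ^ k` has `k ≥ 1`, as genericity keeps it off `outerPoles`
  rcases (hT p hp).1 with h' | h'
  · exact h'
  · exact absurd ⟨h, h'⟩ fun h'' => hA.generic.2.le_bot h''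

end ContourInvariance

end SepVar

namespace SepVar

/-! ### The Askey–Wilson integral -/

section AskeyWilson

variable {q : ℝ} {S : Set ℂ} {ε : ℝ}

theorem norm_ofReal_lt_one (hq0 : 0 < q) (hq1 : q < 1) : ‖(q : ℂ)‖ < 1 := by
  rwa [Complex.norm_real, Real.norm_of_nonneg hq0.le]

theorem analyticAt_qPochInf_comp (hq0 : 0 < q) (hq1 : q < 1) {f : ℂ → ℂ} {z : ℂ}
    (hf : AnalyticAt ℂ f z) : AnalyticAt ℂ (fun z => qPochInf (f z) q) z :=
  AnalyticAt.comp (f := f) (g := fun w => qPochInf w q)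
    ((differentiable_qPochInf (norm_ofReal_lt_one hq0 hq1)).analyticAt (f z)) hf

/-- The polynomials `∏_{i<k} (1 - a q^i z) (1 - a q^i z⁻¹)` in `X = z + z⁻¹`, in which the
Askey–Wilson weight has moments in closed form. -/
noncomputable def awBasis (q a : ℂ) (k : ℕ) : Polynomial ℂ :=
  ∏ i ∈ Finset.range k,
    (Polynomial.C (1 + (a * q ^ i) ^ 2) - Polynomial.C (a * q ^ i) * Polynomial.X)

theorem awBasis_zero (q a : ℂ) : awBasis q a 0 = 1 := by simp [awBasis]

theorem awBasis_succ (q a : ℂ) (k : ℕ) : awBasis q a (k + 1) = awBasis q a k *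
    (Polynomial.C (1 + (a * q ^ k) ^ 2) - Polynomial.C (a * q ^ k) * Polynomial.X) := by
  rw [awBasis, Finset.prod_range_succ, awBasis]

theorem awBasis_succ' (q a : ℂ) (k : ℕ) : awBasis q a (k + 1) =
    (Polynomial.C (1 + a ^ 2) - Polynomial.C a * Polynomial.X) * awBasis q (a * q) k := by
  rw [awBasis, Finset.prod_range_succ', awBasis, mul_comm]
  simp only [pow_zero, mul_one, pow_succ', mul_assoc]

/-- The integral of `p(z + z⁻¹)` against the Askey–Wilson weight over the deformed contour. -/
noncomputable def awIntegral (q : ℝ) (ε : ℝ) (a b c d : ℂ) (p : Polynomial ℂ) : ℂ :=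
  contourIntegral q {a, b, c, d} ε fun z => z⁻¹ * (awWeight q z a b c d * p.eval (z + z⁻¹))

/-- The value `2 (abcd)_∞ / (q, ab, ac, ad, bc, bd, cd; q)_∞` of the Askey–Wilson integral. -/
noncomputable def awValue (q a b c d : ℂ) : ℂ :=
  2 * qPochInf (a * b * c * d) q / (qPochInf q q * qPochInf (a * b) q * qPochInf (a * c) q *
    qPochInf (a * d) q * qPochInf (b * c) q * qPochInf (b * d) q * qPochInf (c * d) q)

theorem Admissible.mono (hA : Admissible q S ε) {S' : Set ℂ} (hf : S'.Finite)
    (h0 : (0 : ℂ) ∉ S') (hin : innerPoles q S' ⊆ innerPoles q S) : Admissible q S' ε := by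
  have hout : outerPoles q S' ⊆ outerPoles q S := by
    rw [outerPoles_eq, outerPoles_eq]
    exact fun p hp => hin hp
  have hl : largePoles q S' ⊆ largePoles q S := fun p hp => ⟨hin hp.1, hp.2⟩
  exact ⟨hf, h0, ⟨fun p hp => hA.generic.1 p (hin hp), hA.generic.2.mono hin hout⟩,
    ⟨hA.small.1, fun p hp s hs => hA.small.2 p (hl hp) s (Set.union_subset_union hin hout hs)⟩,
    fun p hp => hA.zero_notMem_ball p (hl hp)⟩

theorem finite_params (a b c d : ℂ) : ({a, b, c, d} : Set ℂ).Finite := by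
  simp

theorem zero_notMem_params {a b c d : ℂ} :
    (0 : ℂ) ∉ ({a, b, c, d} : Set ℂ) ↔ a ≠ 0 ∧ b ≠ 0 ∧ c ≠ 0 ∧ d ≠ 0 := by
  simp only [Set.mem_insert_iff, Set.mem_singleton_iff, not_or, eq_comm (a := (0 : ℂ)), ne_eq]

theorem Admissible.shift (hq0 : 0 < q) {a b c d : ℂ} (hA : Admissible q {a, b, c, d} ε) :
    Admissible q {a * q, b, c, d} ε := by
  have hqc : (q : ℂ) ≠ 0 := by exact_mod_cast hq0.ne'
  obtain ⟨ha, hb, hc, hd⟩ := zero_notMem_params.1 hA.zero_notMem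
  refine hA.mono (finite_params _ _ _ _)
    (zero_notMem_params.2 ⟨mul_ne_zero ha hqc, hb, hc, hd⟩) ?_
  rintro p ⟨s, hs, k, rfl⟩
  rcases hs with rfl | hs
  · exact ⟨a, Or.inl rfl, k + 1, by ring⟩
  · exact ⟨s, Or.inr hs, k, rfl⟩

theorem params_rotate (a b c d : ℂ) : ({a, b, c, d} : Set ℂ) = {b, c, d, a} := by
  ext z
  simp only [Set.mem_insert_iff, Set.mem_singleton_iff]
  tauto

theorem awWeight_rotate (q x a b c d : ℂ) : awWeight q x a b c d = awWeight q x b c d a := by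
  unfold awWeight
  congr 1
  ring

theorem awIntegral_rotate (a b c d : ℂ) (p : Polynomial ℂ) :
    awIntegral q ε a b c d p = awIntegral q ε b c d a p := by
  unfold awIntegral
  rw [params_rotate]
  congr 1
  funext z
  rw [awWeight_rotate]

theorem awValue_rotate (q a b c d : ℂ) : awValue q a b c d = awValue q b c d a := by
  unfold awValue
  rw [show b * c * d * a = a * b * c * d by ring, mul_comm b a, mul_comm c a, mul_comm d a]
  congr 1
  ring

theorem qPochInf_mul_ne_zero (hq0 : 0 < q) (hq1 : q < 1) {s z : ℂ} (hs : s ∈ S)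
    (hz : z ∉ outerPoles q S) : qPochInf (s * z) q ≠ 0 := by
  refine qPochInf_ne_zero (norm_ofReal_lt_one hq0 hq1) fun k hk => hz ⟨s, hs, k, ?_⟩
  rw [eq_comm, inv_eq_of_mul_eq_one_right]
  linear_combination hk

theorem qPochInf_mul_inv_ne_zero (hq0 : 0 < q) (hq1 : q < 1) {s z : ℂ} (hs : s ∈ S)
    (hz0 : z ≠ 0) (hz : z ∉ innerPoles q S) : qPochInf (s * z⁻¹) q ≠ 0 := by
  refine qPochInf_ne_zero (norm_ofReal_lt_one hq0 hq1) fun k hk => hz ⟨s, hs, k, ?_⟩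
  field_simp at hk
  exact hk.symm

theorem differentiableAt_awWeight (hq0 : 0 < q) (hq1 : q < 1) {a b c d z : ℂ} (hz0 : z ≠ 0)
    (hz : z ∉ innerPoles q {a, b, c, d} ∪ outerPoles q {a, b, c, d}) :
    DifferentiableAt ℂ (fun z => awWeight q z a b c d) z := by
  have hzi : z ∉ innerPoles q {a, b, c, d} := fun h => hz (Or.inl h)
  have hzo : z ∉ outerPoles q {a, b, c, d} := fun h => hz (Or.inr h)
  have han : ∀ {f : ℂ → ℂ}, AnalyticAt ℂ f z →
      DifferentiableAt ℂ (fun z => qPochInf (f z) q) z := fun hf =>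
    (analyticAt_qPochInf_comp hq0 hq1 hf).differentiableAt
  have hinv : AnalyticAt ℂ (fun z : ℂ => z⁻¹) z := analyticAt_inv hz0
  have h1 : ∀ s : ℂ, DifferentiableAt ℂ (fun z => qPochInf (s * z) q) z := fun s =>
    han (by fun_prop)
  have h2 : ∀ s : ℂ, DifferentiableAt ℂ (fun z => qPochInf (s * z⁻¹) q) z := fun s =>
    han (analyticAt_const.mul hinv)
  have h3 : DifferentiableAt ℂ (fun z => qPochInf (z ^ 2) q) z := han (by fun_prop)
  have h4 : DifferentiableAt ℂ (fun z : ℂ => qPochInf (z ^ 2)⁻¹ q) z :=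
    han (AnalyticAt.inv (by fun_prop) (pow_ne_zero 2 hz0))
  unfold awWeight
  refine (h3.mul h4).div (((((((((h1 a).mul (h2 a)).mul (h1 b)).mul (h2 b)).mul
    (h1 c)).mul (h2 c)).mul (h1 d)).mul (h2 d))) ?_
  have e1 : ∀ s ∈ ({a, b, c, d} : Set ℂ), qPochInf (s * z) q ≠ 0 := fun s hs =>
    qPochInf_mul_ne_zero hq0 hq1 hs hzo
  have e2 : ∀ s ∈ ({a, b, c, d} : Set ℂ), qPochInf (s * z⁻¹) q ≠ 0 := fun s hs =>
    qPochInf_mul_inv_ne_zero hq0 hq1 hs hz0 hzi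
  have := e1 a (by simp); have := e1 b (by simp); have := e1 c (by simp)
  have := e1 d (by simp); have := e2 a (by simp); have := e2 b (by simp)
  have := e2 c (by simp); have := e2 d (by simp)
  simp only [ne_eq, mul_eq_zero, not_or]
  tauto

theorem meromorphicAt_awWeight (hq0 : 0 < q) (hq1 : q < 1) {a b c d z : ℂ} (hz0 : z ≠ 0) :
    MeromorphicAt (fun z => awWeight q z a b c d) z := by
  have han : ∀ {f : ℂ → ℂ}, AnalyticAt ℂ f z →
      MeromorphicAt (fun z => qPochInf (f z) q) z := fun hf =>
    (analyticAt_qPochInf_comp hq0 hq1 hf).meromorphicAt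
  have hinv : AnalyticAt ℂ (fun z : ℂ => z⁻¹) z := analyticAt_inv hz0
  have h1 : ∀ s : ℂ, MeromorphicAt (fun z => qPochInf (s * z) q) z := fun s => han (by fun_prop)
  have h2 : ∀ s : ℂ, MeromorphicAt (fun z => qPochInf (s * z⁻¹) q) z := fun s =>
    han (analyticAt_const.mul hinv)
  have h3 : MeromorphicAt (fun z => qPochInf (z ^ 2) q) z := han (by fun_prop)
  have h4 : MeromorphicAt (fun z : ℂ => qPochInf (z ^ 2)⁻¹ q) z :=
    han (AnalyticAt.inv (by fun_prop) (pow_ne_zero 2 hz0))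
  unfold awWeight
  exact (h3.mul h4).div (((((((((h1 a).mul (h2 a)).mul (h1 b)).mul (h2 b)).mul
    (h1 c)).mul (h2 c)).mul (h1 d)).mul (h2 d)))

theorem differentiableAt_awIntegrand (hq0 : 0 < q) (hq1 : q < 1) {a b c d z : ℂ} (hz0 : z ≠ 0)
    (hz : z ∉ innerPoles q {a, b, c, d} ∪ outerPoles q {a, b, c, d}) (p : Polynomial ℂ) :
    DifferentiableAt ℂ (fun z => z⁻¹ * (awWeight q z a b c d * p.eval (z + z⁻¹))) z := by
  have h1 := differentiableAt_awWeight hq0 hq1 hz0 hz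
  have h2 : DifferentiableAt ℂ (fun z : ℂ => p.eval (z + z⁻¹)) z :=
    DifferentiableAt.comp (g := fun w => p.eval w) z p.differentiableAt
      (by fun_prop (disch := assumption))
  exact (differentiableAt_inv hz0).mul (h1.mul h2)

theorem continuousOn_awIntegrand (hq0 : 0 < q) (hq1 : q < 1) {a b c d : ℂ}
    (hA : Admissible q {a, b, c, d} ε) (p : Polynomial ℂ) :
    ContinuousOn (fun z => z⁻¹ * (awWeight q z a b c d * p.eval (z + z⁻¹)))
      (contourCurve q {a, b, c, d} ε) := fun _ hz =>
  (differentiableAt_awIntegrand hq0 hq1 (hA.ne_zero_of_mem_contourCurve hz)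
    (fun h => hA.notMem_contourCurve h hz) p).continuousAt.continuousWithinAt

theorem awIntegral_add (hq0 : 0 < q) (hq1 : q < 1) {a b c d : ℂ}
    (hA : Admissible q {a, b, c, d} ε) (p p' : Polynomial ℂ) :
    awIntegral q ε a b c d (p + p') = awIntegral q ε a b c d p + awIntegral q ε a b c d p' := by
  unfold awIntegral
  rw [← contourIntegral_add hq0 hq1 hA.finite hA.small.1
    (continuousOn_awIntegrand hq0 hq1 hA p) (continuousOn_awIntegrand hq0 hq1 hA p')]
  congr 1
  funext z
  rw [Polynomial.eval_add]
  ring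

theorem awIntegral_smul (hq0 : 0 < q) (hq1 : q < 1) {a b c d : ℂ} (r : ℂ) (p : Polynomial ℂ) :
    awIntegral q ε a b c d (r • p) = r * awIntegral q ε a b c d p := by
  unfold awIntegral
  rw [← contourIntegral_const_mul hq0 hq1 (finite_params a b c d)]
  congr 1
  funext z
  rw [Polynomial.eval_smul, smul_eq_mul]
  ring

/-- A factor of the basis polynomials is absorbed by the weight as a shift `a ↦ a q`. -/
theorem awIntegral_shift (hq0 : 0 < q) (hq1 : q < 1) {a b c d : ℂ}
    (hA : Admissible q {a, b, c, d} ε) (p : Polynomial ℂ) :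
    awIntegral q ε a b c d
        ((Polynomial.C (1 + a ^ 2) - Polynomial.C a * Polynomial.X) * p) =
      awIntegral q ε (a * q) b c d p := by
  have hA' := hA.shift hq0
  have hq := norm_ofReal_lt_one hq0 hq1
  have hin : innerPoles q {a * q, b, c, d} ⊆ innerPoles q {a, b, c, d} := by
    rintro p ⟨s, hs, k, rfl⟩
    rcases hs with rfl | hs
    · exact ⟨a, Or.inl rfl, k + 1, by ring⟩
    · exact ⟨s, Or.inr hs, k, rfl⟩
  unfold awIntegral
  rw [contourIntegral_eq_of_subset hA hA' hq0 hq1 hin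
    (fun z hz hzP => differentiableAt_awIntegrand hq0 hq1 hz hzP p)
    (fun z hz => (by fun_prop : MeromorphicAt (fun z : ℂ => z⁻¹) z).mul
      ((meromorphicAt_awWeight hq0 hq1 hz).mul
        (AnalyticAt.comp (g := fun w => p.eval w) (p.differentiable.analyticAt _)
          (analyticAt_id.add (analyticAt_inv hz))).meromorphicAt))]
  refine contourIntegral_congr hA.small.1 fun z hz => ?_
  have hz0 := hA.ne_zero_of_mem_contourCurve hz
  have hzi : z ∉ innerPoles q {a, b, c, d} := fun h => hA.notMem_contourCurve (Or.inl h) hz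
  have hzo : z ∉ outerPoles q {a, b, c, d} := fun h => hA.notMem_contourCurve (Or.inr h) hz
  have h1 := qPochInf_mul_ne_zero hq0 hq1 (s := a) (by simp) hzo
  have h2 := qPochInf_mul_inv_ne_zero hq0 hq1 (s := a) (by simp) hz0 hzi
  have e1 : qPochInf (a * z) q = (1 - a * z) * qPochInf (a * q * z) q := by
    rw [qPochInf_eq_mul hq, mul_right_comm]
  have e2 : qPochInf (a * z⁻¹) q = (1 - a * z⁻¹) * qPochInf (a * q * z⁻¹) q := by
    rw [qPochInf_eq_mul hq, mul_right_comm]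
  rw [e1] at h1
  rw [e2] at h2
  have e3 : (Polynomial.C (1 + a ^ 2) - Polynomial.C a * Polynomial.X).eval (z + z⁻¹) =
      (1 - a * z) * (1 - a * z⁻¹) := by
    simp only [Polynomial.eval_sub, Polynomial.eval_mul, Polynomial.eval_C, Polynomial.eval_X]
    field_simp
    ring
  simp only [awWeight, Polynomial.eval_mul, e3, e1, e2]
  have n1 := left_ne_zero_of_mul h1
  have n2 := left_ne_zero_of_mul h2
  rw [← mul_assoc (_ / _) _ (p.eval _)]
  congr 2
  rw [div_mul_eq_mul_div, ← mul_div_mul_right _ (qPochInf (a * q * z) q *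
    qPochInf (a * q * z⁻¹) q * qPochInf (b * z) q * qPochInf (b * z⁻¹) q *
      qPochInf (c * z) q * qPochInf (c * z⁻¹) q * qPochInf (d * z) q * qPochInf (d * z⁻¹) q)
      (mul_ne_zero n1 n2)]
  congr 1
  ring

end AskeyWilson

end SepVar

namespace SepVar

/-! ### The shift of a parameter in the Askey–Wilson integral -/

section AskeyWilsonValue

variable {q : ℝ} {ε : ℝ}

/-- The function whose `q`-difference gives the first moment of the Askey–Wilson weight. -/
noncomputable def awPotential (q a b c d z : ℂ) : ℂ :=
  z * (qPochInf (z ^ 2) q * qPochInf (q * (z ^ 2)⁻¹) q) /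
    (qPochInf (a * z) q * qPochInf (a * q * z⁻¹) q * (qPochInf (b * z) q *
      qPochInf (b * q * z⁻¹) q) * (qPochInf (c * z) q * qPochInf (c * q * z⁻¹) q) *
      (qPochInf (d * z) q * qPochInf (d * q * z⁻¹) q))

/-- The substitution `z ↦ q z` turns the potential into minus its image under `z ↦ 1 / z`. -/
theorem awPotential_mul (hq0 : 0 < q) (hq1 : q < 1) (a b c d : ℂ) {z : ℂ} (hz : z ≠ 0) :
    awPotential q a b c d (q * z) = -awPotential q a b c d z⁻¹ := by
  have hqc : (q : ℂ) ≠ 0 := by exact_mod_cast hq0.ne'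
  have hq := norm_ofReal_lt_one hq0 hq1
  have e1 : qPochInf (q * (z⁻¹ ^ 2)⁻¹) q = (1 - q * z ^ 2) * qPochInf ((q * z) ^ 2) q := by
    rw [qPochInf_eq_mul hq, inv_pow, inv_inv]
    congr 2
    ring
  have e2 : qPochInf (q * ((q * z) ^ 2)⁻¹) q =
      (1 - (q * z ^ 2)⁻¹) * qPochInf (z⁻¹ ^ 2) q := by
    rw [qPochInf_eq_mul hq]
    congr 2 <;> field_simp
  have e3 : ∀ s : ℂ, qPochInf (s * q * (q * z)⁻¹) q = qPochInf (s * z⁻¹) q := by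
    intro s
    congr 1
    field_simp
  have e4 : ∀ s : ℂ, qPochInf (s * q * z⁻¹⁻¹) q = qPochInf (s * (q * z)) q := by
    intro s
    rw [inv_inv, mul_assoc]
  unfold awPotential
  simp only [e1, e2, e3, e4]
  rw [← neg_div]
  congr 1
  · field_simp
    ring
  · ring

theorem first_moment_identity (a b c d : ℂ) {z : ℂ} (hz : z ≠ 0) :
    z * (1 - z ^ 2) * ((1 - a * z⁻¹) * (1 - b * z⁻¹) * (1 - c * z⁻¹) * (1 - d * z⁻¹)) +
        (1 - a * z) * (1 - b * z) * (1 - c * z) * (1 - d * z) * (z⁻¹ * (1 - (z ^ 2)⁻¹)) =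
      (1 - z ^ 2) * (1 - (z ^ 2)⁻¹) * ((1 - a * b * c * d) * (z + z⁻¹) -
        (a + b + c + d - (a * b * c + a * b * d + a * c * d + b * c * d))) := by
  field_simp
  ring

/-- The `q`-difference of the potential is the weight times a polynomial of degree one in
`z + z⁻¹`. -/
theorem awPotential_add (hq0 : 0 < q) (hq1 : q < 1) {a b c d z : ℂ} (hz0 : z ≠ 0)
    (h : ∀ s ∈ ({a, b, c, d} : Set ℂ), qPochInf (s * z) q ≠ 0 ∧ qPochInf (s * z⁻¹) q ≠ 0) :
    awPotential q a b c d z + awPotential q a b c d z⁻¹ =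
      awWeight q z a b c d * ((1 - a * b * c * d) * (z + z⁻¹) -
        (a + b + c + d - (a * b * c + a * b * d + a * c * d + b * c * d))) := by
  have hq := norm_ofReal_lt_one hq0 hq1
  have e1 : ∀ s w : ℂ, qPochInf (s * w) q = (1 - s * w) * qPochInf (s * q * w) q := by
    intro s w
    rw [qPochInf_eq_mul hq, mul_right_comm]
  have e2 : qPochInf (z ^ 2) q = (1 - z ^ 2) * qPochInf (q * z ^ 2) q := by
    rw [qPochInf_eq_mul hq, mul_comm]; ring_nf
  have e3 : qPochInf (z ^ 2)⁻¹ q = (1 - (z ^ 2)⁻¹) * qPochInf (q * (z ^ 2)⁻¹) q := by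
    rw [qPochInf_eq_mul hq, mul_comm]; ring_nf
  obtain ⟨ha1, ha2⟩ := h a (by simp)
  obtain ⟨hb1, hb2⟩ := h b (by simp)
  obtain ⟨hc1, hc2⟩ := h c (by simp)
  obtain ⟨hd1, hd2⟩ := h d (by simp)
  unfold awPotential awWeight
  simp only [inv_inv, inv_pow]
  rw [e1] at ha1 ha2 hb1 hb2 hc1 hc2 hd1 hd2
  rw [e1 a z, e1 a z⁻¹, e1 b z, e1 b z⁻¹, e1 c z, e1 c z⁻¹, e1 d z, e1 d z⁻¹, e2, e3]
  obtain ⟨ha1, pa1⟩ := mul_ne_zero_iff.1 ha1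
  obtain ⟨ha2, pa2⟩ := mul_ne_zero_iff.1 ha2
  obtain ⟨hb1, pb1⟩ := mul_ne_zero_iff.1 hb1
  obtain ⟨hb2, pb2⟩ := mul_ne_zero_iff.1 hb2
  obtain ⟨hc1, pc1⟩ := mul_ne_zero_iff.1 hc1
  obtain ⟨hc2, pc2⟩ := mul_ne_zero_iff.1 hc2
  obtain ⟨hd1, pd1⟩ := mul_ne_zero_iff.1 hd1
  obtain ⟨hd2, pd2⟩ := mul_ne_zero_iff.1 hd2
  generalize qPochInf (a * q * z) q = A1 at *
  generalize qPochInf (a * q * z⁻¹) q = A2 at *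
  generalize qPochInf (b * q * z) q = B1 at *
  generalize qPochInf (b * q * z⁻¹) q = B2 at *
  generalize qPochInf (c * q * z) q = C1 at *
  generalize qPochInf (c * q * z⁻¹) q = C2 at *
  generalize qPochInf (d * q * z) q = D1 at *
  generalize qPochInf (d * q * z⁻¹) q = D2 at *
  generalize qPochInf (q * z ^ 2) q = N1 at *
  generalize qPochInf (q * (z ^ 2)⁻¹) q = N2 at *
  set K := N1 * N2 / (A1 * A2 * B1 * B2 * C1 * C2 * D1 * D2) with hK
  set u := (1 - a * z) * (1 - b * z) * (1 - c * z) * (1 - d * z) with hu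
  set v := (1 - a * z⁻¹) * (1 - b * z⁻¹) * (1 - c * z⁻¹) * (1 - d * z⁻¹) with hv
  have hu0 : u ≠ 0 := by simp only [hu, ne_eq, mul_eq_zero, not_or]; tauto
  have hv0 : v ≠ 0 := by simp only [hv, ne_eq, mul_eq_zero, not_or]; tauto
  have k1 : z * ((1 - z ^ 2) * N1 * N2) / ((1 - a * z) * A1 * A2 * ((1 - b * z) * B1 * B2) *
      ((1 - c * z) * C1 * C2) * ((1 - d * z) * D1 * D2)) = K * (z * (1 - z ^ 2)) / u := by
    rw [hK, div_mul_eq_mul_div, div_div]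
    congr 1 <;> ring
  have k2 : z⁻¹ * ((1 - (z ^ 2)⁻¹) * N2 * (N1)) / ((1 - a * z⁻¹) * A2 * A1 *
      ((1 - b * z⁻¹) * B2 * B1) * ((1 - c * z⁻¹) * C2 * C1) * ((1 - d * z⁻¹) * D2 * D1)) =
      K * (z⁻¹ * (1 - (z ^ 2)⁻¹)) / v := by
    rw [hK, div_mul_eq_mul_div, div_div]
    congr 1 <;> ring
  have k3 : (1 - z ^ 2) * N1 * ((1 - (z ^ 2)⁻¹) * N2) / ((1 - a * z) * A1 * ((1 - a * z⁻¹) * A2) *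
      ((1 - b * z) * B1) * ((1 - b * z⁻¹) * B2) * ((1 - c * z) * C1) * ((1 - c * z⁻¹) * C2) *
      ((1 - d * z) * D1) * ((1 - d * z⁻¹) * D2)) =
      K * ((1 - z ^ 2) * (1 - (z ^ 2)⁻¹)) / (u * v) := by
    rw [hK, div_mul_eq_mul_div, div_div]
    congr 1 <;> ring
  rw [k1, k2, k3, div_add_div _ _ hu0 hv0, div_mul_eq_mul_div (b := u * v), div_left_inj'
    (mul_ne_zero hu0 hv0)]
  have hfm : z * (1 - z ^ 2) * v + u * (z⁻¹ * (1 - (z ^ 2)⁻¹)) = _ :=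
    first_moment_identity a b c d hz0
  clear_value K u v
  linear_combination K * hfm

theorem differentiableAt_awPotential (hq0 : 0 < q) (hq1 : q < 1) {a b c d z : ℂ} (hz0 : z ≠ 0)
    (hzi : z / q ∉ innerPoles q {a, b, c, d}) (hzo : z ∉ outerPoles q {a, b, c, d}) :
    DifferentiableAt ℂ (awPotential q a b c d) z := by
  have hqc : (q : ℂ) ≠ 0 := by exact_mod_cast hq0.ne'
  have han : ∀ {f : ℂ → ℂ}, AnalyticAt ℂ f z →
      DifferentiableAt ℂ (fun z => qPochInf (f z) q) z := fun hf =>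
    (analyticAt_qPochInf_comp hq0 hq1 hf).differentiableAt
  have hinv : AnalyticAt ℂ (fun z : ℂ => z⁻¹) z := analyticAt_inv hz0
  have h1 : ∀ s : ℂ, DifferentiableAt ℂ
      (fun z => qPochInf (s * z) q * qPochInf (s * q * z⁻¹) q) z := fun s =>
    (han (by fun_prop)).mul (han (analyticAt_const.mul hinv))
  have h3 : DifferentiableAt ℂ (fun z => qPochInf (z ^ 2) q) z := han (by fun_prop)
  have h4 : DifferentiableAt ℂ (fun z : ℂ => qPochInf (q * (z ^ 2)⁻¹) q) z :=
    han (analyticAt_const.mul (AnalyticAt.inv (by fun_prop) (pow_ne_zero 2 hz0)))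
  have e2 : ∀ s ∈ ({a, b, c, d} : Set ℂ),
      qPochInf (s * z) q * qPochInf (s * q * z⁻¹) q ≠ 0 := by
    intro s hs
    have := qPochInf_mul_inv_ne_zero hq0 hq1 hs (div_ne_zero hz0 hqc) hzi
    rw [inv_div, div_eq_mul_inv, ← mul_assoc] at this
    exact mul_ne_zero (qPochInf_mul_ne_zero hq0 hq1 hs hzo) this
  exact ((differentiableAt_id.mul (h3.mul h4))).div ((((h1 a).mul (h1 b)).mul (h1 c)).mul (h1 d))
    (mul_ne_zero (mul_ne_zero (mul_ne_zero (e2 a (by simp)) (e2 b (by simp))) (e2 c (by simp)))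
      (e2 d (by simp)))

theorem meromorphicAt_awPotential (hq0 : 0 < q) (hq1 : q < 1) (a b c d : ℂ) {z : ℂ}
    (hz0 : z ≠ 0) : MeromorphicAt (awPotential q a b c d) z := by
  have han : ∀ {f : ℂ → ℂ}, AnalyticAt ℂ f z →
      MeromorphicAt (fun z => qPochInf (f z) q) z := fun hf =>
    (analyticAt_qPochInf_comp hq0 hq1 hf).meromorphicAt
  have hinv : AnalyticAt ℂ (fun z : ℂ => z⁻¹) z := analyticAt_inv hz0
  have h1 : ∀ s : ℂ, MeromorphicAt
      (fun z => qPochInf (s * z) q * qPochInf (s * q * z⁻¹) q) z := fun s =>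
    (han (by fun_prop)).mul (han (analyticAt_const.mul hinv))
  have h3 : MeromorphicAt (fun z => qPochInf (z ^ 2) q) z := han (by fun_prop)
  have h4 : MeromorphicAt (fun z : ℂ => qPochInf (q * (z ^ 2)⁻¹) q) z :=
    han (analyticAt_const.mul (AnalyticAt.inv (by fun_prop) (pow_ne_zero 2 hz0)))
  exact ((analyticAt_id.meromorphicAt.mul (h3.mul h4))).div
    ((((h1 a).mul (h1 b)).mul (h1 c)).mul (h1 d))

theorem Admissible.mul_mul_pow_ne_one {S : Set ℂ} (hA : Admissible q S ε) {s s' : ℂ}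
    (hs : s ∈ S) (hs' : s' ∈ S) (k : ℕ) : s * s' * (q : ℂ) ^ k ≠ 1 := by
  intro h
  refine (Set.disjoint_left.1 hA.generic.2 : ∀ ⦃p⦄, _) (⟨s, hs, 0, by simp⟩ : s ∈ innerPoles q S)
    ⟨s', hs', k, ?_⟩
  rw [eq_comm, inv_eq_of_mul_eq_one_right]
  linear_combination h

/-- The first moment of the weight: the integral of the `q`-difference of `awPotential` vanishes, as
the potential has no poles at the parameters themselves. -/
theorem awIntegral_first_moment (hq0 : 0 < q) (hq1 : q < 1) {a b c d : ℂ}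
    (hA : Admissible q {a, b, c, d} ε) :
    awIntegral q ε a b c d (Polynomial.C (1 - a * b * c * d) * Polynomial.X - Polynomial.C
      (a + b + c + d - (a * b * c + a * b * d + a * c * d + b * c * d))) = 0 := by
  have hqc : (q : ℂ) ≠ 0 := by exact_mod_cast hq0.ne'
  have hinq : ∀ {p : ℂ}, p / q ∈ innerPoles q {a, b, c, d} → p ∈ innerPoles q {a, b, c, d} := by
    rintro p ⟨s, hs, k, hk⟩
    refine ⟨s, hs, k + 1, ?_⟩
    rw [div_eq_iff hqc] at hk
    rw [hk]; ring
  have hcurve : ∀ z ∈ contourCurve q {a, b, c, d} ε, z ≠ 0 ∧ z ∉ innerPoles q {a, b, c, d} ∧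
      z ∉ outerPoles q {a, b, c, d} := fun z hz =>
    ⟨hA.ne_zero_of_mem_contourCurve hz, fun h => hA.notMem_contourCurve (Or.inl h) hz,
      fun h => hA.notMem_contourCurve (Or.inr h) hz⟩
  have hd1 : ∀ z ∈ contourCurve q {a, b, c, d} ε,
      DifferentiableAt ℂ (awPotential q a b c d) z := by
    intro z hz
    obtain ⟨h0, hi, ho⟩ := hcurve z hz
    exact differentiableAt_awPotential hq0 hq1 h0 (fun h => hi (hinq h)) ho
  have hd2 : ∀ z ∈ contourCurve q {a, b, c, d} ε,
      DifferentiableAt ℂ (fun z => awPotential q a b c d z⁻¹) z := by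
    intro z hz
    obtain ⟨h0, hi, ho⟩ := hcurve z hz
    refine DifferentiableAt.comp (g := awPotential q a b c d) z
      (differentiableAt_awPotential hq0 hq1 (inv_ne_zero h0) (fun h => ho ?_) fun h => hi ?_)
      (differentiableAt_inv h0)
    · rw [outerPoles_eq]; exact hinq h
    · rw [outerPoles_eq] at h; simpa using h
  have key : awIntegral q ε a b c d (Polynomial.C (1 - a * b * c * d) * Polynomial.X - Polynomial.C
      (a + b + c + d - (a * b * c + a * b * d + a * c * d + b * c * d))) =
      contourIntegral q {a, b, c, d} ε fun z => z⁻¹ * awPotential q a b c d z +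
        z⁻¹ * awPotential q a b c d z⁻¹ := by
    refine contourIntegral_congr hA.small.1 fun z hz => ?_
    obtain ⟨h0, hi, ho⟩ := hcurve z hz
    simp only [Polynomial.eval_sub, Polynomial.eval_mul, Polynomial.eval_C, Polynomial.eval_X]
    rw [← awPotential_add hq0 hq1 h0 fun s hs => ⟨qPochInf_mul_ne_zero hq0 hq1 hs ho,
      qPochInf_mul_inv_ne_zero hq0 hq1 hs h0 hi⟩, mul_add]
  rw [key, contourIntegral_add (F := fun z => z⁻¹ * awPotential q a b c d z)
      (G := fun z => z⁻¹ * awPotential q a b c d z⁻¹) hq0 hq1 hA.finite hA.small.1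
    (fun z hz => ((differentiableAt_inv (hcurve z hz).1).mul
      (hd1 z hz)).continuousAt.continuousWithinAt)
    (fun z hz => ((differentiableAt_inv (hcurve z hz).1).mul
      (hd2 z hz)).continuousAt.continuousWithinAt),
    ← contourIntegral_comp_mul hA hq0 hq1
      (fun z h0 hi ho => differentiableAt_awPotential hq0 hq1 h0 hi ho)
      (fun z h0 => meromorphicAt_awPotential hq0 hq1 a b c d h0)]
  have h3 : contourIntegral q {a, b, c, d} ε (fun z => z⁻¹ * awPotential q a b c d (q * z)) =
      contourIntegral q {a, b, c, d} ε (fun z => (-1) * (z⁻¹ * awPotential q a b c d z⁻¹)) := by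
    refine contourIntegral_congr hA.small.1 fun z hz => ?_
    simp only [awPotential_mul hq0 hq1 a b c d (hcurve z hz).1]
    ring
  rw [h3, contourIntegral_const_mul hq0 hq1 hA.finite]
  ring

/-- Absorbing `1 + a² - a (z + z⁻¹)` into the weight and inserting the first moment gives the ratio
of the integrals for `a q` and for `a`. -/
theorem awIntegral_one_shift (hq0 : 0 < q) (hq1 : q < 1) {a b c d : ℂ}
    (hA : Admissible q {a, b, c, d} ε) :
    (1 - a * b * c * d) * awIntegral q ε (a * q) b c d 1 =
      (1 - a * b) * (1 - a * c) * (1 - a * d) * awIntegral q ε a b c d 1 := by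
  have h1 := awIntegral_first_moment hq0 hq1 hA
  have h2 := awIntegral_shift hq0 hq1 hA 1
  have e1 : (Polynomial.C (1 - a * b * c * d) * Polynomial.X - Polynomial.C
      (a + b + c + d - (a * b * c + a * b * d + a * c * d + b * c * d)) : Polynomial ℂ) =
      (1 - a * b * c * d) • Polynomial.X +
      (-(a + b + c + d - (a * b * c + a * b * d + a * c * d + b * c * d))) • 1 := by
    simp only [Polynomial.smul_eq_C_mul, Polynomial.C_neg]
    ring
  have e2 : ((Polynomial.C (1 + a ^ 2) - Polynomial.C a * Polynomial.X) * 1 : Polynomial ℂ) =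
      (1 + a ^ 2) • 1 + (-a) • Polynomial.X := by
    simp only [Polynomial.smul_eq_C_mul, Polynomial.C_neg]
    ring
  rw [e1, awIntegral_add hq0 hq1 hA, awIntegral_smul hq0 hq1, awIntegral_smul hq0 hq1] at h1
  rw [e2, awIntegral_add hq0 hq1 hA, awIntegral_smul hq0 hq1, awIntegral_smul hq0 hq1] at h2
  rw [← h2]
  linear_combination (-a) * h1

theorem awValue_shift (hq0 : 0 < q) (hq1 : q < 1) {a b c d : ℂ}
    (hA : Admissible q {a, b, c, d} ε) :
    (1 - a * b * c * d) * awValue q (a * q) b c d =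
      (1 - a * b) * (1 - a * c) * (1 - a * d) * awValue q a b c d := by
  have hq := norm_ofReal_lt_one hq0 hq1
  have hne : ∀ s ∈ ({a, b, c, d} : Set ℂ), 1 - a * s ≠ 0 := fun s hs => by
    have := hA.mul_mul_pow_ne_one (s := a) (by simp) hs 0
    rw [pow_zero, mul_one] at this
    exact sub_ne_zero.2 this.symm
  have hb := hne b (by simp)
  have hc := hne c (by simp)
  have hd := hne d (by simp)
  unfold awValue
  rw [qPochInf_eq_mul hq (a * b * c * d), qPochInf_eq_mul hq (a * b), qPochInf_eq_mul hq (a * c),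
    qPochInf_eq_mul hq (a * d), show a * q * b * c * d = a * b * c * d * q by ring,
    mul_right_comm a q b, mul_right_comm a q c, mul_right_comm a q d, ← mul_div_assoc,
    ← mul_div_assoc, ← mul_div_mul_left _ _ (mul_ne_zero (mul_ne_zero hb hc) hd)]
  congr 1 <;> ring

theorem awValue_ne_zero (hq0 : 0 < q) (hq1 : q < 1) {a b c d : ℂ}
    (hA : Admissible q {a, b, c, d} ε) (h4 : ∀ k : ℕ, a * b * c * d * (q : ℂ) ^ k ≠ 1) :
    awValue q a b c d ≠ 0 := by
  have hq := norm_ofReal_lt_one hq0 hq1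
  have hne : ∀ s ∈ ({a, b, c, d} : Set ℂ), ∀ s' ∈ ({a, b, c, d} : Set ℂ),
      qPochInf (s * s') q ≠ 0 := fun s hs s' hs' =>
    qPochInf_ne_zero hq fun k => hA.mul_mul_pow_ne_one hs hs' k
  have := qPochInf_ne_zero_of_norm_lt_one hq hq
  have := hne a (by simp) b (by simp)
  have := hne a (by simp) c (by simp)
  have := hne a (by simp) d (by simp)
  have := hne b (by simp) c (by simp)
  have := hne b (by simp) d (by simp)
  have := hne c (by simp) d (by simp)
  have := qPochInf_ne_zero hq h4
  simp only [awValue, ne_eq, div_eq_zero_iff, mul_eq_zero, not_or]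
  refine ⟨⟨two_ne_zero, this⟩, ?_⟩
  tauto

/-- The quotient of the Askey–Wilson integral by its expected value is invariant under a shift of
one parameter. -/
theorem awIntegral_div_awValue_shift (hq0 : 0 < q) (hq1 : q < 1) {a b c d : ℂ}
    (hA : Admissible q {a, b, c, d} ε) (h4 : ∀ k : ℕ, a * b * c * d * (q : ℂ) ^ k ≠ 1) :
    awIntegral q ε (a * q) b c d 1 / awValue q (a * q) b c d =
      awIntegral q ε a b c d 1 / awValue q a b c d := by
  have h1 : 1 - a * b * c * d ≠ 0 := by
    have := h4 0
    rw [pow_zero, mul_one] at this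
    exact sub_ne_zero.2 this.symm
  have hA' := hA.shift hq0
  have h4' : ∀ k : ℕ, a * q * b * c * d * (q : ℂ) ^ k ≠ 1 := fun k => by
    have := h4 (k + 1)
    rwa [show a * q * b * c * d * (q : ℂ) ^ k = a * b * c * d * (q : ℂ) ^ (k + 1) by ring]
  rw [div_eq_div_iff (awValue_ne_zero hq0 hq1 hA' h4') (awValue_ne_zero hq0 hq1 hA h4)]
  apply mul_left_cancel₀ h1
  linear_combination awValue q a b c d * awIntegral_one_shift hq0 hq1 hA -
    awIntegral q ε a b c d 1 * awValue_shift hq0 hq1 hA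

theorem awIntegral_div_awValue_shift_all (hq0 : 0 < q) (hq1 : q < 1) {a b c d : ℂ}
    (hA : Admissible q {a, b, c, d} ε) (h4 : ∀ k : ℕ, a * b * c * d * (q : ℂ) ^ k ≠ 1) :
    Admissible q {a * q, b * q, c * q, d * q} ε ∧
      awIntegral q ε (a * q) (b * q) (c * q) (d * q) 1 /
          awValue q (a * q) (b * q) (c * q) (d * q) =
        awIntegral q ε a b c d 1 / awValue q a b c d := by
  have step : ∀ {a b c d : ℂ}, Admissible q {a, b, c, d} ε →
      (∀ k : ℕ, a * b * c * d * (q : ℂ) ^ k ≠ 1) →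
      Admissible q {b, c, d, a * q} ε ∧ (∀ k : ℕ, b * c * d * (a * q) * (q : ℂ) ^ k ≠ 1) ∧
      awIntegral q ε b c d (a * q) 1 / awValue q b c d (a * q) =
        awIntegral q ε a b c d 1 / awValue q a b c d := by
    intro a b c d hA h4
    refine ⟨params_rotate (a * q) b c d ▸ hA.shift hq0, fun k => ?_, ?_⟩
    · have := h4 (k + 1)
      rwa [show b * c * d * (a * q) * (q : ℂ) ^ k = a * b * c * d * (q : ℂ) ^ (k + 1) by ring]
    · rw [← awIntegral_rotate, ← awValue_rotate]
      exact awIntegral_div_awValue_shift hq0 hq1 hA h4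
  obtain ⟨hA1, h41, e1⟩ := step hA h4
  obtain ⟨hA2, h42, e2⟩ := step hA1 h41
  obtain ⟨hA3, h43, e3⟩ := step hA2 h42
  obtain ⟨hA4, h44, e4⟩ := step hA3 h43
  exact ⟨hA4, by rw [e4, e3, e2, e1]⟩

end AskeyWilsonValue

end SepVar

namespace SepVar

/-! ### Evaluation of the Askey–Wilson integral -/

section AskeyWilsonEvaluation

variable {q : ℝ} {ε : ℝ}

theorem largePoles_eq_empty (hq0 : 0 < q) (hq1 : q < 1) {S : Set ℂ} (hS : ∀ s ∈ S, ‖s‖ < 1) :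
    largePoles q S = ∅ := by
  refine Set.eq_empty_iff_forall_notMem.2 ?_
  rintro p ⟨⟨s, hs, k, rfl⟩, hp⟩
  rw [norm_mul, norm_pow] at hp
  have h1 : ‖(q : ℂ)‖ ^ k ≤ 1 := pow_le_one₀ (norm_nonneg _) (norm_ofReal_lt_one hq0 hq1).le
  nlinarith [hS s hs, norm_nonneg s]

theorem generic_of_norm_lt_one (hq0 : 0 < q) (hq1 : q < 1) {S : Set ℂ} (h0 : (0 : ℂ) ∉ S)
    (hS : ∀ s ∈ S, ‖s‖ < 1) : Generic q S := by
  have h1 : ∀ p ∈ innerPoles q S, ‖p‖ < 1 := by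
    rintro p ⟨s, hs, k, rfl⟩
    rw [norm_mul, norm_pow]
    have h1 : ‖(q : ℂ)‖ ^ k ≤ 1 := pow_le_one₀ (norm_nonneg _) (norm_ofReal_lt_one hq0 hq1).le
    nlinarith [hS s hs, norm_nonneg s]
  refine ⟨fun p hp => (h1 p hp).ne, Set.disjoint_left.2 fun p hp hp' => ?_⟩
  rw [outerPoles_eq] at hp'
  have h2 := h1 _ hp'
  have hp0 : p ≠ 0 := fun h => zero_notMem_innerPoles hq0 h0 (h ▸ hp)
  rw [norm_inv] at h2
  exact (one_lt_inv₀ (norm_pos_iff.2 hp0)).2 (h1 p hp) |>.not_gt h2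

theorem admissible_of_norm_lt_one (hq0 : 0 < q) (hq1 : q < 1) {S : Set ℂ} (hf : S.Finite)
    (h0 : (0 : ℂ) ∉ S) (hS : ∀ s ∈ S, ‖s‖ < 1) (hε : 0 < ε) : Admissible q S ε := by
  have hl := largePoles_eq_empty hq0 hq1 hS
  refine ⟨hf, h0, generic_of_norm_lt_one hq0 hq1 h0 hS, ⟨hε, ?_⟩, ?_⟩ <;>
  · rw [hl]
    exact fun p hp => absurd hp (Set.notMem_empty p)

theorem contourIntegral_of_norm_lt_one (hq0 : 0 < q) (hq1 : q < 1) {S : Set ℂ}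
    (hS : ∀ s ∈ S, ‖s‖ < 1) (F : ℂ → ℂ) :
    contourIntegral q S ε F = (2 * (π : ℂ) * Complex.I)⁻¹ * ∮ x in C(0, 1), F x := by
  rw [contourIntegral, largePoles_eq_empty hq0 hq1 hS, finsum_mem_empty, add_zero]

theorem tendsto_circleIntegral_awWeight (hq0 : 0 < q) (hq1 : q < 1) (a b c d : ℂ) :
    Filter.Tendsto (fun N : ℕ => ∮ z in C(0, 1), z⁻¹ * awWeight q z (a * (q : ℂ) ^ N)
        (b * (q : ℂ) ^ N) (c * (q : ℂ) ^ N) (d * (q : ℂ) ^ N)) Filter.atTop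
      (nhds (∮ z in C(0, 1), z⁻¹ * awWeight q z 0 0 0 0)) := by
  have hq := norm_ofReal_lt_one hq0 hq1
  set f : ℂ → Metric.sphere (0 : ℂ) 1 → ℂ := fun τ z =>
    (z : ℂ)⁻¹ * awWeight q z (a * τ) (b * τ) (c * τ) (d * τ) with hf
  set U : Set ℂ := {τ | ‖a * τ‖ < 1 ∧ ‖b * τ‖ < 1 ∧ ‖c * τ‖ < 1 ∧ ‖d * τ‖ < 1} with hU
  have hUo : IsOpen U := by
    have h : ∀ s : ℂ, IsOpen {τ : ℂ | ‖s * τ‖ < 1} := fun s =>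
      isOpen_lt (by fun_prop) continuous_const
    exact (h a).inter ((h b).inter ((h c).inter (h d)))
  have hU0 : U ∈ nhds (0 : ℂ) := hUo.mem_nhds (by simp [hU])
  have hz0 : ∀ z : Metric.sphere (0 : ℂ) 1, (z : ℂ) ≠ 0 := fun z h => by
    have := z.2
    rw [h] at this
    simp at this
  have hz1 : ∀ z : Metric.sphere (0 : ℂ) 1, ‖(z : ℂ)‖ = 1 := fun z => by simp
  have hcont : ContinuousOn ↿f (U ×ˢ Set.univ) := by
    rintro ⟨τ, z⟩ ⟨hτ, -⟩
    have hz := hz0 z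
    have hP : ∀ {g : ℂ × Metric.sphere (0 : ℂ) 1 → ℂ}, ContinuousAt g (τ, z) →
        ContinuousAt (fun x => qPochInf (g x) q) (τ, z) := fun hg =>
      ContinuousAt.comp (g := fun w => qPochInf w q) (continuous_qPochInf hq).continuousAt hg
    have hz' : ContinuousAt (fun x : ℂ × Metric.sphere (0 : ℂ) 1 => (x.2 : ℂ)) (τ, z) := by
      fun_prop
    have hzi : ContinuousAt (fun x : ℂ × Metric.sphere (0 : ℂ) 1 => (x.2 : ℂ)⁻¹) (τ, z) :=
      hz'.inv₀ hz
    have hz2 : ContinuousAt (fun x : ℂ × Metric.sphere (0 : ℂ) 1 => ((x.2 : ℂ) ^ 2)⁻¹) (τ, z) :=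
      (hz'.pow 2).inv₀ (pow_ne_zero 2 hz)
    have h1 : ∀ s : ℂ, ContinuousAt (fun x : ℂ × Metric.sphere (0 : ℂ) 1 =>
        qPochInf (s * x.1 * x.2) q) (τ, z) := fun s => hP (by fun_prop)
    have h2 : ∀ s : ℂ, ContinuousAt (fun x : ℂ × Metric.sphere (0 : ℂ) 1 =>
        qPochInf (s * x.1 * (x.2 : ℂ)⁻¹) q) (τ, z) := fun s => hP (by fun_prop)
    have n1 : ∀ s : ℂ, ‖s * τ‖ < 1 → qPochInf (s * τ * z) q ≠ 0 := fun s hs =>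
      qPochInf_ne_zero_of_norm_lt_one hq (by rw [norm_mul, hz1, mul_one]; exact hs)
    have n2 : ∀ s : ℂ, ‖s * τ‖ < 1 → qPochInf (s * τ * (z : ℂ)⁻¹) q ≠ 0 := fun s hs =>
      qPochInf_ne_zero_of_norm_lt_one hq
        (by rw [norm_mul, norm_inv, hz1, inv_one, mul_one]; exact hs)
    obtain ⟨ha, hb, hc, hd⟩ := hτ
    refine ContinuousAt.continuousWithinAt ?_
    refine hzi.mul (((hP (hz'.pow 2)).mul (hP hz2)).div ((((((((h1 a).mul (h2 a)).mul (h1 b)).mul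
      (h2 b)).mul (h1 c)).mul (h2 c)).mul (h1 d)).mul (h2 d)) ?_)
    exact mul_ne_zero (mul_ne_zero (mul_ne_zero (mul_ne_zero (mul_ne_zero (mul_ne_zero (mul_ne_zero
      (n1 a ha) (n2 a ha)) (n1 b hb)) (n2 b hb)) (n1 c hc)) (n2 c hc)) (n1 d hd)) (n2 d hd)
  have hunif := ContinuousOn.tendstoUniformly hU0 hcont
  have hpow : Filter.Tendsto (fun N : ℕ => (q : ℂ) ^ N) Filter.atTop (nhds 0) :=
    tendsto_pow_atTop_nhds_zero_of_norm_lt_one hq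
  have hlim := TendstoUniformlyOn.tendsto_circleIntegral_of_continuousOn (l := Filter.atTop)
    (f := fun (N : ℕ) (z : ℂ) => z⁻¹ * awWeight q z (a * (q : ℂ) ^ N)
        (b * (q : ℂ) ^ N) (c * (q : ℂ) ^ N) (d * (q : ℂ) ^ N))
    (g := fun z => z⁻¹ * awWeight q z 0 0 0 0) (c := 0) (R := 1) zero_le_one ?_ ?_
  · exact hlim
  · filter_upwards [hpow.eventually hU0] with N hN
    rw [continuousOn_iff_continuous_domRestrict]
    have : Continuous fun z : Metric.sphere (0 : ℂ) 1 => (((q : ℂ) ^ N, z) : ℂ × _) := by fun_prop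
    exact hcont.comp_continuous this fun z => ⟨hN, Set.mem_univ _⟩
  · rw [tendstoUniformlyOn_iff_tendstoUniformly_comp_coe]
    intro u hu
    have := hpow.eventually (hunif u hu)
    simpa [hf] using this

theorem tendsto_awValue (hq0 : 0 < q) (hq1 : q < 1) (a b c d : ℂ) :
    Filter.Tendsto (fun N : ℕ => awValue q (a * (q : ℂ) ^ N)
        (b * (q : ℂ) ^ N) (c * (q : ℂ) ^ N) (d * (q : ℂ) ^ N)) Filter.atTop
      (nhds (awValue q 0 0 0 0)) := by
  have hq := norm_ofReal_lt_one hq0 hq1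
  have hpow : Filter.Tendsto (fun N : ℕ => (q : ℂ) ^ N) Filter.atTop (nhds 0) :=
    tendsto_pow_atTop_nhds_zero_of_norm_lt_one hq
  have h : ContinuousAt (fun τ : ℂ => awValue q (a * τ) (b * τ) (c * τ) (d * τ)) 0 := by
    have hP : ∀ {g : ℂ → ℂ}, ContinuousAt g 0 →
        ContinuousAt (fun x => qPochInf (g x) q) 0 := fun hg =>
      ContinuousAt.comp (g := fun w => qPochInf w q) (continuous_qPochInf hq).continuousAt hg
    have h2 : ∀ s s' : ℂ, ContinuousAt (fun τ : ℂ => qPochInf (s * τ * (s' * τ)) q) 0 :=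
      fun s s' => hP (by fun_prop)
    refine (continuousAt_const.mul (hP (by fun_prop))).div (((((((continuousAt_const).mul
      (h2 a b)).mul (h2 a c)).mul (h2 a d)).mul (h2 b c)).mul (h2 b d)).mul (h2 c d)) ?_
    simpa [qPochInf_zero_left] using qPochInf_ne_zero_of_norm_lt_one hq hq
  have := h.tendsto.comp hpow
  simpa [Function.comp_def] using this

/-- The quotient of the Askey–Wilson integral by its expected value does not depend on the
parameters: they can be shifted to `0`. -/
theorem awIntegral_div_awValue (hq0 : 0 < q) (hq1 : q < 1) {a b c d : ℂ}
    (hA : Admissible q {a, b, c, d} ε) (h4 : ∀ k : ℕ, a * b * c * d * (q : ℂ) ^ k ≠ 1) :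
    awIntegral q ε a b c d 1 / awValue q a b c d = (2 * (π : ℂ) * Complex.I)⁻¹ *
      (∮ z in C(0, 1), z⁻¹ * awWeight q z 0 0 0 0) / awValue q 0 0 0 0 := by
  have hq := norm_ofReal_lt_one hq0 hq1
  have hpow : Filter.Tendsto (fun N : ℕ => (q : ℂ) ^ N) Filter.atTop (nhds 0) :=
    tendsto_pow_atTop_nhds_zero_of_norm_lt_one hq
  have hN : ∀ N : ℕ, Admissible q {a * q ^ N, b * q ^ N, c * q ^ N, d * q ^ N} ε ∧
      awIntegral q ε (a * q ^ N) (b * q ^ N) (c * q ^ N) (d * q ^ N) 1 /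
        awValue q (a * q ^ N) (b * q ^ N) (c * q ^ N) (d * q ^ N) =
      awIntegral q ε a b c d 1 / awValue q a b c d := by
    intro N
    induction N with
    | zero => simpa using hA
    | succ N ih =>
      obtain ⟨h1, h2⟩ := awIntegral_div_awValue_shift_all hq0 hq1 ih.1 fun k => by
        have := h4 (4 * N + k)
        rwa [show a * q ^ N * (b * q ^ N) * (c * q ^ N) * (d * q ^ N) * (q : ℂ) ^ k =
          a * b * c * d * (q : ℂ) ^ (4 * N + k) by ring]
      simp only [pow_succ, ← mul_assoc]
      exact ⟨h1, h2.trans ih.2⟩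
  have hev : ∀ s : ℂ, ∀ᶠ N : ℕ in Filter.atTop, ‖s * (q : ℂ) ^ N‖ < 1 := by
    intro s
    have : Filter.Tendsto (fun N : ℕ => ‖s * (q : ℂ) ^ N‖) Filter.atTop (nhds 0) := by
      simpa using (hpow.const_mul s).norm
    exact this.eventually (gt_mem_nhds one_pos)
  have hv0 : awValue q 0 0 0 0 ≠ 0 := by
    simpa [awValue, qPochInf_zero_left] using qPochInf_ne_zero_of_norm_lt_one hq hq
  have hlim := ((tendsto_circleIntegral_awWeight hq0 hq1 a b c d).const_mul
    (2 * (π : ℂ) * Complex.I)⁻¹).div (tendsto_awValue hq0 hq1 a b c d) hv0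
  refine tendsto_nhds_unique (Filter.Tendsto.congr' ?_ tendsto_const_nhds) hlim
  filter_upwards [hev a, hev b, hev c, hev d] with N ha hb hc hd
  rw [← (hN N).2]
  simp only [Pi.div_apply]
  congr 1
  rw [awIntegral, contourIntegral_of_norm_lt_one hq0 hq1]
  · simp
  · simp only [Set.mem_insert_iff, Set.mem_singleton_iff]
    rintro s (rfl | rfl | rfl | rfl) <;> assumption

/-- For the parameters `q, -q, √q, -√q` the weight is a Laurent polynomial, the weight of the
Chebyshev polynomials of the second kind. -/
theorem awWeight_chebyshev (hq0 : 0 < q) (hq1 : q < 1) {z : ℂ} (hz : ‖z‖ = 1) :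
    awWeight q z q (-q) (√q : ℝ) (-(√q : ℝ)) = (1 - z ^ 2) * (1 - (z ^ 2)⁻¹) := by
  have hq := norm_ofReal_lt_one hq0 hq1
  set h : ℂ := ((√q : ℝ) : ℂ) with hh
  have hh2 : h ^ 2 = q := by
    rw [hh, ← Complex.ofReal_pow, Real.sq_sqrt hq0.le]
  have hq2 : ‖(q : ℂ) ^ 2‖ < 1 := by
    rw [norm_pow]; exact pow_lt_one₀ (norm_nonneg _) hq two_ne_zero
  -- the four factors combine to `(w² q; q)_∞`
  have key : ∀ w : ℂ, qPochInf (q * w) q * qPochInf (-q * w) q * qPochInf (h * w) q *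
      qPochInf (-h * w) q = qPochInf (w ^ 2 * q) q := by
    intro w
    rw [neg_mul, neg_mul, qPochInf_mul_qPochInf_neg hq, mul_assoc, qPochInf_mul_qPochInf_neg hq,
      ← qPochInf_sq_mul hq, mul_comm, mul_pow, hh2, mul_pow]
    congr 2 <;> ring
  have hz2 : ‖(z ^ 2 : ℂ) * q‖ < 1 := by rw [norm_mul, norm_pow, hz]; simpa using hq
  have hz3 : ‖(z⁻¹ ^ 2 : ℂ) * q‖ < 1 := by rw [norm_mul, norm_pow, norm_inv, hz]; simpa using hq
  have n1 := qPochInf_ne_zero_of_norm_lt_one hq hz2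
  have n2 := qPochInf_ne_zero_of_norm_lt_one hq hz3
  unfold awWeight
  rw [qPochInf_eq_mul hq (z ^ 2), qPochInf_eq_mul hq (z ^ 2)⁻¹, ← inv_pow,
    div_eq_iff, ← key z, ← key z⁻¹]
  · ring
  · rw [← key] at n1 n2
    intro h0
    refine mul_ne_zero n1 n2 ?_
    rw [← h0]
    ring

theorem awIntegral_chebyshev (hq0 : 0 < q) (hq1 : q < 1) :
    (2 * (π : ℂ) * Complex.I)⁻¹ *
      (∮ z in C(0, 1), z⁻¹ * awWeight q z q (-q) (√q : ℝ) (-(√q : ℝ))) = 2 := by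
  have h1 : (∮ z in C(0, 1), z⁻¹ * awWeight q z q (-q) (√q : ℝ) (-(√q : ℝ))) =
      ∮ z in C(0, 1), (2 * (z - 0) ^ (-1 : ℤ) - (z - 0) ^ (1 : ℤ) - (z - 0) ^ (-3 : ℤ)) := by
    refine circleIntegral.integral_congr zero_le_one fun z hz => ?_
    have hz1 : ‖z‖ = 1 := by simpa using hz
    have hz0 : z ≠ 0 := fun h => by simp [h] at hz1
    simp only [awWeight_chebyshev hq0 hq1 hz1, sub_zero]
    rw [zpow_neg_one, zpow_one, show (-3 : ℤ) = -(3 : ℕ) by norm_num, zpow_neg, zpow_natCast]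
    field_simp
    ring
  have hi : ∀ n : ℤ, CircleIntegrable (fun z : ℂ => (z - 0) ^ n) 0 1 := fun n => by
    rw [circleIntegrable_sub_zpow_iff]; simp
  have hi2 : CircleIntegrable (fun z : ℂ => 2 * (z - 0) ^ (-1 : ℤ)) 0 1 := by
    have := (hi (-1)).const_smul (a := (2 : ℂ))
    exact this
  rw [h1, circleIntegral.integral_sub (f := fun z : ℂ => 2 * (z - 0) ^ (-1 : ℤ) - (z - 0) ^ (1 : ℤ))
    (hi2.sub (hi 1)) (hi (-3)), circleIntegral.integral_sub hi2 (hi 1),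
    circleIntegral.integral_const_mul,
    circleIntegral.integral_sub_zpow_of_ne (n := 1) (by norm_num),
    circleIntegral.integral_sub_zpow_of_ne (n := -3) (by norm_num)]
  have h2 : (∮ z in C((0 : ℂ), 1), (z - 0) ^ (-1 : ℤ)) = 2 * (π : ℂ) * Complex.I := by
    simpa using circleIntegral.integral_sub_center_inv (0 : ℂ) (one_ne_zero (α := ℝ))
  rw [h2, sub_zero, sub_zero]
  have := Complex.two_pi_I_ne_zero
  field_simp

theorem awValue_chebyshev (hq0 : 0 < q) (hq1 : q < 1) :
    awValue q q (-q) (√q : ℝ) (-(√q : ℝ)) = 2 := by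
  have hq := norm_ofReal_lt_one hq0 hq1
  set h : ℂ := ((√q : ℝ) : ℂ) with hh
  have hh2 : h ^ 2 = q := by
    rw [hh, ← Complex.ofReal_pow, Real.sq_sqrt hq0.le]
  have hq2 : ‖(q : ℂ) ^ 2‖ < 1 := by
    rw [norm_pow]; exact pow_lt_one₀ (norm_nonneg _) hq two_ne_zero
  have hq3 : ‖(q : ℂ) ^ 3‖ < 1 := by
    rw [norm_pow]; exact pow_lt_one₀ (norm_nonneg _) hq three_ne_zero
  have n1 := qPochInf_ne_zero_of_norm_lt_one hq hq
  have n3 := qPochInf_ne_zero_of_norm_lt_one hq hq3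
  -- `(q; q)_∞ = (q; q²)_∞ (q; q)_∞ (-q; q)_∞`, whence `(q; q²)_∞ (-q; q)_∞ = 1`
  have e1 : qPochInf (q : ℂ) q =
      qPochInf q ((q : ℂ) ^ 2) * (qPochInf q q * qPochInf (-q) q) := by
    rw [qPochInf_mul_qPochInf_neg hq, ← qPochInf_sq_mul hq, ← pow_two]
  have e2 : qPochInf (q : ℂ) q = (1 - q) * ((1 - q ^ 2) * qPochInf ((q : ℂ) ^ 3) q) := by
    rw [qPochInf_eq_mul hq, qPochInf_eq_mul hq (q * q), ← pow_two, ← pow_succ]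
  have e3 : qPochInf (-(q : ℂ)) q = (1 + q) * qPochInf (-(q : ℂ) ^ 2) q := by
    rw [qPochInf_eq_mul hq, sub_neg_eq_add, neg_mul, ← pow_two]
  have e4 : qPochInf (q : ℂ) ((q : ℂ) ^ 2) = (1 - q) * qPochInf ((q : ℂ) ^ 3) ((q : ℂ) ^ 2) := by
    rw [qPochInf_eq_mul hq2, ← pow_succ']
  have e5 : qPochInf ((q : ℂ) * h) q * qPochInf (-(q * h)) q =
      qPochInf ((q : ℂ) ^ 3) ((q : ℂ) ^ 2) := by
    rw [qPochInf_mul_qPochInf_neg hq, mul_pow, hh2, ← pow_succ]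
  have e6 : qPochInf (q : ℂ) ((q : ℂ) ^ 2) * qPochInf (-q) q = 1 :=
    mul_left_cancel₀ n1 (by linear_combination -e1)
  rw [e3, e4] at e6
  unfold awValue
  have s1 : (q : ℂ) * -q * h * -h = q ^ 3 := by linear_combination (q : ℂ) ^ 2 * hh2
  have s2 : h * -h = -q := by linear_combination -hh2
  rw [s1, s2, show (q : ℂ) * -q = -q ^ 2 by ring, show (q : ℂ) * -h = -(q * h) by ring,
    show -(q : ℂ) * h = -(q * h) by ring, show -(q : ℂ) * -h = q * h by ring, e3, e2]
  set P := qPochInf (-(q : ℂ) ^ 2) q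
  set Y := qPochInf ((q : ℂ) ^ 3) ((q : ℂ) ^ 2)
  set Z := qPochInf ((q : ℂ) ^ 3) q
  set V := qPochInf ((q : ℂ) * h) q
  set W := qPochInf (-((q : ℂ) * h)) q
  have hden : (1 - (q : ℂ)) * ((1 - q ^ 2) * Z) * P * V * W * W * V * ((1 + q) * P) = Z := by
    have : (1 - (q : ℂ)) * ((1 - q ^ 2) * Z) * P * V * W * W * V * ((1 + q) * P) =
        Z * ((1 - q) * (V * W) * ((1 + q) * P)) ^ 2 := by ring
    rw [this, e5, e6]
    ring
  rw [hden, mul_div_assoc, div_self n3, mul_one]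

/-- The Askey–Wilson integral over the deformed contour. -/
theorem awIntegral_one (hq0 : 0 < q) (hq1 : q < 1) {a b c d : ℂ}
    (hA : Admissible q {a, b, c, d} ε) (h4 : ∀ k : ℕ, a * b * c * d * (q : ℂ) ^ k ≠ 1) :
    awIntegral q ε a b c d 1 = awValue q a b c d := by
  have hq := norm_ofReal_lt_one hq0 hq1
  have hqc : (q : ℂ) ≠ 0 := by exact_mod_cast hq0.ne'
  have hs0 : ((√q : ℝ) : ℂ) ≠ 0 := by exact_mod_cast (Real.sqrt_pos.2 hq0).ne'
  have hs1 : ‖((√q : ℝ) : ℂ)‖ < 1 := by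
    rw [Complex.norm_real, Real.norm_of_nonneg (Real.sqrt_nonneg q)]
    exact (Real.sqrt_lt' one_pos).2 (by simpa using hq1)
  have hnorm : ∀ s ∈ ({(q : ℂ), -(q : ℂ), ((√q : ℝ) : ℂ), -((√q : ℝ) : ℂ)} : Set ℂ), ‖s‖ < 1 := by
    simp only [Set.mem_insert_iff, Set.mem_singleton_iff]
    rintro s (rfl | rfl | rfl | rfl) <;> simpa only [norm_neg]
  have hA0 : Admissible q {(q : ℂ), -(q : ℂ), ((√q : ℝ) : ℂ), -((√q : ℝ) : ℂ)} ε :=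
    admissible_of_norm_lt_one hq0 hq1 (finite_params _ _ _ _)
      (zero_notMem_params.2 ⟨hqc, neg_ne_zero.2 hqc, hs0, neg_ne_zero.2 hs0⟩) hnorm hA.small.1
  have h40 : ∀ k : ℕ, (q : ℂ) * -q * ((√q : ℝ) : ℂ) * -((√q : ℝ) : ℂ) * (q : ℂ) ^ k ≠ 1 := by
    intro k hk
    have h1 : ((√q : ℝ) : ℂ) ^ 2 = q := by rw [← Complex.ofReal_pow, Real.sq_sqrt hq0.le]
    have h2 : (q : ℂ) ^ (3 + k) = 1 := by
      rw [← hk, pow_add]; linear_combination (-(q : ℂ) ^ 2 * q ^ k) * h1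
    have h3 : ‖(q : ℂ)‖ ^ (3 + k) < 1 := pow_lt_one₀ (norm_nonneg _) hq (by omega)
    rw [← norm_pow, h2, norm_one] at h3
    exact lt_irrefl _ h3
  have h1 := awIntegral_div_awValue hq0 hq1 hA h4
  have h2 := awIntegral_div_awValue hq0 hq1 hA0 h40
  have h3 : awIntegral q ε q (-q) (√q : ℝ) (-(√q : ℝ)) 1 = (2 * (π : ℂ) * Complex.I)⁻¹ *
      (∮ z in C(0, 1), z⁻¹ * awWeight q z q (-q) (√q : ℝ) (-(√q : ℝ))) := by
    rw [awIntegral, contourIntegral_of_norm_lt_one hq0 hq1 hnorm]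
    simp only [Polynomial.eval_one, mul_one]
  rw [← h2, awValue_chebyshev hq0 hq1, h3, awIntegral_chebyshev hq0 hq1, div_self two_ne_zero,
    div_eq_one_iff_eq (awValue_ne_zero hq0 hq1 hA h4)] at h1
  exact h1

/-- The moments of the Askey–Wilson weight. -/
theorem awIntegral_awBasis (hq0 : 0 < q) (hq1 : q < 1) {b c d : ℂ} (k : ℕ) :
    ∀ {a : ℂ}, Admissible q {a, b, c, d} ε → (∀ k : ℕ, a * b * c * d * (q : ℂ) ^ k ≠ 1) →
    awIntegral q ε a b c d (awBasis q a k) = awValue q a b c d *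
      (qPoch (a * b) q k * qPoch (a * c) q k * qPoch (a * d) q k / qPoch (a * b * c * d) q k) := by
  induction k with
  | zero =>
    intro a hA h4
    rw [awBasis_zero, awIntegral_one hq0 hq1 hA h4]
    simp [qPoch_zero]
  | succ k ih =>
    intro a hA h4
    have h4' : ∀ k : ℕ, a * q * b * c * d * (q : ℂ) ^ k ≠ 1 := fun k => by
      have := h4 (k + 1)
      rwa [show a * q * b * c * d * (q : ℂ) ^ k = a * b * c * d * (q : ℂ) ^ (k + 1) by ring]
    have h1 : 1 - a * b * c * d ≠ 0 := by
      have := h4 0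
      rw [pow_zero, mul_one] at this
      exact sub_ne_zero.2 this.symm
    rw [awBasis_succ', awIntegral_shift hq0 hq1 hA, ih (hA.shift hq0) h4']
    have h2 := awValue_shift hq0 hq1 hA
    simp only [qPoch_succ']
    rw [mul_right_comm a q b, mul_right_comm a q c, mul_right_comm a q d,
      show a * b * q * c * d = a * b * c * d * q by ring]
    have h3 : awValue q (a * q) b c d =
        (1 - a * b) * (1 - a * c) * (1 - a * d) * awValue q a b c d / (1 - a * b * c * d) := by
      rw [eq_div_iff h1, ← h2]; ring
    rw [h3, div_mul_div_comm, ← mul_div_assoc]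
    congr 1
    ring

end AskeyWilsonEvaluation

end SepVar

namespace SepVar

/-! ### The continuous `q`-ultraspherical polynomials -/

section Ultraspherical

theorem add_inv_surjective (w : ℂ) : ∃ z : ℂ, z ≠ 0 ∧ z + z⁻¹ = w := by
  obtain ⟨s, hs⟩ := IsAlgClosed.exists_pow_nat_eq (w ^ 2 - 4) (n := 2) two_pos
  have h1 : (w + s) / 2 * ((w - s) / 2) = 1 := by linear_combination (-1 / 4) * hs
  refine ⟨(w + s) / 2, left_ne_zero_of_mul_eq_one h1, ?_⟩
  rw [inv_eq_of_mul_eq_one_right h1]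
  ring

theorem eq_of_eval_add_inv {p p' : Polynomial ℂ} (h : ∀ z : ℂ, z ≠ 0 → z ^ 2 ≠ 1 →
    p.eval (z + z⁻¹) = p'.eval (z + z⁻¹)) : p = p' := by
  refine Polynomial.eq_of_infinite_eval_eq p p'
    (((Set.toFinite ({2, -2} : Set ℂ)).infinite_compl).mono fun w hw => ?_)
  obtain ⟨z, hz0, hzw⟩ := add_inv_surjective w
  rw [← hzw]
  refine h z hz0 fun hz => hw ?_
  have hz' : z⁻¹ = z := inv_eq_of_mul_eq_one_right (by rw [← pow_two, hz])
  rcases mul_self_eq_one_iff.1 ((pow_two z).symm.trans hz) with rfl | rfl <;>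
    rw [← hzw] <;> norm_num

/-- The Laurent polynomial `C_n(z)` is symmetric, hence a polynomial in `z + z⁻¹`; the Dickson
polynomials give `z^m + z^{-m}`. -/
theorem exists_qUltra_polynomial (q β : ℂ) (n : ℕ) :
    ∃ p : Polynomial ℂ, ∀ z : ℂ, z ≠ 0 → p.eval (z + z⁻¹) = qUltraExp q β n z := by
  refine ⟨Polynomial.C (1 / 2) * ∑ k ∈ Finset.range (n + 1), Polynomial.C (qPoch β q k *
    qPoch β q (n - k) / (qPoch q q k * qPoch q q (n - k))) *
      Polynomial.dickson 1 1 ((n : ℤ) - 2 * (k : ℤ)).natAbs, fun z hz => ?_⟩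
  have h1 : ∀ m : ℤ, (Polynomial.dickson 1 (1 : ℂ) m.natAbs).eval (z + z⁻¹) =
      z ^ m + z⁻¹ ^ m := by
    intro m
    rw [Polynomial.dickson_one_one_eval_add_inv _ _ (mul_inv_cancel₀ hz)]
    obtain ⟨j, rfl | rfl⟩ := m.eq_nat_or_neg
    · simp
    · simp [add_comm]
  rw [Polynomial.eval_mul, Polynomial.eval_C, Polynomial.eval_finsetSum]
  simp only [Polynomial.eval_mul, Polynomial.eval_C, h1, mul_add, Finset.sum_add_distrib]
  have h2 := qUltraExp_inv q β n z
  unfold qUltraExp at h2 ⊢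
  rw [h2]
  ring

/-- The coefficients `(β; q)_k / (q; q)_k` of the generating function. -/
noncomputable def ultraCoeff (q β : ℂ) (k : ℕ) : ℂ := qPoch β q k / qPoch q q k

theorem ultraCoeff_succ {q : ℂ} (hq : ‖q‖ < 1) (β : ℂ) (k : ℕ) :
    ultraCoeff q β (k + 1) * (1 - q ^ (k + 1)) = ultraCoeff q β k * (1 - β * q ^ k) := by
  have h1 := qPoch_ne_zero_of_norm_lt_one hq hq (k + 1)
  rw [qPoch_succ] at h1
  have h2 := left_ne_zero_of_mul h1
  have h3 := right_ne_zero_of_mul h1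
  rw [← pow_succ'] at h3
  rw [ultraCoeff, ultraCoeff, qPoch_succ, qPoch_succ, ← pow_succ']
  field_simp

theorem qUltraExp_eq_sum (q β : ℂ) (n : ℕ) (z : ℂ) : qUltraExp q β n z =
    ∑ k ∈ Finset.range (n + 1), ultraCoeff q β k * ultraCoeff q β (n - k) *
      z ^ ((n : ℤ) - 2 * (k : ℤ)) := by
  unfold qUltraExp ultraCoeff
  exact Finset.sum_congr rfl fun k _ => by rw [div_mul_div_comm]

/-- The `q`-difference equation of the continuous `q`-ultraspherical polynomials, that is, the
eigenvalue equation of the `A₁` Macdonald operator. -/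
theorem qUltraExp_qDifference {q t h : ℂ} (hq : ‖q‖ < 1) (hh : h ≠ 0) (hhq : q = h ^ 2) (n : ℕ)
    {z : ℂ} (hz : z ≠ 0) :
    (1 - t * z ^ 2) * qUltraExp q t n (h * z) + (t - z ^ 2) * qUltraExp q t n (z / h) =
      ((h ^ n)⁻¹ + t * h ^ n) * ((1 - z ^ 2) * qUltraExp q t n z) := by
  have hn : h ^ n ≠ 0 := pow_ne_zero n hh
  -- the term of index `k` contributes to the exponents `n - 2k` and `n - 2k + 2`, with the
  -- coefficients `A k` and `-B k`, and `B (k + 1) = A k` makes the sum telescope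
  set A : ℕ → ℂ := fun k => ultraCoeff q t k * ultraCoeff q t (n - k) *
    (-(h ^ n)⁻¹ * ((1 - q ^ (n - k)) * (1 - t * q ^ k))) with hA
  set B : ℕ → ℂ := fun k => ultraCoeff q t k * ultraCoeff q t (n - k) *
    (-(h ^ n)⁻¹ * ((1 - q ^ k) * (1 - t * q ^ (n - k)))) with hB
  have hterm : ∀ k ∈ Finset.range (n + 1),
      (1 - t * z ^ 2) * (ultraCoeff q t k * ultraCoeff q t (n - k) *
        (h * z) ^ ((n : ℤ) - 2 * (k : ℤ))) +
      (t - z ^ 2) * (ultraCoeff q t k * ultraCoeff q t (n - k) *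
        (z / h) ^ ((n : ℤ) - 2 * (k : ℤ))) -
      ((h ^ n)⁻¹ + t * h ^ n) * ((1 - z ^ 2) * (ultraCoeff q t k * ultraCoeff q t (n - k) *
        z ^ ((n : ℤ) - 2 * (k : ℤ)))) =
      A k * z ^ ((n : ℤ) - 2 * (k : ℤ)) - B k * z ^ ((n : ℤ) - 2 * (k : ℤ) + 2) := by
    intro k hk
    obtain ⟨j, rfl⟩ : ∃ j, n = k + j := ⟨n - k, by have := Finset.mem_range.1 hk; omega⟩
    have e1 : ((k + j : ℕ) : ℤ) - 2 * (k : ℤ) = (j : ℤ) - k := by push_cast; ring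
    rw [hA, hB]
    simp only [e1, Nat.add_sub_cancel_left]
    rw [mul_zpow, div_zpow, zpow_add₀ hz, zpow_sub₀ hh, zpow_sub₀ hz, hhq]
    simp only [zpow_natCast, ← pow_mul]
    norm_cast
    have hk : h ^ k ≠ 0 := pow_ne_zero k hh
    have hj : h ^ j ≠ 0 := pow_ne_zero j hh
    have e2 : h ^ (2 * k) = (h ^ k) ^ 2 := by ring
    have e3 : h ^ (2 * j) = (h ^ j) ^ 2 := by ring
    rw [e2, e3, pow_add]
    field_simp
    ring
  have hAB : ∀ k ∈ Finset.range n, B (k + 1) = A k := by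
    intro k hk
    obtain ⟨j, rfl⟩ : ∃ j, n = k + 1 + j := ⟨n - (k + 1), by have := Finset.mem_range.1 hk; omega⟩
    rw [hA, hB]
    have e1 : k + 1 + j - k = j + 1 := by omega
    have e2 : k + 1 + j - (k + 1) = j := by omega
    simp only [e1, e2]
    have r1 := ultraCoeff_succ hq t k
    have r2 := ultraCoeff_succ hq t j
    linear_combination (-(h ^ (k + 1 + j))⁻¹ * ultraCoeff q t j * (1 - t * q ^ j)) * r1 +
      (h ^ (k + 1 + j))⁻¹ * ultraCoeff q t k * (1 - t * q ^ k) * r2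
  have hA0 : A n = 0 := by simp [hA]
  have hB0 : B 0 = 0 := by simp [hB]
  rw [← sub_eq_zero]
  simp only [qUltraExp_eq_sum, Finset.mul_sum]
  rw [← Finset.sum_add_distrib, ← Finset.sum_sub_distrib, Finset.sum_congr rfl hterm,
    Finset.sum_sub_distrib, Finset.sum_range_succ, Finset.sum_range_succ', hA0, hB0]
  rw [zero_mul, zero_mul, add_zero, add_zero, sub_eq_zero]
  refine Finset.sum_congr rfl fun k hk => ?_
  rw [hAB k hk]
  congr 2
  push_cast
  ring

/-- The `q`-Vandermonde sum behind the principal specialization: the generating function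
`F(X) = ∑ (t; q)_k / (q; q)_k X^k` satisfies `(1 - X) F(X) = (1 - t X) F(q X)`. -/
theorem sum_ultraCoeff_mul_pow {q : ℂ} (hq : ‖q‖ < 1) (t : ℂ) (n : ℕ) :
    ∑ k ∈ Finset.range (n + 1), ultraCoeff q t k * ultraCoeff q t (n - k) * t ^ k =
      qPoch (t ^ 2) q n / qPoch q q n := by
  set F : PowerSeries ℂ := PowerSeries.mk (ultraCoeff q t) with hF
  have hFeq : (1 - PowerSeries.X) * F =
      (1 - PowerSeries.C t * PowerSeries.X) * PowerSeries.rescale q F := by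
    ext k
    rcases k with _ | k
    · simp only [sub_mul, one_mul, map_sub, PowerSeries.coeff_zero_X_mul, mul_assoc,
        PowerSeries.coeff_C_mul, PowerSeries.coeff_rescale, mul_zero, pow_zero]
    · have := ultraCoeff_succ hq t k
      simp only [sub_mul, one_mul, map_sub, PowerSeries.coeff_succ_X_mul, mul_assoc,
        PowerSeries.coeff_C_mul, PowerSeries.coeff_rescale, hF, PowerSeries.coeff_mk]
      linear_combination this
  set G : PowerSeries ℂ := F * PowerSeries.rescale t F with hG
  have hresc : (1 - PowerSeries.C t * PowerSeries.X) * PowerSeries.rescale t F =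
      (1 - PowerSeries.C (t ^ 2) * PowerSeries.X) *
        PowerSeries.rescale q (PowerSeries.rescale t F) := by
    have h1 := congrArg (PowerSeries.rescale t) hFeq
    have hC : PowerSeries.rescale t (PowerSeries.C t) = PowerSeries.C t := by
      ext k
      rw [PowerSeries.coeff_rescale, PowerSeries.coeff_C]
      rcases k with _ | k <;> simp
    simp only [map_mul, map_sub, map_one, PowerSeries.rescale_X, hC] at h1
    rw [h1, PowerSeries.rescale_rescale, PowerSeries.rescale_rescale, mul_comm q t, ← mul_assoc,
      ← map_mul, pow_two]
  have hne : (1 - PowerSeries.C t * PowerSeries.X : PowerSeries ℂ) ≠ 0 := by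
    intro h0
    have := congrArg PowerSeries.constantCoeff h0
    simp at this
  have hGeq : (1 - PowerSeries.X) * G =
      (1 - PowerSeries.C (t ^ 2) * PowerSeries.X) * PowerSeries.rescale q G := by
    apply mul_left_cancel₀ hne
    rw [hG, map_mul]
    linear_combination PowerSeries.rescale t F * (1 - PowerSeries.C t * PowerSeries.X) * hFeq +
      (1 - PowerSeries.C t * PowerSeries.X) * PowerSeries.rescale q F * hresc
  have hcoef : ∀ k, PowerSeries.coeff k G = qPoch (t ^ 2) q k / qPoch q q k := by
    intro k
    induction k with
    | zero =>
      rw [hG, PowerSeries.coeff_mul, Finset.Nat.antidiagonal_zero, Finset.sum_singleton,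
        PowerSeries.coeff_rescale, hF, PowerSeries.coeff_mk]
      simp [ultraCoeff, qPoch_zero]
    | succ k ih =>
      have h1 := congrArg (PowerSeries.coeff (k + 1)) hGeq
      simp only [sub_mul, one_mul, map_sub, PowerSeries.coeff_succ_X_mul, mul_assoc,
        PowerSeries.coeff_C_mul, PowerSeries.coeff_rescale] at h1
      have h2 := qPoch_ne_zero_of_norm_lt_one hq hq (k + 1)
      rw [qPoch_succ] at h2 ⊢
      have h3 := left_ne_zero_of_mul h2
      have h4 := right_ne_zero_of_mul h2
      rw [qPoch_succ, eq_div_iff h2]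
      rw [ih] at h1
      have h5 : PowerSeries.coeff (k + 1) G * (1 - q * q ^ k) =
          qPoch (t ^ 2) q k / qPoch q q k * (1 - t ^ 2 * q ^ k) := by
        linear_combination h1
      have h6 : qPoch (t ^ 2) q k / qPoch q q k * qPoch q q k = qPoch (t ^ 2) q k :=
        div_mul_cancel₀ _ h3
      linear_combination qPoch q q k * h5 + (1 - t ^ 2 * q ^ k) * h6
  rw [← hcoef n, hG, mul_comm F, PowerSeries.coeff_mul,
    Finset.Nat.sum_antidiagonal_eq_sum_range_succ_mk]
  refine Finset.sum_congr rfl fun k _ => ?_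
  simp only [PowerSeries.coeff_rescale, hF, PowerSeries.coeff_mk]
  ring

/-- The principal specialization of the continuous `q`-ultraspherical polynomials. -/
theorem qUltraExp_principal {q : ℂ} (hq : ‖q‖ < 1) {s : ℂ} (hs : s ≠ 0) (n : ℕ) :
    qUltraExp q (s ^ 2) n s⁻¹ = (s ^ n)⁻¹ * (qPoch ((s ^ 2) ^ 2) q n / qPoch q q n) := by
  rw [← sum_ultraCoeff_mul_pow hq, qUltraExp_eq_sum, Finset.mul_sum]
  refine Finset.sum_congr rfl fun k _ => ?_
  have : s⁻¹ ^ ((n : ℤ) - 2 * (k : ℤ)) = (s ^ n)⁻¹ * (s ^ 2) ^ k := by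
    rw [inv_zpow', neg_sub, zpow_sub₀ hs, zpow_mul]
    norm_cast
    rw [div_eq_mul_inv, mul_comm]
  rw [this]
  ring

end Ultraspherical

end SepVar

namespace SepVar

/-! ### Moment functionals -/

section Moments

theorem awBasis_eval (q a : ℂ) (k : ℕ) {z : ℂ} (hz : z ≠ 0) :
    (awBasis q a k).eval (z + z⁻¹) = qPoch (a * z) q k * qPoch (a * z⁻¹) q k := by
  induction k with
  | zero => simp [awBasis_zero, qPoch_zero]
  | succ k ih =>
    rw [awBasis_succ, Polynomial.eval_mul, ih, qPoch_succ, qPoch_succ]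
    simp only [Polynomial.eval_sub, Polynomial.eval_mul, Polynomial.eval_C, Polynomial.eval_X]
    field_simp
    ring

theorem X_pow_succ_mul_awBasis {q a : ℂ} (ha : a ≠ 0) (hq : q ≠ 0) (m k : ℕ) :
    Polynomial.X ^ (m + 1) * awBasis q a k = ((1 + (a * q ^ k) ^ 2) / (a * q ^ k)) •
      (Polynomial.X ^ m * awBasis q a k) - (a * q ^ k)⁻¹ •
        (Polynomial.X ^ m * awBasis q a (k + 1)) := by
  have h : a * q ^ k ≠ 0 := mul_ne_zero ha (pow_ne_zero k hq)
  have h2 : (Polynomial.C (a * q ^ k)⁻¹ * Polynomial.C (a * q ^ k) : Polynomial ℂ) = 1 := by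
    rw [← Polynomial.C_mul, inv_mul_cancel₀ h, Polynomial.C_1]
  rw [awBasis_succ, Polynomial.smul_eq_C_mul, Polynomial.smul_eq_C_mul, div_eq_mul_inv,
    Polynomial.C_mul]
  linear_combination (-(Polynomial.X ^ (m + 1) * awBasis q a k)) * h2

/-- The basis polynomials span all polynomials, as `a ≠ 0`. -/
theorem span_awBasis {q a : ℂ} (ha : a ≠ 0) (hq : q ≠ 0) :
    Submodule.span ℂ (Set.range (awBasis q a)) = ⊤ := by
  have key : ∀ m k, Polynomial.X ^ m * awBasis q a k ∈
      Submodule.span ℂ (Set.range (awBasis q a)) := by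
    intro m
    induction m with
    | zero => intro k; simpa using Submodule.subset_span (Set.mem_range_self k)
    | succ m ih =>
      intro k
      rw [X_pow_succ_mul_awBasis ha hq]
      exact Submodule.sub_mem _ (Submodule.smul_mem _ _ (ih k))
        (Submodule.smul_mem _ _ (ih (k + 1)))
  refine eq_top_iff.2 fun p _ => ?_
  rw [p.as_sum_support_C_mul_X_pow]
  refine Submodule.sum_mem _ fun m _ => ?_
  have := key m 0
  rw [awBasis_zero, mul_one] at this
  rw [← Polynomial.smul_eq_C_mul]
  exact Submodule.smul_mem _ _ this

/-- The values on `X ^ m * awBasis q a k` of the functional with `awBasis q a k ↦ M k`, from the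
recursion `X_pow_succ_mul_awBasis`. -/
noncomputable def mixedMoment (q a : ℂ) (M : ℕ → ℂ) : ℕ → ℕ → ℂ
  | 0, k => M k
  | m + 1, k => (1 + (a * q ^ k) ^ 2) / (a * q ^ k) * mixedMoment q a M m k -
      (a * q ^ k)⁻¹ * mixedMoment q a M m (k + 1)

/-- The linear functional on polynomials with `awBasis q a k ↦ M k`, for `a ≠ 0`. -/
noncomputable def momentFunctional (q a : ℂ) (M : ℕ → ℂ) : Polynomial ℂ →ₗ[ℂ] ℂ :=
  Polynomial.lsum fun m => (LinearMap.id : ℂ →ₗ[ℂ] ℂ).smulRight (mixedMoment q a M m 0)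

theorem momentFunctional_apply (q a : ℂ) (M : ℕ → ℂ) (p : Polynomial ℂ) :
    momentFunctional q a M p = ∑ m ∈ p.support, p.coeff m * mixedMoment q a M m 0 := by
  simp [momentFunctional, Polynomial.sum_def]

theorem momentFunctional_X_pow_mul {q a : ℂ} (ha : a ≠ 0) (hq : q ≠ 0) (M : ℕ → ℂ) (k : ℕ) :
    ∀ m, momentFunctional q a M (Polynomial.X ^ m * awBasis q a k) = mixedMoment q a M m k := by
  induction k with
  | zero =>
    intro m
    rw [awBasis_zero, mul_one, momentFunctional, Polynomial.lsum_apply,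
      ← Polynomial.monomial_one_right_eq_X_pow, Polynomial.sum_monomial_index _ _ (by simp)]
    simp
  | succ k ih =>
    intro m
    have h : a * q ^ k ≠ 0 := mul_ne_zero ha (pow_ne_zero k hq)
    have h1 := congrArg (momentFunctional q a M) (X_pow_succ_mul_awBasis ha hq m k)
    rw [map_sub, map_smul, map_smul, ih, ih, mixedMoment, smul_eq_mul, smul_eq_mul] at h1
    exact mul_left_cancel₀ (inv_ne_zero h) (by linear_combination h1)

theorem momentFunctional_awBasis {q a : ℂ} (ha : a ≠ 0) (hq : q ≠ 0) (M : ℕ → ℂ) (k : ℕ) :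
    momentFunctional q a M (awBasis q a k) = M k := by
  have := momentFunctional_X_pow_mul ha hq M k 0
  rwa [pow_zero, one_mul, mixedMoment] at this

theorem linearMap_ext_awBasis {q a : ℂ} (ha : a ≠ 0) (hq : q ≠ 0) {L L' : Polynomial ℂ →ₗ[ℂ] ℂ}
    (h : ∀ k, L (awBasis q a k) = L' (awBasis q a k)) : L = L' :=
  LinearMap.ext_on_range (span_awBasis ha hq) h

/-- The moments of the Askey–Wilson functional with parameters `s u / v`, `s v / u`, `s u v`,
`s / (u v)`, where `t = s²`, in the basis attached to the first parameter. -/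
noncomputable def sepMoment (q t u v : ℂ) (k : ℕ) : ℂ :=
  qPoch t q k * qPoch (t * u ^ 2) q k * qPoch (t / v ^ 2) q k / qPoch (t ^ 2) q k

/-- The normalized Askey–Wilson functional with parameters `s u / v`, `s v / u`, `s u v`,
`s / (u v)`. -/
noncomputable def sepFunctional (q s u v : ℂ) : Polynomial ℂ →ₗ[ℂ] ℂ :=
  momentFunctional q (s * u / v) (sepMoment q (s ^ 2) u v)

/-- The basis attached to `a` in terms of the one attached to `a q`. -/
theorem awBasis_lower {q : ℂ} (hq : q ≠ 0) (a : ℂ) (k : ℕ) :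
    awBasis q a (k + 1) = ((1 - (q ^ (k + 1))⁻¹) * (1 - a ^ 2 * q ^ (k + 1))) •
      awBasis q (a * q) k + (q ^ (k + 1))⁻¹ • awBasis q (a * q) (k + 1) := by
  have h : (q ^ (k + 1)) ≠ 0 := pow_ne_zero _ hq
  refine eq_of_eval_add_inv fun z _ _ => ?_
  rw [awBasis_succ', awBasis_succ]
  simp only [Polynomial.eval_mul, Polynomial.eval_add, Polynomial.eval_smul, Polynomial.eval_sub,
    Polynomial.eval_C, Polynomial.eval_X, smul_eq_mul]
  have e : a * q * q ^ k = a * q ^ (k + 1) := by ring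
  rw [e]
  generalize q ^ (k + 1) = Y at *
  field_simp
  ring

/-- The action of the Macdonald operator on the basis polynomials. -/
theorem awBasis_qDifference {q t h : ℂ} (hh : h ≠ 0) (hhq : q = h ^ 2) (α : ℂ) (k : ℕ) {z : ℂ}
    (hz : z ≠ 0) :
    (1 - t * z ^ 2) * (awBasis q α (k + 1)).eval (h * z + (h * z)⁻¹) +
        (t - z ^ 2) * (awBasis q α (k + 1)).eval (z / h + (z / h)⁻¹) =
      (1 - z ^ 2) * (((1 - (q ^ (k + 1))⁻¹) * (1 - t * (α * h * q ^ k) ^ 2)) •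
        awBasis q (α * h) k + (t + (q ^ (k + 1))⁻¹) • awBasis q (α * h) (k + 1)).eval
          (z + z⁻¹) := by
  have hq : q ≠ 0 := by rw [hhq]; exact pow_ne_zero 2 hh
  simp only [Polynomial.eval_add, Polynomial.eval_smul, smul_eq_mul]
  rw [awBasis_eval _ _ _ (mul_ne_zero hh hz), awBasis_eval _ _ _ (div_ne_zero hz hh),
    awBasis_eval _ _ _ hz, awBasis_eval _ _ _ hz]
  have e1 : qPoch (α * (h * z)) q (k + 1) =
      qPoch (α * h * z) q k * (1 - α * h * z * q ^ k) := by rw [← mul_assoc, qPoch_succ]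
  have e2 : qPoch (α * (h * z)⁻¹) q (k + 1) =
      (1 - α / (h * z)) * qPoch (α * h * z⁻¹) q k := by
    rw [qPoch_succ', ← div_eq_mul_inv, hhq]
    congr 2
    field_simp
  have e3 : qPoch (α * (z / h)) q (k + 1) = (1 - α * z / h) * qPoch (α * h * z) q k := by
    rw [qPoch_succ', hhq, mul_div_assoc]
    congr 2
    field_simp
  have e4 : qPoch (α * (z / h)⁻¹) q (k + 1) =
      qPoch (α * h * z⁻¹) q k * (1 - α * h * z⁻¹ * q ^ k) := by
    rw [inv_div, show α * (h / z) = α * h * z⁻¹ by rw [div_eq_mul_inv, mul_assoc], qPoch_succ]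
  rw [e1, e2, e3, e4, qPoch_succ, qPoch_succ]
  generalize qPoch (α * h * z) q k = A
  generalize qPoch (α * h * z⁻¹) q k = B
  have hY : q ^ k ≠ 0 := pow_ne_zero _ hq
  rw [pow_succ q k, hhq]
  rw [hhq] at hY
  generalize (h ^ 2) ^ k = Y at *
  field_simp
  ring

/-- The polynomial identity behind `sepMoment_qDifference`, with `U = u²`, `V = t / v²` and
`Y = q ^ k`. -/
theorem sepMoment_identity {q Y : ℂ} (hq : q ≠ 0) (hY : Y ≠ 0) (t U V : ℂ) :
    (1 - (Y * q)⁻¹) * (1 - U * V / q * (Y * q)) * (1 - t * U * Y) * (1 - t ^ 2 * Y) +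
        (Y * q)⁻¹ * (1 - t * Y) * (1 - V * Y) * (1 - t * U * Y) * (1 - t * U * Y * q) +
        (t - U) * (1 - t * Y) * (1 - V * Y) * (1 - t * U / q) =
      (1 - U) * ((1 - (Y * q)⁻¹) * (1 - t * (U * V) * Y ^ 2) * (1 - t ^ 2 * Y) +
        (t + (Y * q)⁻¹) * ((1 - t * Y) * (1 - V * Y) * (1 - t * U * Y))) := by
  field_simp
  ring

/-- The intertwining relation on a basis polynomial, written in terms of the moments. -/
theorem sepMoment_qDifference {q t h : ℂ} (hh : h ≠ 0) (hhq : q = h ^ 2) {u v α : ℂ}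
    (hα : α ^ 2 * h ^ 2 = t * u ^ 2 / v ^ 2) (k : ℕ)
    (hk : qPoch (t ^ 2) q (k + 1) ≠ 0) :
    (1 - t * u ^ 2) * ((1 - (q ^ (k + 1))⁻¹) * (1 - α ^ 2 * q ^ (k + 1)) *
        sepMoment q t (h * u) v k + (q ^ (k + 1))⁻¹ * sepMoment q t (h * u) v (k + 1)) +
      (t - u ^ 2) * sepMoment q t (u / h) v (k + 1) =
    (1 - u ^ 2) * ((1 - (q ^ (k + 1))⁻¹) * (1 - t * (α * h * q ^ k) ^ 2) * sepMoment q t u v k +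
      (t + (q ^ (k + 1))⁻¹) * sepMoment q t u v (k + 1)) := by
  have hq : q ≠ 0 := by rw [hhq]; exact pow_ne_zero 2 hh
  have hY : q ^ k ≠ 0 := pow_ne_zero _ hq
  have hα2 : α ^ 2 = t * u ^ 2 / v ^ 2 / q := by
    rw [hhq, ← hα]; field_simp
  have e1 : (1 - t * u ^ 2) * qPoch (t * (h * u) ^ 2) q k =
      qPoch (t * u ^ 2) q k * (1 - t * u ^ 2 * q ^ k) := by
    rw [← qPoch_succ, qPoch_succ', hhq]
    congr 2
    ring
  have e2 : (1 - t * u ^ 2) * qPoch (t * (h * u) ^ 2) q (k + 1) =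
      qPoch (t * u ^ 2) q k * (1 - t * u ^ 2 * q ^ k) * (1 - t * u ^ 2 * q ^ k * q) := by
    rw [qPoch_succ, ← mul_assoc, e1, hhq]
    ring
  have e3 : qPoch (t * (u / h) ^ 2) q (k + 1) = (1 - t * u ^ 2 / q) * qPoch (t * u ^ 2) q k := by
    rw [qPoch_succ', hhq]
    congr 2
    · field_simp
    · field_simp
  rw [qPoch_succ] at hk
  have hT := left_ne_zero_of_mul hk
  have hT2 := right_ne_zero_of_mul hk
  have hl : ∀ c₁ c₂ : ℂ, (1 - t * u ^ 2) * (c₁ * sepMoment q t (h * u) v k +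
      c₂ * sepMoment q t (h * u) v (k + 1)) =
      c₁ * (qPoch t q k * (qPoch (t * u ^ 2) q k * (1 - t * u ^ 2 * q ^ k)) *
        qPoch (t / v ^ 2) q k / qPoch (t ^ 2) q k) +
      c₂ * (qPoch t q (k + 1) * (qPoch (t * u ^ 2) q k * (1 - t * u ^ 2 * q ^ k) *
        (1 - t * u ^ 2 * q ^ k * q)) * qPoch (t / v ^ 2) q (k + 1) / qPoch (t ^ 2) q (k + 1)) := by
    intro c₁ c₂
    rw [← e2, ← e1]
    unfold sepMoment
    ring
  rw [hl]
  unfold sepMoment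
  rw [e3, show t * (α * h * q ^ k) ^ 2 = t * (t * u ^ 2 / v ^ 2) * (q ^ k) ^ 2 by rw [← hα]; ring,
    hα2, qPoch_succ t, qPoch_succ (t ^ 2), qPoch_succ (t / v ^ 2), qPoch_succ (t * u ^ 2),
    pow_succ q k]
  clear hl e1 e2 e3 hα2 hα
  generalize qPoch t q k = A
  generalize qPoch (t ^ 2) q k = T at *
  generalize qPoch (t / v ^ 2) q k = C
  generalize qPoch (t * u ^ 2) q k = D
  generalize q ^ k = Y at *
  set V := t / v ^ 2 with hV
  have e5 : t * u ^ 2 / v ^ 2 = u ^ 2 * V := by rw [hV]; ring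
  rw [e5]
  clear_value V
  have key := sepMoment_identity hq hY t (u ^ 2) V
  clear e5 hV hk
  generalize 1 - t ^ 2 * Y = T2 at *
  generalize 1 - t * Y = T1 at *
  generalize 1 - V * Y = V1 at *
  generalize 1 - t * u ^ 2 * Y = X1 at *
  generalize (Y * q)⁻¹ = Z at *
  trans A * D * C / (T * T2) * ((1 - Z) * (1 - u ^ 2 * V / q * (Y * q)) * X1 * T2 +
    Z * T1 * V1 * X1 * (1 - t * u ^ 2 * Y * q) +
      (t - u ^ 2) * T1 * V1 * (1 - t * u ^ 2 / q))
  · field_simp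
  · rw [key]
    field_simp

/-- The intertwining relation: the functional carries the Macdonald operator in `z` to the
Macdonald operator in `u`. -/
theorem exists_sepFunctional_intertwine {q h s : ℂ} (hh : h ≠ 0) (hhq : q = h ^ 2) (hs : s ≠ 0)
    (hT : ∀ k, qPoch ((s ^ 2) ^ 2) q k ≠ 0) {u v : ℂ} (hu : u ≠ 0) (hv : v ≠ 0)
    (p : Polynomial ℂ) : ∃ p' : Polynomial ℂ,
      (∀ z : ℂ, z ≠ 0 → (1 - s ^ 2 * z ^ 2) * p.eval (h * z + (h * z)⁻¹) +
        (s ^ 2 - z ^ 2) * p.eval (z / h + (z / h)⁻¹) = (1 - z ^ 2) * p'.eval (z + z⁻¹)) ∧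
      (1 - s ^ 2 * u ^ 2) * sepFunctional q s (h * u) v p +
        (s ^ 2 - u ^ 2) * sepFunctional q s (u / h) v p =
          (1 - u ^ 2) * sepFunctional q s u v p' := by
  have hq : q ≠ 0 := by rw [hhq]; exact pow_ne_zero 2 hh
  -- at `h u`, `u / h` and `u` the functional uses the bases attached to `α q`, `α` and `α h`
  set α : ℂ := s * u / v / h with hα
  have hα0 : α ≠ 0 := div_ne_zero (div_ne_zero (mul_ne_zero hs hu) hv) hh
  have ha1 : s * (h * u) / v = α * q := by rw [hα, hhq]; field_simp
  have ha2 : s * (u / h) / v = α := by rw [hα]; field_simp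
  have ha3 : s * u / v = α * h := by rw [hα]; field_simp
  have hp : p ∈ Submodule.span ℂ (Set.range (awBasis q α)) := by
    rw [span_awBasis hα0 hq]; exact Submodule.mem_top
  induction hp using Submodule.span_induction with
  | mem p hp =>
    obtain ⟨k, rfl⟩ := hp
    rcases k with _ | k
    · refine ⟨(1 + s ^ 2) • awBasis q (α * h) 0, fun z hz => ?_, ?_⟩
      · simp only [awBasis_zero, Polynomial.eval_smul, Polynomial.eval_one, smul_eq_mul]
        ring
      · have e : ∀ a b : ℂ, awBasis q a 0 = awBasis q b 0 := fun a b => by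
          rw [awBasis_zero, awBasis_zero]
        have m0 : ∀ u, sepMoment q (s ^ 2) u v 0 = 1 := fun u => by simp [sepMoment, qPoch_zero]
        rw [map_smul, sepFunctional, sepFunctional, sepFunctional, ha1, ha2, ha3,
          momentFunctional_awBasis hα0 hq, e α (α * q),
          momentFunctional_awBasis (mul_ne_zero hα0 hq) hq,
          momentFunctional_awBasis (mul_ne_zero hα0 hh) hq, m0, m0, m0, smul_eq_mul]
        ring
    · refine ⟨((1 - (q ^ (k + 1))⁻¹) * (1 - s ^ 2 * (α * h * q ^ k) ^ 2)) • awBasis q (α * h) k +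
        (s ^ 2 + (q ^ (k + 1))⁻¹) • awBasis q (α * h) (k + 1), fun z hz =>
        awBasis_qDifference hh hhq α k hz, ?_⟩
      rw [map_add, map_smul, map_smul, sepFunctional, sepFunctional, sepFunctional, ha1, ha2, ha3,
        momentFunctional_awBasis hα0 hq, awBasis_lower hq α k, map_add, map_smul, map_smul]
      simp only [momentFunctional_awBasis (mul_ne_zero hα0 hq) hq,
        momentFunctional_awBasis (mul_ne_zero hα0 hh) hq, smul_eq_mul]
      refine sepMoment_qDifference hh hhq ?_ k (hT _)
      rw [hα]
      field_simp
  | zero => exact ⟨0, fun z _ => by simp, by simp⟩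
  | add p₁ p₂ _ _ h₁ h₂ =>
    obtain ⟨r₁, h11, h12⟩ := h₁
    obtain ⟨r₂, h21, h22⟩ := h₂
    refine ⟨r₁ + r₂, fun z hz => ?_, ?_⟩
    · simp only [Polynomial.eval_add]
      linear_combination h11 z hz + h21 z hz
    · simp only [map_add]
      linear_combination h12 + h22
  | smul c p₁ _ h₁ =>
    obtain ⟨r₁, h11, h12⟩ := h₁
    refine ⟨c • r₁, fun z hz => ?_, ?_⟩
    · simp only [Polynomial.eval_smul, smul_eq_mul]
      linear_combination c * h11 z hz
    · simp only [map_smul, smul_eq_mul]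
      linear_combination c * h12

/-- At `u = 1 / s` the functional is the evaluation at `v`: the first parameter is `1 / v`, and the
moments are the values of the basis polynomials at `v`. -/
theorem sepFunctional_inv {q s v : ℂ} (hq : q ≠ 0) (hs : s ≠ 0) (hv : v ≠ 0)
    (p : Polynomial ℂ) : sepFunctional q s s⁻¹ v p = p.eval (v + v⁻¹) := by
  have ha : s * s⁻¹ / v = v⁻¹ := by field_simp
  rw [sepFunctional, ha]
  have : momentFunctional q v⁻¹ (sepMoment q (s ^ 2) s⁻¹ v) =
      Polynomial.leval (v + v⁻¹) := by
    refine linearMap_ext_awBasis (inv_ne_zero hv) hq fun k => ?_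
    rw [momentFunctional_awBasis (inv_ne_zero hv) hq, Polynomial.leval_apply,
      awBasis_eval _ _ _ hv, sepMoment, inv_mul_cancel₀ hv,
      show s ^ 2 * s⁻¹ ^ 2 = 1 by field_simp]
    rcases k with _ | k
    · simp [qPoch_zero]
    · simp [qPoch_succ' 1]
  rw [this, Polynomial.leval_apply]

end Moments

end SepVar

namespace SepVar

/-! ### Laurent polynomial eigenfunctions of the Macdonald operator -/

section Laurent

/-- `g` agrees on `ℂ ∖ {0}` with a Laurent polynomial. -/
def IsLaurent (g : ℂ → ℂ) : Prop :=
  ∃ (N : ℕ) (p : Polynomial ℂ), ∀ u, u ≠ 0 → u ^ N * g u = p.eval u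

theorem IsLaurent.of_polynomial (p : Polynomial ℂ) : IsLaurent fun u => p.eval u :=
  ⟨0, p, fun u _ => by simp⟩

theorem IsLaurent.const (c : ℂ) : IsLaurent fun _ => c := by
  simpa using IsLaurent.of_polynomial (Polynomial.C c)

theorem IsLaurent.id : IsLaurent fun u => u := by
  simpa using IsLaurent.of_polynomial Polynomial.X

theorem IsLaurent.inv : IsLaurent fun u => u⁻¹ :=
  ⟨1, 1, fun u hu => by simp [hu]⟩

theorem IsLaurent.add {g g' : ℂ → ℂ} (hg : IsLaurent g) (hg' : IsLaurent g') :
    IsLaurent fun u => g u + g' u := by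
  obtain ⟨N, p, hp⟩ := hg
  obtain ⟨N', p', hp'⟩ := hg'
  refine ⟨N + N', Polynomial.X ^ N' * p + Polynomial.X ^ N * p', fun u hu => ?_⟩
  simp only [Polynomial.eval_add, Polynomial.eval_mul, Polynomial.eval_pow, Polynomial.eval_X]
  rw [← hp u hu, ← hp' u hu]
  ring

theorem IsLaurent.mul {g g' : ℂ → ℂ} (hg : IsLaurent g) (hg' : IsLaurent g') :
    IsLaurent fun u => g u * g' u := by
  obtain ⟨N, p, hp⟩ := hg
  obtain ⟨N', p', hp'⟩ := hg'
  refine ⟨N + N', p * p', fun u hu => ?_⟩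
  rw [Polynomial.eval_mul, ← hp u hu, ← hp' u hu]
  ring

theorem IsLaurent.sum {ι : Type*} (T : Finset ι) {g : ι → ℂ → ℂ} (hg : ∀ i, IsLaurent (g i)) :
    IsLaurent fun u => ∑ i ∈ T, g i u := by
  classical
  induction T using Finset.induction_on with
  | empty => simpa using IsLaurent.const 0
  | insert i T hi ih => simpa [Finset.sum_insert hi] using (hg i).add ih

theorem IsLaurent.qPoch_mul_sq (q t : ℂ) (k : ℕ) : IsLaurent fun u => qPoch (t * u ^ 2) q k := by
  refine ⟨0, ∏ i ∈ Finset.range k,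
    (1 - Polynomial.C t * Polynomial.X ^ 2 * Polynomial.C (q ^ i)), fun u _ => ?_⟩
  simp [qPoch, Polynomial.eval_prod]

theorem isLaurent_sepFunctional (q s v : ℂ) (p : Polynomial ℂ) :
    IsLaurent fun u => sepFunctional q s u v p := by
  have hM : ∀ m k, IsLaurent fun u =>
      mixedMoment q (s * u / v) (sepMoment q (s ^ 2) u v) m k := by
    intro m
    induction m with
    | zero =>
      intro k
      have h := ((IsLaurent.const (qPoch (s ^ 2) q k)).mul (IsLaurent.qPoch_mul_sq q (s ^ 2) k)).mul
        (IsLaurent.const (qPoch (s ^ 2 / v ^ 2) q k / qPoch ((s ^ 2) ^ 2) q k))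
      refine (funext fun u => ?_ : (fun u => _) = _) ▸ h
      rw [mixedMoment, sepMoment]
      ring
    | succ m ih =>
      intro k
      have h1 := ((IsLaurent.const (s / v * q ^ k)⁻¹).mul IsLaurent.inv).mul (ih k)
      have h2 := ((IsLaurent.const (s / v * q ^ k)).mul IsLaurent.id)
      have h3 := ((IsLaurent.const (s / v * q ^ k)⁻¹).mul IsLaurent.inv).mul
        ((IsLaurent.const (-1)).mul (ih (k + 1)))
      refine (funext fun u => ?_ : (fun u => _) = _) ▸ (h1.add ((h2.mul h2).mul h1)).add h3
      rw [mixedMoment, show s * u / v * q ^ k = s / v * q ^ k * u by ring, div_eq_mul_inv, mul_inv]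
      ring
  simp only [sepFunctional, momentFunctional_apply]
  exact IsLaurent.sum _ fun m => (IsLaurent.const _).mul (hM m 0)

/-- The diagonal coefficients of the recursion in `eq_zero_of_qDifference` do not
vanish at the indices `j ≤ n` other than `-n`. -/
theorem zpow_add_sub_ne_zero {h t : ℝ} (h0 : 0 < h) (h1 : h < 1) (t0 : 0 < t) (t1 : t < 1) (n : ℕ)
    {j : ℤ} (hj : j ≤ n) (hjn : j ≠ -n) :
    h ^ j + t * h ^ (-j) - ((h ^ n)⁻¹ + t * h ^ n) ≠ 0 := by
  have e : h ^ j + t * h ^ (-j) - ((h ^ n)⁻¹ + t * h ^ n) =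
      (h ^ j - h ^ (-(n : ℤ))) * (1 - t * h ^ ((n : ℤ) - j)) := by
    rw [sub_eq_add_neg (n : ℤ) j, zpow_add₀ h0.ne', zpow_neg, zpow_neg, zpow_natCast]
    have : h ^ j ≠ 0 := zpow_ne_zero _ h0.ne'
    have : h ^ n ≠ 0 := pow_ne_zero _ h0.ne'
    field_simp
    ring
  rw [e]
  refine mul_ne_zero (sub_ne_zero.2 fun hh => hjn (zpow_right_injective₀ h0 h1.ne hh)) ?_
  have : h ^ ((n : ℤ) - j) ≤ 1 := by
    obtain ⟨m, hm⟩ := Int.eq_ofNat_of_zero_le (show 0 ≤ (n : ℤ) - j by omega)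
    rw [hm, zpow_natCast]
    exact pow_le_one₀ h0.le h1.le
  have hpos : 0 < h ^ ((n : ℤ) - j) := zpow_pos h0 _
  nlinarith

/-- The off-diagonal coefficients of the recursion in `eq_zero_of_qDifference` do not
vanish above the index `n`. -/
theorem zpow_neg_add_sub_ne_zero {h t : ℝ} (h0 : 0 < h) (h1 : h < 1) (t0 : 0 < t) (t1 : t < 1)
    (n : ℕ) {j : ℤ} (hj : (n : ℤ) < j) :
    t * h ^ j + h ^ (-j) - ((h ^ n)⁻¹ + t * h ^ n) ≠ 0 := by
  have := zpow_add_sub_ne_zero h0 h1 t0 t1 n (j := -j) (by omega) (by omega)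
  rw [neg_neg] at this
  rwa [add_comm (t * h ^ j)]

/-- A Laurent polynomial eigenfunction of the Macdonald operator for the eigenvalue of `C_n` is
zero if its coefficient of `u^{-n}` is. Its coefficients satisfy a two-term recursion, which is
solved upwards below the index `n` and downwards above it. -/
theorem eq_zero_of_qDifference {h t : ℝ} (h0 : 0 < h) (h1 : h < 1) (t0 : 0 < t) (t1 : t < 1)
    (n N : ℕ) {G : ℂ → ℂ} {p : Polynomial ℂ}
    (hp : ∀ u, u ≠ 0 → u ^ N * G u = p.eval u)
    (hD : ∀ u : ℂ, u ≠ 0 → (1 - t * u ^ 2) * G (h * u) + (t - u ^ 2) * G (u / h) =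
      (((h : ℂ) ^ n)⁻¹ + t * (h : ℂ) ^ n) * ((1 - u ^ 2) * G u))
    (hc : p.coeff (N - n) = 0) : p = 0 := by
  have hhc : (h : ℂ) ≠ 0 := by exact_mod_cast h0.ne'
  set lam : ℂ := ((h : ℂ) ^ n)⁻¹ + t * (h : ℂ) ^ n with hlam
  set pu : Polynomial ℂ := p.comp (Polynomial.C (h : ℂ) * Polynomial.X) with hpu
  set pd : Polynomial ℂ := p.comp (Polynomial.C (h : ℂ)⁻¹ * Polynomial.X) with hpd
  have hpoly : Polynomial.C ((h : ℂ) ^ N)⁻¹ *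
      (pu - Polynomial.C (t : ℂ) * (Polynomial.X ^ 2 * pu)) +
      Polynomial.C ((h : ℂ) ^ N) * (Polynomial.C (t : ℂ) * pd - Polynomial.X ^ 2 * pd) =
      Polynomial.C lam * (p - Polynomial.X ^ 2 * p) := by
    refine Polynomial.eq_of_infinite_eval_eq _ _
      (((Set.toFinite ({0} : Set ℂ)).infinite_compl).mono fun u hu => ?_)
    have hu0 : u ≠ 0 := hu
    have e1 := hp (h * u) (mul_ne_zero hhc hu0)
    have e2 := hp (u / h) (div_ne_zero hu0 hhc)
    have e3 := hp u hu0
    simp only [Set.mem_ofPred_eq, Polynomial.eval_add, Polynomial.eval_mul, Polynomial.eval_sub,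
      Polynomial.eval_C, Polynomial.eval_pow, Polynomial.eval_X, hpu, hpd, Polynomial.eval_comp]
    rw [inv_mul_eq_div (h : ℂ) u, ← e1, ← e2, ← e3, mul_pow, div_pow]
    have hhN : (h : ℂ) ^ N ≠ 0 := pow_ne_zero _ hhc
    have := hD u hu0
    field_simp
    linear_combination this
  have hcoef : ∀ m, p.coeff (m + 2) * ((h : ℂ) ^ ((m : ℤ) + 2 - N) +
      t * (h : ℂ) ^ (-((m : ℤ) + 2 - N)) - lam) =
      p.coeff m * (t * (h : ℂ) ^ ((m : ℤ) - N) + (h : ℂ) ^ (-((m : ℤ) - N)) - lam) := by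
    intro m
    have := congrArg (fun r => Polynomial.coeff r (m + 2)) hpoly
    simp only [Polynomial.coeff_add, Polynomial.coeff_sub, Polynomial.coeff_C_mul,
      Polynomial.coeff_X_pow_mul, hpu, hpd, Polynomial.comp_C_mul_X_coeff] at this
    rw [neg_sub, neg_sub, zpow_sub₀ hhc, zpow_sub₀ hhc, zpow_sub₀ hhc, zpow_sub₀ hhc,
      zpow_add₀ hhc]
    norm_cast at this ⊢
    push_cast at this ⊢
    rw [inv_pow, inv_pow, pow_add] at this
    linear_combination this
  have hcoef0 : ∀ m < 2, p.coeff m * ((h : ℂ) ^ ((m : ℤ) - N) +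
      t * (h : ℂ) ^ (-((m : ℤ) - N)) - lam) = 0 := by
    intro m hm
    have := congrArg (fun r => Polynomial.coeff r m) hpoly
    have hm2 : ¬ 2 ≤ m := by omega
    simp only [Polynomial.coeff_add, Polynomial.coeff_sub, Polynomial.coeff_C_mul,
      Polynomial.coeff_X_pow_mul', hpu, hpd, Polynomial.comp_C_mul_X_coeff, if_neg hm2] at this
    rw [neg_sub, zpow_sub₀ hhc, zpow_sub₀ hhc]
    norm_cast at this ⊢
    push_cast at this ⊢
    rw [inv_pow] at this
    linear_combination this
  have hE : ∀ j : ℤ, j ≤ n → j ≠ -n →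
      (h : ℂ) ^ j + t * (h : ℂ) ^ (-j) - lam ≠ 0 := by
    intro j hj hjn
    have := zpow_add_sub_ne_zero h0 h1 t0 t1 n hj hjn
    rw [hlam]
    exact_mod_cast this
  have hF : ∀ j : ℤ, (n : ℤ) < j → t * (h : ℂ) ^ j + (h : ℂ) ^ (-j) - lam ≠ 0 := by
    intro j hj
    have := zpow_neg_add_sub_ne_zero h0 h1 t0 t1 n hj
    rw [hlam]
    exact_mod_cast this
  have hlow : ∀ m, m ≤ N + n → p.coeff m = 0 := by
    intro m
    induction m using Nat.strong_induction_on with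
    | _ m ih =>
      intro hm
      by_cases hmn : m = N - n
      · rw [hmn, hc]
      · rcases Nat.lt_or_ge m 2 with hm2 | hm2
        · exact (mul_eq_zero.1 (hcoef0 m hm2)).resolve_right (hE _ (by omega) (by omega))
        · obtain ⟨k, rfl⟩ : ∃ k, m = k + 2 := ⟨m - 2, by omega⟩
          have := hcoef k
          rw [ih k (by omega) (by omega), zero_mul] at this
          exact (mul_eq_zero.1 this).resolve_right (hE _ (by omega) (by omega))
  have hhigh : ∀ d m, N + n < m → p.natDegree < m + 2 * d → p.coeff m = 0 := by
    intro d
    induction d with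
    | zero => exact fun m _ hm => Polynomial.coeff_eq_zero_of_natDegree_lt (by simpa using hm)
    | succ d ih =>
      intro m hmN hm
      have := hcoef m
      rw [ih (m + 2) (by omega) (by omega), zero_mul] at this
      exact (mul_eq_zero.1 this.symm).resolve_right (hF _ (by omega))
  ext m
  rcases Nat.lt_or_ge (N + n) m with hm | hm
  · exact hhigh (p.natDegree + 1) m hm (by omega)
  · exact hlow m hm

/-- The Laurent polynomial eigenfunctions of the Macdonald operator for the eigenvalue of `C_n`
are the multiples of `C_n`. -/
theorem IsLaurent.eq_mul_qUltraExp {h t : ℝ} (h0 : 0 < h) (h1 : h < 1) (t0 : 0 < t) (t1 : t < 1)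
    (n : ℕ) {g : ℂ → ℂ} (hg : IsLaurent g)
    (hD : ∀ u : ℂ, u ≠ 0 → (1 - t * u ^ 2) * g (h * u) + (t - u ^ 2) * g (u / h) =
      (((h : ℂ) ^ n)⁻¹ + t * (h : ℂ) ^ n) * ((1 - u ^ 2) * g u)) :
    ∃ κ : ℂ, ∀ u, u ≠ 0 → g u = κ * qUltraExp ((h : ℂ) ^ 2) t n u := by
  have hhc : (h : ℂ) ≠ 0 := by exact_mod_cast h0.ne'
  have hh : ‖(h : ℂ)‖ < 1 := by rwa [Complex.norm_real, Real.norm_of_nonneg h0.le]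
  have ht : ‖(t : ℂ)‖ < 1 := by rwa [Complex.norm_real, Real.norm_of_nonneg t0.le]
  have hq : ‖(h : ℂ) ^ 2‖ < 1 := by
    rw [norm_pow]; exact pow_lt_one₀ (norm_nonneg _) hh two_ne_zero
  obtain ⟨M, p, hp⟩ := hg
  set c : ℕ → ℂ := ultraCoeff ((h : ℂ) ^ 2) t with hcdef
  set pQ : Polynomial ℂ := ∑ k ∈ Finset.range (n + 1),
    Polynomial.C (c k * c (n - k)) * Polynomial.X ^ (M + (n + n - 2 * k)) with hpQ
  have hQ : ∀ u : ℂ, u ≠ 0 →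
      u ^ (M + n) * qUltraExp ((h : ℂ) ^ 2) t n u = pQ.eval u := by
    intro u hu
    rw [qUltraExp_eq_sum, hpQ, Polynomial.eval_finsetSum, Finset.mul_sum]
    refine Finset.sum_congr rfl fun k hk => ?_
    have hk' : k ≤ n := by have := Finset.mem_range.1 hk; omega
    simp only [Polynomial.eval_mul, Polynomial.eval_C, Polynomial.eval_pow, Polynomial.eval_X]
    have : u ^ (M + (n + n - 2 * k)) = u ^ (M + n) * u ^ ((n : ℤ) - 2 * (k : ℤ)) := by
      rw [← zpow_natCast, ← zpow_natCast, ← zpow_add₀ hu]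
      congr 1
      omega
    rw [this]
    ring
  have hQc : pQ.coeff (M + n - n) = c n := by
    rw [hpQ, Polynomial.finsetSum_coeff, Finset.sum_eq_single n]
    · simp only [Polynomial.coeff_C_mul, Polynomial.coeff_X_pow]
      rw [if_pos (by omega)]
      simp [hcdef, ultraCoeff, qPoch_zero]
    · intro k hk hkn
      have hk' : k ≤ n := by have := Finset.mem_range.1 hk; omega
      simp only [Polynomial.coeff_C_mul, Polynomial.coeff_X_pow]
      rw [if_neg (by omega), mul_zero]
    · simp
  have hcn : c n ≠ 0 :=
    div_ne_zero (qPoch_ne_zero_of_norm_lt_one hq ht n) (qPoch_ne_zero_of_norm_lt_one hq hq n)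
  -- subtract the multiple of `C_n` with the same coefficient of `u^{-n}`
  set κ : ℂ := (p * Polynomial.X ^ n).coeff M / c n with hκ
  set P : Polynomial ℂ := p * Polynomial.X ^ n - Polynomial.C κ * pQ with hP
  have hPeval : ∀ u : ℂ, u ≠ 0 →
      u ^ (M + n) * (g u - κ * qUltraExp ((h : ℂ) ^ 2) t n u) = P.eval u := by
    intro u hu
    simp only [hP, Polynomial.eval_sub, Polynomial.eval_mul, Polynomial.eval_pow,
      Polynomial.eval_X, Polynomial.eval_C]
    rw [← hp u hu, ← hQ u hu]
    ring
  have hzero := eq_zero_of_qDifference h0 h1 t0 t1 n (M + n) hPeval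
    (fun u hu => by
      have e1 := hD u hu
      have e2 := qUltraExp_qDifference (t := t) hq hhc rfl n hu
      linear_combination e1 - κ * e2)
    (by
      rw [hP, Polynomial.coeff_sub, Polynomial.coeff_C_mul, hQc, Nat.add_sub_cancel,
        hκ, div_mul_cancel₀ _ hcn, sub_self])
  refine ⟨κ, fun u hu => ?_⟩
  have := hPeval u hu
  rw [hzero, Polynomial.eval_zero] at this
  exact sub_eq_zero.1 ((mul_eq_zero.1 this).resolve_left (pow_ne_zero _ hu))

end Laurent

end SepVar

namespace SepVar

/-! ### The product formula for the Askey–Wilson functional -/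

section Product

/-- The functional with parameters `s u / v`, `s v / u`, `s u v`, `s / (u v)` takes `C_n` to a
multiple of `C_n(u) C_n(v)`. As a function of `u` it is a Laurent polynomial eigenfunction of the
Macdonald operator, hence a multiple of `C_n(u)`, and the factor is found at `u = 1 / s`. -/
theorem sepFunctional_qUltra {h s : ℝ} (h0 : 0 < h) (h1 : h < 1) (s0 : 0 < s) (s1 : s < 1)
    (n : ℕ) {p : Polynomial ℂ}
    (hp : ∀ z : ℂ, z ≠ 0 → p.eval (z + z⁻¹) = qUltraExp ((h : ℂ) ^ 2) ((s : ℂ) ^ 2) n z)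
    {u v : ℂ} (hu : u ≠ 0) (hv : v ≠ 0) :
    sepFunctional ((h : ℂ) ^ 2) s u v p =
      (s : ℂ) ^ n * (qPoch ((h : ℂ) ^ 2) ((h : ℂ) ^ 2) n /
        qPoch (((s : ℂ) ^ 2) ^ 2) ((h : ℂ) ^ 2) n) *
        (qUltraExp ((h : ℂ) ^ 2) ((s : ℂ) ^ 2) n u *
          qUltraExp ((h : ℂ) ^ 2) ((s : ℂ) ^ 2) n v) := by
  have hhc : (h : ℂ) ≠ 0 := by exact_mod_cast h0.ne'
  have hsc : (s : ℂ) ≠ 0 := by exact_mod_cast s0.ne'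
  have hq : ‖(h : ℂ) ^ 2‖ < 1 := by
    rw [norm_pow, Complex.norm_real, Real.norm_of_nonneg h0.le]
    exact pow_lt_one₀ h0.le h1 two_ne_zero
  have hs2 : ‖((s : ℂ) ^ 2) ^ 2‖ < 1 := by
    rw [norm_pow, norm_pow, Complex.norm_real, Real.norm_of_nonneg s0.le, ← pow_mul]
    exact pow_lt_one₀ s0.le s1 (by norm_num)
  have hD : ∀ u : ℂ, u ≠ 0 →
      (1 - ((s ^ 2 : ℝ) : ℂ) * u ^ 2) * sepFunctional ((h : ℂ) ^ 2) s (h * u) v p +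
        (((s ^ 2 : ℝ) : ℂ) - u ^ 2) * sepFunctional ((h : ℂ) ^ 2) s (u / h) v p =
      (((h : ℂ) ^ n)⁻¹ + ((s ^ 2 : ℝ) : ℂ) * (h : ℂ) ^ n) *
        ((1 - u ^ 2) * sepFunctional ((h : ℂ) ^ 2) s u v p) := by
    intro u hu
    obtain ⟨p', h1', h2'⟩ := exists_sepFunctional_intertwine hhc rfl hsc
      (fun k => qPoch_ne_zero_of_norm_lt_one hq hs2 k) hu hv p
    have hp' : p' = (((h : ℂ) ^ n)⁻¹ + (s : ℂ) ^ 2 * (h : ℂ) ^ n) • p := by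
      refine eq_of_eval_add_inv fun z hz hz2 => ?_
      have e := h1' z hz
      rw [hp _ (mul_ne_zero hhc hz), hp _ (div_ne_zero hz hhc),
        qUltraExp_qDifference hq hhc rfl n hz] at e
      rw [Polynomial.eval_smul, hp z hz, smul_eq_mul]
      exact mul_left_cancel₀ (sub_ne_zero.2 (Ne.symm hz2)) (by linear_combination -e)
    rw [hp', map_smul, smul_eq_mul] at h2'
    push_cast
    linear_combination h2'
  obtain ⟨κ, hκ⟩ := IsLaurent.eq_mul_qUltraExp h0 h1 (pow_pos s0 2)
    (pow_lt_one₀ s0.le s1 two_ne_zero) n (isLaurent_sepFunctional _ s v p) hD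
  push_cast at hκ
  have e := hκ _ (inv_ne_zero hsc)
  rw [sepFunctional_inv (pow_ne_zero 2 hhc) hsc hv, hp v hv, qUltraExp_principal hq hsc] at e
  rw [hκ u hu, e]
  have h1 := qPoch_ne_zero_of_norm_lt_one hq hs2 n
  have h2 := qPoch_ne_zero_of_norm_lt_one hq hq n
  generalize qPoch (((s : ℂ) ^ 2) ^ 2) ((h : ℂ) ^ 2) n = A at *
  field_simp

/-- The contour integral with parameters `s u / v`, `s v / u`, `s u v`, `s / (u v)` of a
polynomial. -/
theorem awIntegral_eq_sepFunctional {q : ℝ} (hq0 : 0 < q) (hq1 : q < 1) {ε : ℝ} {s u v : ℂ}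
    (hs : s ≠ 0) (hu : u ≠ 0) (hv : v ≠ 0) (hs4 : ∀ k : ℕ, s ^ 4 * (q : ℂ) ^ k ≠ 1)
    (hA : Admissible q {s * u / v, s * v / u, s * (u * v), s / (u * v)} ε) (p : Polynomial ℂ) :
    awIntegral q ε (s * u / v) (s * v / u) (s * (u * v)) (s / (u * v)) p =
      awValue q (s * u / v) (s * v / u) (s * (u * v)) (s / (u * v)) *
        sepFunctional q s u v p := by
  have hqc : (q : ℂ) ≠ 0 := by exact_mod_cast hq0.ne'
  have ha : s * u / v ≠ 0 := div_ne_zero (mul_ne_zero hs hu) hv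
  set L : Polynomial ℂ →ₗ[ℂ] ℂ :=
    { toFun := awIntegral q ε (s * u / v) (s * v / u) (s * (u * v)) (s / (u * v))
      map_add' := awIntegral_add hq0 hq1 hA
      map_smul' := awIntegral_smul hq0 hq1 } with hL
  have habcd : s * u / v * (s * v / u) * (s * (u * v)) * (s / (u * v)) = s ^ 4 := by
    field_simp
  have : L = awValue q (s * u / v) (s * v / u) (s * (u * v)) (s / (u * v)) •
      sepFunctional q s u v := by
    refine linearMap_ext_awBasis ha hqc fun k => ?_
    have e := awIntegral_awBasis hq0 hq1 k hA (by rwa [habcd])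
    rw [LinearMap.smul_apply, sepFunctional, momentFunctional_awBasis ha hqc, sepMoment, hL,
      LinearMap.coe_mk, AddHom.coe_mk, e, habcd, smul_eq_mul,
      show s * u / v * (s * v / u) = s ^ 2 by field_simp,
      show s * u / v * (s * (u * v)) = s ^ 2 * u ^ 2 by field_simp,
      show s * u / v * (s / (u * v)) = s ^ 2 / v ^ 2 by field_simp,
      show s ^ 4 = (s ^ 2) ^ 2 by ring]
  exact congrArg (fun M => M p) this

end Product

end SepVar

namespace SepVar

/-! ### The separated polynomials -/

section SepPoly

/-- The coefficients of the series `₂φ₁` of `f_λ` are those of `C_n`, up to a constant. -/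
theorem qPoch_reversal {q t : ℂ} (hq0 : q ≠ 0) (ht0 : t ≠ 0) (hq : ‖q‖ < 1) (ht : ‖t‖ < 1) (n : ℕ) :
    ∀ k ≤ n, qPoch (q ^ (-(n : ℤ))) q k / qPoch (t⁻¹ * q ^ (1 - (n : ℤ))) q k * (t⁻¹ * q) ^ k =
      qPoch q q n / qPoch t q n * (qPoch t q (n - k) / qPoch q q (n - k)) := by
  intro k
  induction k with
  | zero =>
    intro _
    have h1 := qPoch_ne_zero_of_norm_lt_one hq hq n
    have h2 := qPoch_ne_zero_of_norm_lt_one hq ht n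
    simp only [qPoch_zero, Nat.sub_zero, pow_zero]
    field_simp
  | succ k ih =>
    intro hk
    obtain ⟨m, rfl⟩ : ∃ m, n = m + (k + 1) := ⟨n - (k + 1), by omega⟩
    have ih := ih (by omega)
    rw [show m + (k + 1) - k = m + 1 by omega, qPoch_succ, qPoch_succ] at ih
    have h1 := qPoch_ne_zero_of_norm_lt_one hq hq (m + 1)
    have h2 := qPoch_ne_zero_of_norm_lt_one hq ht (m + 1)
    rw [qPoch_succ] at h1 h2
    have h1' := right_ne_zero_of_mul h1
    have h2' := right_ne_zero_of_mul h2
    have hqm : q ^ m ≠ 0 := pow_ne_zero _ hq0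
    have e1 : q ^ (-((m + (k + 1) : ℕ) : ℤ)) * q ^ k = (q ^ m * q)⁻¹ := by
      rw [← zpow_natCast q k, ← zpow_add₀ hq0, ← pow_succ, ← zpow_natCast q (m + 1), ← zpow_neg]
      congr 1
      push_cast
      ring
    have e2 : t⁻¹ * q ^ (1 - ((m + (k + 1) : ℕ) : ℤ)) * q ^ k = (t * q ^ m)⁻¹ := by
      rw [mul_assoc, ← zpow_natCast q k, ← zpow_add₀ hq0, mul_inv, ← zpow_natCast q m, ← zpow_neg]
      congr 2
      push_cast
      ring
    have e3 : (1 - (q ^ m * q)⁻¹) / (1 - (t * q ^ m)⁻¹) * (t⁻¹ * q) =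
        (1 - q * q ^ m) / (1 - t * q ^ m) := by
      have h3 : 1 - (t * q ^ m)⁻¹ ≠ 0 := by
        intro h
        refine h2' ?_
        rw [sub_eq_zero, eq_comm, inv_eq_one] at h
        rw [h, sub_self]
      have h4 : t * q ^ m - 1 ≠ 0 := fun h => h2' (by linear_combination -h)
      rw [eq_div_iff h2', div_mul_eq_mul_div, div_mul_eq_mul_div, div_eq_iff h3]
      field_simp
      ring
    rw [qPoch_succ, qPoch_succ, e1, e2, pow_succ, Nat.add_sub_cancel, mul_div_mul_comm]
    trans qPoch (q ^ (-((m + (k + 1) : ℕ) : ℤ))) q k /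
      qPoch (t⁻¹ * q ^ (1 - ((m + (k + 1) : ℕ) : ℤ))) q k * (t⁻¹ * q) ^ k *
        ((1 - (q ^ m * q)⁻¹) / (1 - (t * q ^ m)⁻¹) * (t⁻¹ * q))
    · ring
    · rw [ih, e3]
      have := left_ne_zero_of_mul h1
      generalize 1 - q * q ^ m = A at *
      generalize 1 - t * q ^ m = B at *
      field_simp

theorem qPoch_zpow_neg_eq_zero {q : ℂ} (hq0 : q ≠ 0) {n k : ℕ} (hk : n < k) :
    qPoch (q ^ (-(n : ℤ))) q k = 0 :=
  Finset.prod_eq_zero (Finset.mem_range.2 hk)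
    (by rw [zpow_neg, zpow_natCast, inv_mul_cancel₀ (pow_ne_zero n hq0), sub_self])

/-- The separated polynomial is, up to elementary factors, the continuous `q`-ultraspherical
polynomial at the square root of `y / t`. -/
theorem sepPoly_mul_sq {q t : ℝ} (hq0 : 0 < q) (hq1 : q < 1) (ht0 : 0 < t) (ht1 : t < 1)
    {l₁ l₂ : ℤ} {n : ℕ} (hn : l₂ - l₁ = n) {u : ℂ} (hu : u ≠ 0) :
    sepPoly q t l₁ l₂ (t * u ^ 2) = (t * u ^ 2) ^ l₁ * (qPoch q q n / qPoch t q n) *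
      (u ^ n * qUltraExp q t n u) := by
  have hqc : (q : ℂ) ≠ 0 := by exact_mod_cast hq0.ne'
  have htc : (t : ℂ) ≠ 0 := by exact_mod_cast ht0.ne'
  rw [sepPoly, hn, phi21, tsum_eq_sum (s := Finset.range (n + 1)), mul_assoc (_ ^ l₁)]
  · congr 1
    rw [← qUltraExp_inv, qUltraExp, Finset.mul_sum, Finset.mul_sum]
    refine Finset.sum_congr rfl fun k hk => ?_
    have hkn : k ≤ n := by have := Finset.mem_range.1 hk; omega
    have e := qPoch_reversal hqc htc (norm_ofReal_lt_one hq0 hq1) (norm_ofReal_lt_one ht0 ht1)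
      n k hkn
    have e1 : u ^ n * u⁻¹ ^ ((n : ℤ) - 2 * (k : ℤ)) = (u ^ 2) ^ k := by
      rw [inv_zpow', ← zpow_natCast, ← zpow_add₀ hu, ← pow_mul, ← zpow_natCast]
      congr 1
      push_cast
      ring
    have e2 : ((t : ℂ) ^ 2)⁻¹ * q * (t * u ^ 2) = (t : ℂ)⁻¹ * q * u ^ 2 := by
      field_simp
    rw [e2, mul_pow]
    trans qPoch t q k / qPoch q q k * (qPoch ((q : ℂ) ^ (-(n : ℤ))) q k /
      qPoch ((t : ℂ)⁻¹ * (q : ℂ) ^ (1 - (n : ℤ))) q k * ((t : ℂ)⁻¹ * q) ^ k) * (u ^ 2) ^ k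
    · ring
    · rw [e, ← e1]
      ring
  · intro k hk
    rw [qPoch_zpow_neg_eq_zero hqc (by simpa using hk)]
    simp

end SepPoly

/-! ### Admissible radii -/

section Radius

variable {q : ℝ} {S : Set ℂ} {ε : ℝ}

/-- If `S` is closed under `s ↦ c / s` for a positive `c`, a small disc cannot contain `0`: next
to `0` it would contain points of the sequence `c s⁻¹ q ^ j`. -/
theorem SmallRadius.admissible (hq0 : 0 < q) (hq1 : q < 1) {c : ℝ} (hc : 0 < c)
    (hS : ∀ s ∈ S, (c : ℂ) * s⁻¹ ∈ S) (hf : S.Finite) (h0 : (0 : ℂ) ∉ S) (hg : Generic q S)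
    (hε : SmallRadius q S ε) : Admissible q S ε := by
  have key : ∀ (a : ℂ) (x : ℝ), a ≠ 0 → 0 < x → x < 1 → (0 : ℂ) ∈ Metric.closedBall a ε →
      (x : ℂ) * a ∈ Metric.closedBall a ε ∧ (x : ℂ) * a ≠ a := by
    intro a x ha hx0 hx1 h
    rw [Metric.mem_closedBall, dist_zero_left] at h
    refine ⟨?_, fun he => ?_⟩
    · rw [Metric.mem_closedBall, dist_eq_norm, show (x : ℂ) * a - a = ((x - 1 : ℝ) : ℂ) * a by
        push_cast; ring, norm_mul, Complex.norm_real, Real.norm_of_nonpos (by linarith)]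
      nlinarith [norm_nonneg a]
    · have : (x : ℂ) = 1 := mul_right_cancel₀ ha (by rw [he, one_mul])
      exact hx1.ne (by exact_mod_cast this)
  refine ⟨hf, h0, hg, hε, fun p hp => ⟨fun h => ?_, fun h => ?_⟩⟩
  · have hp0 : p ≠ 0 := by
      rintro rfl
      have := hp.2
      rw [norm_zero] at this
      linarith
    obtain ⟨h1, h2⟩ := key p q hp0 hq0 hq1 h
    obtain ⟨s, hs, k, rfl⟩ := hp.1
    exact h2 ((hε.2 _ hp _ (Or.inl ⟨s, hs, k + 1, by ring⟩)).1 h1)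
  · obtain ⟨s, hs, k, rfl⟩ := hp.1
    have hp0 : (s * (q : ℂ) ^ k) ≠ 0 := by
      intro h0
      have := hp.2
      rw [h0, norm_zero] at this
      linarith
    have hs0 := left_ne_zero_of_mul hp0
    have hqk := right_ne_zero_of_mul hp0
    have ht : Filter.Tendsto (fun j : ℕ => c * q ^ k * q ^ j) Filter.atTop (nhds 0) := by
      simpa using (tendsto_pow_atTop_nhds_zero_of_lt_one hq0.le hq1).const_mul (c * q ^ k)
    obtain ⟨j, hj⟩ := (ht.eventually (gt_mem_nhds one_pos)).exists
    obtain ⟨h1, h2⟩ := key _ (c * q ^ k * q ^ j) (inv_ne_zero hp0) (by positivity) hj h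
    refine h2 ((hε.2 _ hp _ (Or.inl ⟨_, hS s hs, j, ?_⟩)).2 h1)
    push_cast
    field_simp

/-- The poles accumulate only at `0` and at infinity, so all small radii are small enough. -/
theorem eventually_smallRadius (hq0 : 0 < q) (hq1 : q < 1) (hf : S.Finite) (h0 : (0 : ℂ) ∉ S) :
    ∀ᶠ ε in nhdsWithin (0 : ℝ) (Set.Ioi 0), SmallRadius q S ε := by
  have key : ∀ a : ℂ, a ≠ 0 → ∀ᶠ ε in nhdsWithin (0 : ℝ) (Set.Ioi 0),
      ∀ s ∈ innerPoles q S ∪ outerPoles q S, s ∈ Metric.closedBall a ε → s = a := by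
    intro a ha
    obtain ⟨ρ, hρ0, hρ⟩ : ∃ ρ : ℝ, 0 < ρ ∧ a ∈ annulus ρ := by
      have h1 : 0 < ‖a‖ := norm_pos_iff.2 ha
      refine ⟨‖a‖ + ‖a‖⁻¹, by positivity, ?_, ?_⟩
      · exact inv_lt_of_inv_lt₀ h1 (by linarith)
      · have : 0 < ‖a‖⁻¹ := inv_pos.2 h1
        linarith
    have hfin := (poles_inter_annulus_finite hq0 hq1 hf h0 hρ0).subset
      (Set.sdiff_subset (t := {a}))
    have hU : annulus ρ ∩ ((((innerPoles (q : ℂ) S ∪ outerPoles q S) ∩ annulus ρ) \ {a})ᶜ) ∈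
        nhds a :=
      ((isOpen_annulus ρ).inter hfin.isClosed.isOpen_compl).mem_nhds ⟨hρ, fun h => h.2 rfl⟩
    obtain ⟨δ, hδ0, hδ⟩ := Metric.nhds_basis_closedBall.mem_iff.1 hU
    filter_upwards [Ioo_mem_nhdsGT hδ0] with ε hε s hs hsa
    have h := hδ (Metric.closedBall_subset_closedBall hε.2.le hsa)
    by_contra hne
    exact h.2 ⟨⟨hs, h.1⟩, hne⟩
  have hne : ∀ p ∈ largePoles (q : ℂ) S, p ≠ 0 := by
    rintro _ hp rfl
    have := hp.2
    rw [norm_zero] at this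
    linarith
  have h1 := (largePoles_finite hq0 hq1 hf).eventually_all (l := nhdsWithin (0 : ℝ) (Set.Ioi 0))
    |>.2 fun p hp => (key p (hne p hp)).and (key p⁻¹ (inv_ne_zero (hne p hp)))
  filter_upwards [h1, self_mem_nhdsWithin] with ε hε hε0
  exact ⟨hε0, fun p hp s hs => ⟨(hε p hp).1 s hs, (hε p hp).2 s hs⟩⟩

end Radius

end SepVar

namespace SepVar

/-! ### The separating operator as an Askey–Wilson integral -/

section Separation

theorem qBeta_self {q g : ℝ} (hq0 : 0 < q) (hq1 : q < 1) (hg : 0 < g) :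
    qBeta q g g = (1 - q) * qPochInf q q * qPochInf (((q ^ g : ℝ) : ℂ) ^ 2) q /
      qPochInf ((q ^ g : ℝ) : ℂ) q ^ 2 := by
  have hq := norm_ofReal_lt_one hq0 hq1
  have ht := norm_ofReal_lt_one (Real.rpow_pos_of_pos hq0 g) (Real.rpow_lt_one hq0.le hq1 hg)
  have h1 := qPochInf_ne_zero_of_norm_lt_one hq hq
  have h2 := qPochInf_ne_zero_of_norm_lt_one hq ht
  have h3 : qPochInf (((q ^ g : ℝ) : ℂ) ^ 2) q ≠ 0 :=
    qPochInf_ne_zero_of_norm_lt_one hq (by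
      rw [norm_pow]; exact pow_lt_one₀ (norm_nonneg _) ht two_ne_zero)
  have hq' : 0 < 1 - q := by linarith
  have e1 : q ^ (g + g) = (q ^ g) ^ 2 := by rw [Real.rpow_add hq0, sq]
  have e2 : (1 - q) ^ (1 - g) * (1 - q) ^ (1 - g) = (1 - q) * (1 - q) ^ (1 - (g + g)) := by
    have h := Real.rpow_add hq' 1 (1 - (g + g))
    rw [Real.rpow_one] at h
    rw [← h, ← Real.rpow_add hq']
    congr 1
    ring
  have e2' : (((1 - q) ^ (1 - g) : ℝ) : ℂ) * (((1 - q) ^ (1 - g) : ℝ) : ℂ) =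
      (1 - q) * (((1 - q) ^ (1 - (g + g)) : ℝ) : ℂ) := by exact_mod_cast e2
  have h4 : (((1 - q) ^ (1 - (g + g)) : ℝ) : ℂ) ≠ 0 := by
    exact_mod_cast (Real.rpow_pos_of_pos hq' _).ne'
  rw [qBeta, qGamma, qGamma, e1]
  rw [Complex.ofReal_pow]
  generalize (((1 - q) ^ (1 - g) : ℝ) : ℂ) = A at *
  generalize (((1 - q) ^ (1 - (g + g)) : ℝ) : ℂ) = B at *
  field_simp
  linear_combination e2'

/-- The factor `(q, t, t; q)_∞ L(t; u / v, u v) / (2 (t²; q)_∞)` that normalizes the Askey–Wilson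
weight with parameters `s u / v`, `s v / u`, `s u v`, `s / (u v)`, where `t = s²`. -/
noncomputable def sepNorm (q t u v : ℂ) : ℂ :=
  qPochInf q q * qPochInf t q ^ 2 * Lq q t (u / v) (u * v) / (2 * qPochInf (t ^ 2) q)

theorem sepKernel_eq {q g : ℝ} (hq0 : 0 < q) (hq1 : q < 1) (hg : 0 < g) {yp u v : ℂ}
    (hu : u ≠ 0) (hv : v ≠ 0) (hyp : yp = ((q ^ g : ℝ) : ℂ) * (u * v)) (z : ℂ) :
    sepKernel q g yp (u / v) z =
      sepNorm q ((q ^ g : ℝ) : ℂ) u v *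
      awWeight q z (((√(q ^ g) : ℝ) : ℂ) * u / v) (((√(q ^ g) : ℝ) : ℂ) * v / u)
        (((√(q ^ g) : ℝ) : ℂ) * (u * v)) (((√(q ^ g) : ℝ) : ℂ) / (u * v)) := by
  have htc : ((q ^ g : ℝ) : ℂ) ≠ 0 := by exact_mod_cast (Real.rpow_pos_of_pos hq0 g).ne'
  have hr : ((q ^ g : ℝ) : ℂ)⁻¹ * yp = u * v := by rw [hyp]; field_simp
  have hq := norm_ofReal_lt_one hq0 hq1
  have ht := norm_ofReal_lt_one (Real.rpow_pos_of_pos hq0 g) (Real.rpow_lt_one hq0.le hq1 hg)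
  have h1 := qPochInf_ne_zero_of_norm_lt_one hq hq
  have hq' : (1 - q : ℂ) ≠ 0 := by
    intro h
    rw [sub_eq_zero] at h
    exact hq1.ne (by exact_mod_cast h.symm)
  simp only [sepKernel]
  rw [hr, qBeta_self hq0 hq1 hg, awWeight, sepNorm]
  generalize Lq q _ (u / v) (u * v) = L
  simp only [Lq]
  generalize ((√(q ^ g) : ℝ) : ℂ) = s at *
  generalize ((q ^ g : ℝ) : ℂ) = t at *
  have e1 : s * (u / v) * z = s * u / v * z := by ring
  have e2 : s * (u / v) * z⁻¹ = s * u / v * z⁻¹ := by ring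
  have e3 : s * (u / v)⁻¹ * z = s * v / u * z := by rw [inv_div]; ring
  have e4 : s * (u / v)⁻¹ * z⁻¹ = s * v / u * z⁻¹ := by rw [inv_div]; ring
  have e5 : s * z * (u * v) = s * (u * v) * z := by ring
  have e6 : s * z * (u * v)⁻¹ = s / (u * v) * z := by ring
  have e7 : s * z⁻¹ * (u * v) = s * (u * v) * z⁻¹ := by ring
  have e8 : s * z⁻¹ * (u * v)⁻¹ = s / (u * v) * z⁻¹ := by ring
  rw [e1, e2, e3, e4, e5, e6, e7, e8]
  have e9 : (1 - (q : ℂ)) * qPochInf q q ^ 2 /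
      (2 * ((1 - q) * qPochInf q q * qPochInf (t ^ 2) q / qPochInf t q ^ 2)) =
      qPochInf q q * qPochInf t q ^ 2 / (2 * qPochInf (t ^ 2) q) := by
    generalize qPochInf t q = T at *
    generalize qPochInf (t ^ 2) q = T'
    field_simp
  rw [mul_right_comm _ _ L, mul_assoc (2 * _), mul_div_mul_comm, mul_div_right_comm _ L, e9,
    mul_div_right_comm _ L]
  congr 2
  ring

theorem sepParams_eq {t : ℝ} (ht : 0 < t) {yp u v : ℂ} (hyp : yp = (t : ℂ) * (u * v)) :
    sepParams t yp (u / v) = {((√t : ℝ) : ℂ) * u / v, ((√t : ℝ) : ℂ) * v / u,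
      ((√t : ℝ) : ℂ) * (u * v), ((√t : ℝ) : ℂ) / (u * v)} := by
  have htc : (t : ℂ) ≠ 0 := by exact_mod_cast ht.ne'
  have hr : (t : ℂ)⁻¹ * yp = u * v := by rw [hyp]; field_simp
  rw [sepParams, hr, inv_div]
  generalize ((√t : ℝ) : ℂ) = s
  rw [show u / v * s = s * u / v by ring, show v / u * s = s * v / u by ring,
    mul_comm (u * v) s, ← div_eq_inv_mul]

theorem zero_notMem_sepParams {s u v : ℂ} (hs : s ≠ 0) (hu : u ≠ 0) (hv : v ≠ 0) :
    (0 : ℂ) ∉ ({s * u / v, s * v / u, s * (u * v), s / (u * v)} : Set ℂ) :=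
  zero_notMem_params.2 ⟨div_ne_zero (mul_ne_zero hs hu) hv, div_ne_zero (mul_ne_zero hs hv) hu,
    mul_ne_zero hs (mul_ne_zero hu hv), div_ne_zero hs (mul_ne_zero hu hv)⟩

theorem SmallRadius.admissible_sepParams {q : ℝ} (hq0 : 0 < q) (hq1 : q < 1) {ε s : ℝ}
    (hs : 0 < s) {u v : ℂ} (hu : u ≠ 0) (hv : v ≠ 0)
    (hg : Generic q {s * u / v, s * v / u, s * (u * v), s / (u * v)})
    (hε : SmallRadius q {s * u / v, s * v / u, s * (u * v), s / (u * v)} ε) :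
    Admissible q {s * u / v, s * v / u, s * (u * v), s / (u * v)} ε := by
  have hsc : (s : ℂ) ≠ 0 := by exact_mod_cast hs.ne'
  refine hε.admissible hq0 hq1 (pow_pos hs 2) ?_ (finite_params _ _ _ _)
    (zero_notMem_sepParams hsc hu hv) hg
  push_cast
  rintro x (rfl | rfl | rfl | rfl)
  · right; left; field_simp
  · left; field_simp
  · right; right; right
    rw [Set.mem_singleton_iff]; field_simp
  · right; right; left; field_simp

/-- The product formula, for parameters in general position, as a contour integral. The parameters
have the products `t, t, t u², t / u², t v², t / v²`, so `sepNorm` is the inverse of the value of the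
Askey–Wilson integral. -/
theorem sepNorm_mul_awIntegral {q t : ℝ} (hq0 : 0 < q) (hq1 : q < 1) (ht0 : 0 < t) (ht1 : t < 1)
    {n : ℕ} {p : Polynomial ℂ} (hp : ∀ z : ℂ, z ≠ 0 → p.eval (z + z⁻¹) = qUltraExp q t n z)
    {s : ℂ} (hs : s = ((√t : ℝ) : ℂ)) {u v : ℂ} (hu : u ≠ 0) (hv : v ≠ 0) {ε : ℝ}
    (hA : Admissible q {s * u / v, s * v / u, s * (u * v), s / (u * v)} ε) :
    sepNorm q t u v * awIntegral q ε (s * u / v) (s * v / u) (s * (u * v)) (s / (u * v)) p =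
      s ^ n * (qPoch q q n / qPoch ((t : ℂ) ^ 2) q n) *
        (qUltraExp q t n u * qUltraExp q t n v) := by
  have hs0 : 0 < √t := Real.sqrt_pos.2 ht0
  have hs1 : √t < 1 := by rw [Real.sqrt_lt' one_pos]; simpa using ht1
  have hh0 : 0 < √q := Real.sqrt_pos.2 hq0
  have hh1 : √q < 1 := by rw [Real.sqrt_lt' one_pos]; simpa using hq1
  have hsc : s ≠ 0 := by rw [hs]; exact_mod_cast hs0.ne'
  have hs2 : s ^ 2 = t := by rw [hs]; exact_mod_cast Real.sq_sqrt ht0.le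
  have hh2 : ((√q : ℝ) : ℂ) ^ 2 = q := by exact_mod_cast Real.sq_sqrt hq0.le
  have hs4 : ∀ k : ℕ, s ^ 4 * (q : ℂ) ^ k ≠ 1 := by
    intro k h
    have h1 : t ^ 2 * q ^ k = 1 := by
      rw [show s ^ 4 = (t : ℂ) ^ 2 by rw [← hs2]; ring] at h
      exact_mod_cast h
    have h2 : q ^ k ≤ 1 := pow_le_one₀ hq0.le hq1.le
    have h3 : t ^ 2 < 1 := pow_lt_one₀ ht0.le ht1 two_ne_zero
    nlinarith [pow_pos hq0 k, sq_nonneg t]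
  have hK : sepNorm q t u v *
      awValue q (s * u / v) (s * v / u) (s * (u * v)) (s / (u * v)) = 1 := by
    have e0 : s * u / v * (s * v / u) * (s * (u * v)) * (s / (u * v)) = s ^ 4 := by field_simp
    have hne := awValue_ne_zero hq0 hq1 hA (by rwa [e0])
    rw [awValue, e0, show s ^ 4 = (t : ℂ) ^ 2 by rw [← hs2]; ring,
      show s * u / v * (s * v / u) = t by rw [← hs2]; field_simp,
      show s * u / v * (s * (u * v)) = t * (u / v) * (u * v) by rw [← hs2]; ring,
      show s * u / v * (s / (u * v)) = t * (u / v) * (u * v)⁻¹ by rw [← hs2]; ring,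
      show s * v / u * (s * (u * v)) = t * (u / v)⁻¹ * (u * v) by rw [← hs2, inv_div]; ring,
      show s * v / u * (s / (u * v)) = t * (u / v)⁻¹ * (u * v)⁻¹ by rw [← hs2, inv_div]; ring,
      show s * (u * v) * (s / (u * v)) = t by rw [← hs2]; field_simp] at hne ⊢
    obtain ⟨e1, e2⟩ := div_ne_zero_iff.1 hne
    rw [sepNorm, Lq, div_mul_div_comm, div_eq_one_iff_eq (mul_ne_zero e1 e2)]
    ring
  have hmain := sepFunctional_qUltra hh0 hh1 hs0 hs1 n (p := p) (by rwa [hh2, ← hs, hs2]) hu hv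
  rw [hh2, ← hs, hs2] at hmain
  rw [awIntegral_eq_sepFunctional hq0 hq1 hsc hu hv hs4 hA, ← mul_assoc, hK, one_mul, hmain]

/-- Separation of variables, with `y₁ = t u²` and `y₂ = t v²`. -/
theorem sepOp_macdonaldP {q g t : ℝ} (hq0 : 0 < q) (hq1 : q < 1) (hg : 0 < g) (ht : t = q ^ g)
    {ξ : ℂ} (hξ : ξ ≠ 0) {l₁ l₂ : ℤ} (hl : l₁ ≤ l₂) {u v : ℂ} (hu : u ≠ 0) (hv : v ≠ 0) {ε : ℝ}
    (hgen : Generic q (sepParams t (t * (u * v)) (u / v)))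
    (hε : SmallRadius q (sepParams t (t * (u * v)) (u / v)) ε) :
    sepOp q g ξ ε (macdonaldP q t l₁ l₂) (t * (u * v)) (u / v) =
      sepCoeff q t ξ l₁ l₂ *
        (sepPoly q t l₁ l₂ (t * u ^ 2) * sepPoly q t l₁ l₂ (t * v ^ 2)) := by
  have ht0 : 0 < t := ht ▸ Real.rpow_pos_of_pos hq0 g
  have ht1 : t < 1 := ht ▸ Real.rpow_lt_one hq0.le hq1 hg
  have hs0 : 0 < √t := Real.sqrt_pos.2 ht0
  have htc : (t : ℂ) ≠ 0 := by exact_mod_cast ht0.ne'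
  have hsc : ((√t : ℝ) : ℂ) ≠ 0 := by exact_mod_cast hs0.ne'
  have hs2 : ((√t : ℝ) : ℂ) ^ 2 = t := by exact_mod_cast Real.sq_sqrt ht0.le
  have hq := norm_ofReal_lt_one hq0 hq1
  have htn := norm_ofReal_lt_one ht0 ht1
  obtain ⟨n, hn⟩ := Int.eq_ofNat_of_zero_le (sub_nonneg.2 hl)
  have hnn : (l₂ - l₁).toNat = n := by rw [hn]; rfl
  rw [sepParams_eq ht0 rfl] at hgen hε
  have hA := hε.admissible_sepParams hq0 hq1 hs0 hu hv hgen
  obtain ⟨p, hp⟩ := exists_qUltra_polynomial q t n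
  have hmain := sepNorm_mul_awIntegral hq0 hq1 ht0 ht1 hp rfl hu hv hA
  set s : ℂ := ((√t : ℝ) : ℂ) with hs
  have hX : s⁻¹ * ξ * (t * (u * v)) ≠ 0 :=
    mul_ne_zero (mul_ne_zero (inv_ne_zero hsc) hξ) (mul_ne_zero htc (mul_ne_zero hu hv))
  have hop : sepOp q g ξ ε (macdonaldP q t l₁ l₂) (t * (u * v)) (u / v) =
      (s⁻¹ * ξ * (t * (u * v))) ^ (l₁ + l₂) * (qPoch q q n / qPoch t q n) * sepNorm q t u v *
        awIntegral q ε (s * u / v) (s * v / u) (s * (u * v)) (s / (u * v)) p := by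
    simp only [sepOp]
    rw [← ht, sepParams_eq ht0 rfl, awIntegral, ← contourIntegral_const_mul hq0 hq1 hA.finite]
    refine contourIntegral_congr hε.1 fun z hz => ?_
    have hz0 := hA.ne_zero_of_mem_contourCurve hz
    rw [← div_eq_mul_inv _ z, macdonaldP_eq q t l₁ l₂ hl _ z hX hz0, hnn,
      qUltra_joukowski _ _ _ _ hz0, hp z hz0,
      sepKernel_eq hq0 hq1 hg hu hv (by rw [ht]) z, ← ht]
    ring
  rw [hop, mul_assoc _ (sepNorm _ _ _ _), hmain,
    sepPoly_mul_sq hq0 hq1 ht0 ht1 hn hu, sepPoly_mul_sq hq0 hq1 ht0 ht1 hn hv, sepCoeff, hnn]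
  have hl2 : l₂ = l₁ + n := by omega
  have hpow : (s⁻¹ * ξ * (t * (u * v))) ^ (l₁ + l₂) * s ^ n =
      (t : ℂ) ^ (-2 * l₁ + l₂) * ξ ^ (l₁ + l₂) * (t * u ^ 2) ^ l₁ * u ^ n *
        ((t * v ^ 2) ^ l₁ * v ^ n) := by
    have e0 : s⁻¹ * ξ * (t * (u * v)) = s * ξ * (u * v) := by rw [← hs2]; field_simp
    have e1 : s ^ (l₁ + l₂) * s ^ n = (t : ℂ) ^ (-2 * l₁ + l₂) * (t : ℂ) ^ l₁ * (t : ℂ) ^ l₁ := by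
      rw [← zpow_add₀ htc, ← zpow_add₀ htc, ← hs2, ← zpow_natCast s n, ← zpow_natCast s 2,
        ← zpow_mul, ← zpow_add₀ hsc]
      congr 1
      push_cast
      omega
    have e2 : ∀ w : ℂ, w ≠ 0 → w ^ (l₁ + l₂) = (w ^ 2) ^ l₁ * w ^ n := by
      intro w hw
      rw [← zpow_natCast w n, ← zpow_natCast w 2, ← zpow_mul, ← zpow_add₀ hw]
      congr 1
      push_cast
      omega
    rw [e0, mul_zpow, mul_zpow, mul_zpow u, mul_zpow (t : ℂ), mul_zpow (t : ℂ), e2 u hu, e2 v hv]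
    linear_combination (ξ ^ (l₁ + l₂) * ((u ^ 2) ^ l₁ * u ^ n * ((v ^ 2) ^ l₁ * v ^ n))) * e1
  have h1 := qPoch_ne_zero_of_norm_lt_one hq htn n
  trans ((s⁻¹ * ξ * (t * (u * v))) ^ (l₁ + l₂) * s ^ n) *
    (qPoch q q n / qPoch t q n * (qPoch q q n / qPoch ((t : ℂ) ^ 2) q n)) *
      (qUltraExp q t n u * qUltraExp q t n v)
  · ring
  · rw [hpow]
    generalize qPoch ((t : ℂ) ^ 2) q n = A
    field_simp

end Separation

end SepVar

namespace SepVar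

/-! ### Integrals over the unit circle and over `[-1, 1]` -/

section CircleIntegral

theorem expI_eq_circleMap (ψ : ℝ) : expI ψ = circleMap 0 1 ψ := by
  simp [expI, circleMap]

theorem expI_ne_zero (ψ : ℝ) : expI ψ ≠ 0 := Complex.exp_ne_zero _

theorem expI_add (ψ χ : ℝ) : expI (ψ + χ) = expI ψ * expI χ := by
  simp [expI, add_mul, Complex.exp_add]

theorem expI_neg (ψ : ℝ) : expI (-ψ) = (expI ψ)⁻¹ := by
  simp [expI, Complex.exp_neg]

theorem expI_sub (ψ χ : ℝ) : expI (ψ - χ) = expI ψ / expI χ := by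
  rw [sub_eq_add_neg, expI_add, expI_neg, div_eq_mul_inv]

theorem expI_two_mul (ψ : ℝ) : expI (2 * ψ) = expI ψ ^ 2 := by
  rw [two_mul, expI_add, sq]

theorem norm_expI (ψ : ℝ) : ‖expI ψ‖ = 1 := Complex.norm_exp_ofReal_mul_I ψ

theorem conj_expI (ψ : ℝ) : (starRingEnd ℂ) (expI ψ) = (expI ψ)⁻¹ := by
  rw [← expI_neg, expI, expI, ← Complex.exp_conj]
  simp

theorem expI_add_inv_div_two (ψ : ℝ) : (expI ψ + (expI ψ)⁻¹) / 2 = (Real.cos ψ : ℂ) := by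
  rw [← expI_neg, Complex.ofReal_cos, Complex.cos, expI, expI]
  push_cast
  ring

/-- An even integrand on the unit circle can be integrated over the upper half circle. -/
theorem circleIntegral_even {F : ℂ → ℂ} (hc : ContinuousOn F (Metric.sphere 0 1))
    (hF : ∀ z : ℂ, ‖z‖ = 1 → F z⁻¹ = F z) :
    (2 * (π : ℂ) * Complex.I)⁻¹ * (∮ z in C(0, 1), z⁻¹ * F z) =
      (π : ℂ)⁻¹ * ∫ ψ in (0 : ℝ)..π, F (expI ψ) := by
  have hcont : Continuous fun ψ : ℝ => F (expI ψ) := by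
    refine hc.comp_continuous ?_ fun ψ => by simp [norm_expI]
    unfold expI
    fun_prop
  have h1 : (∮ z in C(0, 1), z⁻¹ * F z) = Complex.I * ∫ ψ in (0 : ℝ)..2 * π, F (expI ψ) := by
    rw [circleIntegral, ← intervalIntegral.integral_const_mul]
    refine intervalIntegral.integral_congr fun ψ _ => ?_
    simp only [deriv_circleMap, ← expI_eq_circleMap, smul_eq_mul]
    have := expI_ne_zero ψ
    field_simp
  have h2 : (∫ ψ in π..2 * π, F (expI ψ)) = ∫ ψ in (0 : ℝ)..π, F (expI ψ) := by
    have e : ∀ ψ : ℝ, F (expI (2 * π - ψ)) = F (expI ψ) := by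
      intro ψ
      rw [expI_sub, show expI (2 * π) = 1 by simp [expI], one_div, hF _ (norm_expI ψ)]
    have := intervalIntegral.integral_comp_sub_left (a := 0) (b := π)
      (fun ψ : ℝ => F (expI ψ)) (2 * π)
    simp only [e] at this
    rw [this]
    congr 1 <;> ring
  rw [h1, ← intervalIntegral.integral_add_adjacent_intervals (hcont.intervalIntegrable 0 π)
    (hcont.intervalIntegrable π (2 * π)), h2]
  have : (π : ℂ) ≠ 0 := by exact_mod_cast Real.pi_ne_zero
  field_simp
  ring

theorem image_cos_Ioo : Real.cos '' Set.Ioo 0 π = Set.Ioo (-1) 1 := by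
  ext x
  constructor
  · rintro ⟨ψ, hψ, rfl⟩
    have := Real.sin_pos_of_mem_Ioo hψ
    exact abs_lt.1 ((sq_lt_one_iff_abs_lt_one _).1 (by nlinarith [Real.sin_sq_add_cos_sq ψ]))
  · rintro ⟨h1, h2⟩
    exact ⟨Real.arccos x, ⟨Real.arccos_pos.2 h2, Real.arccos_lt_pi.2 h1⟩,
      Real.cos_arccos h1.le h2.le⟩

/-- The substitution `w = cos ψ`. -/
theorem integral_comp_arccos (f : ℝ → ℂ) :
    ∫ w in (-1 : ℝ)..1, ((√(1 - w ^ 2) : ℝ) : ℂ)⁻¹ * f (Real.arccos w) =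
      ∫ ψ in (0 : ℝ)..π, f ψ := by
  rw [intervalIntegral.integral_of_le (by norm_num), intervalIntegral.integral_of_le Real.pi_nonneg,
    MeasureTheory.integral_Ioc_eq_integral_Ioo, MeasureTheory.integral_Ioc_eq_integral_Ioo,
    ← image_cos_Ioo, MeasureTheory.integral_image_eq_integral_abs_deriv_smul measurableSet_Ioo
      (fun x _ => (Real.hasDerivAt_cos x).hasDerivWithinAt)
      (Real.injOn_cos.mono Set.Ioo_subset_Icc_self)]
  refine MeasureTheory.setIntegral_congr_fun measurableSet_Ioo fun ψ hψ => ?_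
  have hs := Real.sin_pos_of_mem_Ioo hψ
  have hsc : (Real.sin ψ : ℂ) ≠ 0 := by exact_mod_cast hs.ne'
  rw [abs_neg, abs_of_pos hs, Real.arccos_cos hψ.1.le hψ.2.le, ← Real.sin_sq, Real.sqrt_sq hs.le,
    Complex.real_smul, mul_inv_cancel_left₀ hsc]

end CircleIntegral

/-! ### The product formula on the interval -/

section ProductFormula

theorem awWeight_inv (q z a b c d : ℂ) : awWeight q z⁻¹ a b c d = awWeight q z a b c d := by
  unfold awWeight
  rw [inv_inv, inv_pow, inv_inv]
  congr 1 <;> ring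

/-- The kernel of the product formula is the normalized Askey–Wilson weight with `u = e^{iθ}`,
`v = e^{iφ}`, times `1 / (π √(1 - w²))`. -/
theorem productKernel_eq_awWeight {q t : ℝ} {x y w : ℝ} :
    productKernel q t x y w = (π : ℂ)⁻¹ * (((√(1 - w ^ 2) : ℝ) : ℂ)⁻¹ *
      (sepNorm q t (expI (Real.arccos x)) (expI (Real.arccos y)) *
        awWeight q (expI (Real.arccos w))
          (((√t : ℝ) : ℂ) * expI (Real.arccos x) / expI (Real.arccos y))
          (((√t : ℝ) : ℂ) * expI (Real.arccos y) / expI (Real.arccos x))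
          (((√t : ℝ) : ℂ) * (expI (Real.arccos x) * expI (Real.arccos y)))
          (((√t : ℝ) : ℂ) / (expI (Real.arccos x) * expI (Real.arccos y))))) := by
  unfold productKernel
  simp only
  set u := expI (Real.arccos x) with hu
  set v := expI (Real.arccos y) with hv
  have hu0 : u ≠ 0 := expI_ne_zero _
  have hv0 : v ≠ 0 := expI_ne_zero _
  have hnorm : ((‖qPochInf (t * expI (2 * Real.arccos x)) q *
      qPochInf (t * expI (2 * Real.arccos y)) q‖ ^ 2 : ℝ) : ℂ) = Lq q t (u / v) (u * v) := by
    rw [Complex.ofReal_pow, ← Complex.mul_conj', map_mul, conj_qPochInf, conj_qPochInf, map_mul,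
      map_mul, conj_expI, conj_expI, Complex.conj_ofReal, Complex.conj_ofReal, expI_two_mul,
      expI_two_mul, ← hu, ← hv, Lq,
      show (t : ℂ) * (u / v) * (u * v) = t * u ^ 2 by field_simp,
      show (t : ℂ) * (u / v) * (u * v)⁻¹ = t * (v ^ 2)⁻¹ by field_simp,
      show (t : ℂ) * (u / v)⁻¹ * (u * v) = t * v ^ 2 by field_simp,
      show (t : ℂ) * (u / v)⁻¹ * (u * v)⁻¹ = t * (u ^ 2)⁻¹ by field_simp]
    ring
  rw [hnorm, expI_add, expI_sub, expI_sub, expI_sub, expI_neg, ← hu, ← hv, sepNorm, awWeight,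
    awWeight]
  generalize expI (Real.arccos w) = z
  generalize ((√t : ℝ) : ℂ) = s
  rw [show s * (u⁻¹ / v) = s / (u * v) by field_simp, mul_div_assoc s u v, mul_div_assoc s v u]
  ring

/-- The product formula of the continuous `q`-ultraspherical polynomials. -/
theorem productFormulaAt {q t : ℝ} (hq0 : 0 < q) (hq1 : q < 1) (ht0 : 0 < t) (ht1 : t < 1) (n : ℕ)
    {x y : ℝ} (hx : x ∈ Set.Icc (-1 : ℝ) 1) (hy : y ∈ Set.Icc (-1 : ℝ) 1) :
    ProductFormulaAt q t n x y := by
  have hs0 : 0 < √t := Real.sqrt_pos.2 ht0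
  have hs1 : √t < 1 := by rw [Real.sqrt_lt' one_pos]; simpa using ht1
  have hq := norm_ofReal_lt_one hq0 hq1
  have htn2 : ‖(t : ℂ) ^ 2‖ < 1 := by
    rw [norm_pow]; exact pow_lt_one₀ (norm_nonneg _) (norm_ofReal_lt_one ht0 ht1) two_ne_zero
  have hsn : ‖((√t : ℝ) : ℂ)‖ < 1 := norm_ofReal_lt_one hs0 hs1
  have hsc : ((√t : ℝ) : ℂ) ≠ 0 := by exact_mod_cast hs0.ne'
  have hC : ∀ w ∈ Set.Icc (-1 : ℝ) 1, qUltra q t n w = qUltraExp q t n (expI (Real.arccos w)) := by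
    intro w hw
    rw [← qUltra_joukowski _ _ _ _ (expI_ne_zero _), expI_add_inv_div_two,
      Real.cos_arccos hw.1 hw.2]
  obtain ⟨p, hp⟩ := exists_qUltra_polynomial q t n
  unfold ProductFormulaAt
  rw [hC x hx, hC y hy]
  have hI : ∫ w in (-1 : ℝ)..1, productKernel q t x y w * qUltra q t n w =
      ∫ w in (-1 : ℝ)..1, ((√(1 - w ^ 2) : ℝ) : ℂ)⁻¹ * ((π : ℂ)⁻¹ *
        (sepNorm q t (expI (Real.arccos x)) (expI (Real.arccos y)) *
        (awWeight q (expI (Real.arccos w))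
          (((√t : ℝ) : ℂ) * expI (Real.arccos x) / expI (Real.arccos y))
          (((√t : ℝ) : ℂ) * expI (Real.arccos y) / expI (Real.arccos x))
          (((√t : ℝ) : ℂ) * (expI (Real.arccos x) * expI (Real.arccos y)))
          (((√t : ℝ) : ℂ) / (expI (Real.arccos x) * expI (Real.arccos y))) *
            p.eval (expI (Real.arccos w) + (expI (Real.arccos w))⁻¹)))) := by
    refine intervalIntegral.integral_congr fun w hw => ?_
    rw [Set.uIcc_of_le (by norm_num)] at hw
    rw [productKernel_eq_awWeight, hC w hw, hp _ (expI_ne_zero _)]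
    ring
  set u := expI (Real.arccos x) with hu
  set v := expI (Real.arccos y) with hv
  have hu0 : u ≠ 0 := expI_ne_zero _
  have hv0 : v ≠ 0 := expI_ne_zero _
  have hun : ‖u‖ = 1 := norm_expI _
  have hvn : ‖v‖ = 1 := norm_expI _
  have hS : ∀ a ∈ ({(√t : ℝ) * u / v, (√t : ℝ) * v / u, (√t : ℝ) * (u * v),
      (√t : ℝ) / (u * v)} : Set ℂ), ‖a‖ < 1 := by
    rintro a (rfl | rfl | rfl | rfl) <;> simpa [hun, hvn] using hsn
  have hA := admissible_of_norm_lt_one hq0 hq1 (finite_params _ _ _ _)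
    (zero_notMem_sepParams hsc hu0 hv0) hS one_pos
  have hmain := sepNorm_mul_awIntegral hq0 hq1 ht0 ht1 hp rfl hu0 hv0 hA
  have hcont := (continuousOn_awIntegrand hq0 hq1 hA p).mono
    (Set.subset_union_left : Metric.sphere (0 : ℂ) 1 ⊆ _)
  have hcont' := (continuousOn_id.mul hcont).congr (g := fun z : ℂ =>
    awWeight q z ((√t : ℝ) * u / v) ((√t : ℝ) * v / u) ((√t : ℝ) * (u * v)) ((√t : ℝ) / (u * v)) *
      p.eval (z + z⁻¹)) fun z hz => by
        have hz0 : z ≠ 0 := by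
          rintro rfl
          simp at hz
        simp only [Pi.mul_apply, id]
        rw [mul_inv_cancel_left₀ hz0]
  rw [awIntegral, contourIntegral_of_norm_lt_one hq0 hq1 hS, circleIntegral_even hcont'
    (fun z _ => by rw [awWeight_inv, inv_inv, add_comm])] at hmain
  rw [hI, integral_comp_arccos (fun ψ => (π : ℂ)⁻¹ * (sepNorm q t u v *
    (awWeight q (expI ψ) _ _ _ _ * p.eval (expI ψ + (expI ψ)⁻¹)))),
    intervalIntegral.integral_const_mul, intervalIntegral.integral_const_mul,
    mul_left_comm (π : ℂ)⁻¹,    hmain]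
  have hpow : ((t ^ (-((n : ℝ) / 2)) : ℝ) : ℂ) * ((√t : ℝ) : ℂ) ^ n = 1 := by
    have : t ^ (-((n : ℝ) / 2)) * √t ^ n = 1 := by
      rw [Real.sqrt_eq_rpow, ← Real.rpow_natCast, ← Real.rpow_mul ht0.le, ← Real.rpow_add ht0,
        show -((n : ℝ) / 2) + 1 / 2 * n = 0 by ring, Real.rpow_zero]
    exact_mod_cast this
  have h1 := qPoch_ne_zero_of_norm_lt_one hq hq n
  have h2 := qPoch_ne_zero_of_norm_lt_one hq htn2 n
  generalize qPoch ((t : ℂ) ^ 2) q n = A at *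
  field_simp
  linear_combination (-(qUltraExp q t n u * qUltraExp q t n v)) * hpow

end ProductFormula

end SepVar
theorem mainTheorem1 (q g t : ℝ) (hq0 : 0 < q) (hq1 : q < 1) (hg : 0 < g) (ht : t = q ^ g)
    (ξ : ℂ) (hξ : ξ ≠ 0) (l₁ l₂ : ℤ) (hl : l₁ ≤ l₂) :
    (∀ y₁ y₂ yp ym : ℂ, y₁ ≠ 0 → y₂ ≠ 0 → yp * ym = y₁ → yp / ym = y₂ →
      SepVar.Generic q (SepVar.sepParams t yp ym) →
        (∀ᶠ ε in nhdsWithin (0 : ℝ) (Set.Ioi 0),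
          SepVar.SmallRadius q (SepVar.sepParams t yp ym) ε) ∧
        ∀ ε : ℝ, SepVar.SmallRadius q (SepVar.sepParams t yp ym) ε →
          SepVar.sepOp q g ξ ε (SepVar.macdonaldP q t l₁ l₂) yp ym =
            SepVar.sepCoeff q t ξ l₁ l₂ *
              (SepVar.sepPoly q t l₁ l₂ y₁ * SepVar.sepPoly q t l₁ l₂ y₂)) ∧
    (∀ θ φ : ℝ,
      SepVar.Generic q (SepVar.sepParams t (t * SepVar.expI (-θ - φ)) (SepVar.expI (φ - θ))) ∧
      ∀ ε : ℝ, 0 < ε →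
        (SepVar.sepOp q g ξ ε (SepVar.macdonaldP q t l₁ l₂)
              (t * SepVar.expI (-θ - φ)) (SepVar.expI (φ - θ)) =
            SepVar.sepCoeff q t ξ l₁ l₂ *
              (SepVar.sepPoly q t l₁ l₂ (t * SepVar.expI (-2 * θ)) *
                SepVar.sepPoly q t l₁ l₂ (t * SepVar.expI (-2 * φ))) ↔
          SepVar.ProductFormulaAt q t (l₂ - l₁).toNat (Real.cos θ) (Real.cos φ))) := by
  have ht0 : 0 < t := ht ▸ Real.rpow_pos_of_pos hq0 g
  have ht1 : t < 1 := ht ▸ Real.rpow_lt_one hq0.le hq1 hg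
  have htc : (t : ℂ) ≠ 0 := by exact_mod_cast ht0.ne'
  have hs0 : 0 < √t := Real.sqrt_pos.2 ht0
  have hs1 : √t < 1 := by rw [Real.sqrt_lt' one_pos]; simpa using ht1
  have hsc : ((√t : ℝ) : ℂ) ≠ 0 := by exact_mod_cast hs0.ne'
  constructor
  · intro y₁ y₂ yp ym hy₁ _ h₁ h₂ hgen
    have hyp : yp ≠ 0 := by rintro rfl; simp [← h₁] at hy₁
    have hym : ym ≠ 0 := by rintro rfl; simp [← h₁] at hy₁
    -- `u` and `v = u / ym` are square roots of `y₁ / t` and `y₂ / t`.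
    obtain ⟨u, hu2⟩ := IsAlgClosed.exists_pow_nat_eq (yp / t * ym) (n := 2) two_pos
    have hu : u ≠ 0 := by
      rintro rfl
      rw [zero_pow two_ne_zero, eq_comm] at hu2
      exact mul_ne_zero (div_ne_zero hyp htc) hym hu2
    have hv : u / ym ≠ 0 := div_ne_zero hu hym
    have e1 : yp = t * (u * (u / ym)) := by
      rw [← mul_div_assoc, ← sq, hu2]; field_simp
    have e2 : ym = u / (u / ym) := by field_simp
    have e3 : y₁ = t * u ^ 2 := by rw [hu2, ← h₁]; field_simp
    have e4 : y₂ = t * (u / ym) ^ 2 := by rw [div_pow, hu2, ← h₂]; field_simp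
    generalize u / ym = v at *
    subst e1 e2 e3 e4
    refine ⟨?_, fun ε hε => SepVar.sepOp_macdonaldP hq0 hq1 hg ht hξ hl hu hv hgen hε⟩
    rw [SepVar.sepParams_eq ht0 rfl]
    exact SepVar.eventually_smallRadius hq0 hq1 (SepVar.finite_params _ _ _ _)
      (SepVar.zero_notMem_sepParams hsc hu hv)
  · intro θ φ
    have e1 : SepVar.expI (-θ - φ) = SepVar.expI (-θ) * SepVar.expI (-φ) := by
      rw [← SepVar.expI_add, sub_eq_add_neg]
    have e2 : SepVar.expI (φ - θ) = SepVar.expI (-θ) / SepVar.expI (-φ) := by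
      rw [← SepVar.expI_sub, neg_sub_neg]
    have e3 : ∀ ψ : ℝ, SepVar.expI (-2 * ψ) = SepVar.expI (-ψ) ^ 2 := fun ψ => by
      rw [← SepVar.expI_two_mul, neg_mul, mul_neg]
    have hu := SepVar.expI_ne_zero (-θ)
    have hv := SepVar.expI_ne_zero (-φ)
    have hun := SepVar.norm_expI (-θ)
    have hvn := SepVar.norm_expI (-φ)
    rw [e1, e2, e3, e3]
    generalize SepVar.expI (-θ) = u at *
    generalize SepVar.expI (-φ) = v at *
    have hS : ∀ a ∈ SepVar.sepParams t (t * (u * v)) (u / v), ‖a‖ < 1 := by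
      rw [SepVar.sepParams_eq ht0 rfl]
      rintro a (rfl | rfl | rfl | rfl) <;>
        simpa [hun, hvn] using SepVar.norm_ofReal_lt_one hs0 hs1
    have hf : (SepVar.sepParams t (t * (u * v)) (u / v)).Finite :=
      SepVar.finite_params _ _ _ _
    have h0 : (0 : ℂ) ∉ SepVar.sepParams t (t * (u * v)) (u / v) := by
      rw [SepVar.sepParams_eq ht0 rfl]
      exact SepVar.zero_notMem_sepParams hsc hu hv
    have hgen := SepVar.generic_of_norm_lt_one hq0 hq1 h0 hS
    -- both identities are instances of `sepNorm_mul_awIntegral`, and all four parameters lie inside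
    -- the unit disc, so that every `ε` is admissible
    refine ⟨hgen, fun ε hε => iff_of_true ?_ ?_⟩
    · exact SepVar.sepOp_macdonaldP hq0 hq1 hg ht hξ hl hu hv hgen
        (SepVar.admissible_of_norm_lt_one hq0 hq1 hf h0 hS hε).small
    · exact SepVar.productFormulaAt hq0 hq1 ht0 ht1 _
        ⟨Real.neg_one_le_cos θ, Real.cos_le_one θ⟩ ⟨Real.neg_one_le_cos φ, Real.cos_le_one φ⟩
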